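/- **Proposition 3.1.** Write $\langle v\rangle=(1+|v|^2)^{1/2}$, $\Pi(z)=\mathrm{Id}-\frac{z\otimes z}{|z|^2}$, and for $g:\mathbb R^3\to\mathbb R$ $$A[g]=\frac{\Pi(v)}{8\pi|v|}*g,\qquad a[g]=\frac{1}{4\pi|v|}*g .$$ Fix $p>\frac32$, $m>\frac92\,\frac{p-1}{p-3/2}$, $M>0$ and $N\in\mathbb R$. There are a time $T_0>0$ and a constant $C$, depending only on $p$, $m$, $M$ and $N$, such that the following holds for every $T>0$. Let $f:[0,T]\times\mathbb R^3\to[0,\infty)$ be a smooth, rapidly decaying solution of the homogeneous Landau–Coulomb equation $$\partial_t f=\nabla\cdot\bigl(A[f]\nabla f-f\,\nabla a[f]\bigr),$$ that is, $f$ is continuous on $[0,T]\times\mathbb R^3$, is $C^\infty$ on $(0,T)\times\mathbb R^3$, satisfies $\sup_{0<t<T,\,v\in\mathbb R^3}|v|^k|D_v^nf(t,v)|<\infty$ for all integers $k,n\ge0$, and satisfies the equation pointwise on $(0,T)\times\mathbb R^3$. Suppose that its initial datum $f_{in}=f(0,\cdot)$ satisfies $$\int_{\mathbb R^3} f_{in}\,dv=1,\qquad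 \int_{\mathbb R^3} v\,f_{in}\,dv=0,\qquad \int_{\mathbb R^3}|v|^2f_{in}\,dv=3,$$ $$\int_{\mathbb R^3}\langle v\rangle^m f_{in}\,dv+\int_{\mathbb R^3}f_{in}\,|\log f_{in}|\,dv\le M,\qquad \|f_{in}\|_{L^p}\le N .$$ Then $$\sup_{t\in(0,\min(T,T_0))}\|f(t)\|_{L^p}^p+\int_0^{\min(T,T_0)}\int_{\mathbb R^3}\langle v\rangle^{-3}\bigl|\nabla f^{p/2}\bigr|^2\,dv\,dt\le C .$$ -/

import Mathlib

open MeasureTheory Set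
open scoped ContDiff ENNReal

namespace Landau

noncomputable section

/-- Velocity space `ℝ³` with its Euclidean norm. -/
abbrev Vel : Type := EuclideanSpace ℝ (Fin 3)

/-- The Japanese bracket `⟨v⟩ = (1 + |v|²)^{1/2}`. -/
def bracket (v : Vel) : ℝ := Real.sqrt (1 + ‖v‖ ^ 2)

/-- The matrix `Π(z) = Id - z ⊗ z / |z|²`. -/
def proj (z : Vel) : Matrix (Fin 3) (Fin 3) ℝ :=
  Matrix.of fun i j => (if i = j then 1 else 0) - z i * z j / ‖z‖ ^ 2

/-- The diffusion matrix `A[g] = (Π(v) / (8π|v|)) * g` (convolution, entry by entry). -/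
def diffusion (g : Vel → ℝ) (v : Vel) : Matrix (Fin 3) (Fin 3) ℝ :=
  Matrix.of fun i j => ∫ w, proj (v - w) i j / (8 * Real.pi * ‖v - w‖) * g w

/-- The Coulomb potential `a[g] = (-Δ)⁻¹ g = (1 / (4π|v|)) * g`. -/
def potential (g : Vel → ℝ) (v : Vel) : ℝ :=
  ∫ w, 1 / (4 * Real.pi * ‖v - w‖) * g w

/-- The partial derivative `∂ᵢ g (v)`. -/
def partialDeriv (i : Fin 3) (g : Vel → ℝ) (v : Vel) : ℝ :=
  fderiv ℝ g v (EuclideanSpace.single i 1)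

/-- The `i`-th component of `A[g]∇g - g ∇a[g]`. -/
def flux (g : Vel → ℝ) (i : Fin 3) (v : Vel) : ℝ :=
  (∑ j, diffusion g v i j * partialDeriv j g v) - partialDeriv i (potential g) v * g v

/-- The collision operator `∇ · (A[g]∇g - g ∇a[g])`. -/
def collision (g : Vel → ℝ) (v : Vel) : ℝ :=
  ∑ i, partialDeriv i (flux g i) v

/-- `f : [0,T] × ℝ³ → [0,∞)` is a smooth, rapidly decaying solution of the Landau-Coulomb equation:
it is continuous up to the initial time and smooth in the interior, it belongs to the Schwartz class
in the velocity variable uniformly in time, and it solves the equation pointwise.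
Only the values `f t v` with `0 ≤ t ≤ T` matter. -/
structure IsSchwartzSolution (T : ℝ) (f : ℝ → Vel → ℝ) : Prop where
  nonneg : ∀ t ∈ Icc 0 T, ∀ v, 0 ≤ f t v
  continuousOn : ContinuousOn (fun x : ℝ × Vel => f x.1 x.2) (Icc 0 T ×ˢ univ)
  smooth : ContDiffOn ℝ ∞ (fun x : ℝ × Vel => f x.1 x.2) (Ioo 0 T ×ˢ univ)
  decay : ∀ k n : ℕ, ∃ C : ℝ, ∀ t ∈ Ioo 0 T, ∀ v,
    ‖v‖ ^ k * ‖iteratedFDeriv ℝ n (f t) v‖ ≤ C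
  equation : ∀ t ∈ Ioo 0 T, ∀ v, HasDerivAt (fun s => f s v) (collision (f t) v) t

/-- The normalization of mass, momentum and energy: `∫ g = 1`, `∫ v g = 0`, `∫ |v|² g = 3`. -/
def IsNormalized (g : Vel → ℝ) : Prop :=
  (∫ v, g v = 1) ∧ (∫ v, g v • v = 0) ∧ (∫ v, ‖v‖ ^ 2 * g v = 3)

end

end Landau

/-!
In nondivergence form the collision operator is `A[f] : D²f + f²`, so only the quadratic term can
make `∫ f ^ p` grow. Multiplying the equation by `p f ^ (p - 1)` and integrating by parts,

  `d/dt ∫ f ^ p = -(4 (p - 1) / p) ∫ A[f] ∇f^(p/2) · ∇f^(p/2) + (p - 1) ∫ f ^ (p + 1)`.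

As long as the mass is bounded below and the energy and the `Lᵖ` norm are bounded above, `f` cannot
concentrate near a line, so that `A[f] ≥ c ⟨v⟩⁻³` and the first term controls the dissipation
`∫ ⟨v⟩⁻³ |∇f^(p/2)|²`. The Sobolev inequality for `⟨v⟩^(-3/2) f^(p/2)` bounds `f` in a weighted
`L^(3p)` by this dissipation, and Hölder's inequality interpolates `∫ f ^ (p + 1)` between that
norm, `∫ ⟨v⟩ᵐ f` and `∫ f ^ p`. The condition on `m` is exactly what lets the dissipation enter with
a power less than one, so that half of it survives. The moment `∫ ⟨v⟩ᵐ f` grows at most linearly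
because `|v|⁻¹ * f` is bounded in terms of the mass and the `Lᵖ` norm (here `p > 3 / 2`). Both
growth rates are thus bounded while `∫ f ^ p` and the moment exceed their initial bounds by at most
one, and a continuity argument gives a time up to which they do.
-/

namespace Landau

open scoped SchwartzMap LineDeriv Topology
open Filter

noncomputable section

/-! ### Decay and growth -/

section growth

variable {E : Type*} [NormedAddCommGroup E]

/-- `g` decays faster than every power of `1 + ‖v‖`; unlike for Schwartz functions, nothing is asked
of the derivatives, so that real powers are allowed. -/
def RapidDecay (g : E → ℝ) : Prop :=
  ∀ k : ℕ, ∃ C, 0 ≤ C ∧ ∀ v, |g v| ≤ C * ((1 + ‖v‖) ^ k)⁻¹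

/-- `u` grows at most polynomially; nothing is asked of its derivatives. -/
def PolyGrowth (u : E → ℝ) : Prop :=
  ∃ (n : ℕ) (C : ℝ), 0 ≤ C ∧ ∀ v, |u v| ≤ C * (1 + ‖v‖) ^ n

variable {u w g h : E → ℝ}

lemma PolyGrowth.of_bound {C : ℝ} (hu : ∀ v, |u v| ≤ C) : PolyGrowth u :=
  ⟨0, C, (abs_nonneg _).trans (hu 0), by simpa using hu⟩

lemma PolyGrowth.const (c : ℝ) : PolyGrowth fun _ : E => c := .of_bound fun _ => le_rfl

lemma PolyGrowth.mul (hu : PolyGrowth u) (hw : PolyGrowth w) : PolyGrowth fun v => u v * w v := by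
  obtain ⟨n, C, hC, hu⟩ := hu
  obtain ⟨k, D, hD, hw⟩ := hw
  refine ⟨n + k, C * D, by positivity, fun v => ?_⟩
  calc |u v * w v| = |u v| * |w v| := abs_mul _ _
    _ ≤ (C * (1 + ‖v‖) ^ n) * (D * (1 + ‖v‖) ^ k) := by gcongr; exacts [hu v, hw v]
    _ = C * D * (1 + ‖v‖) ^ (n + k) := by ring

lemma PolyGrowth.mul_rapidDecay (hu : PolyGrowth u) (hg : RapidDecay g) :
    RapidDecay fun v => u v * g v := by
  obtain ⟨n, C, hC, hu⟩ := hu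
  intro k
  obtain ⟨D, hD, hg⟩ := hg (n + k)
  refine ⟨C * D, by positivity, fun v => ?_⟩
  calc |u v * g v| = |u v| * |g v| := abs_mul _ _
    _ ≤ (C * (1 + ‖v‖) ^ n) * (D * ((1 + ‖v‖) ^ (n + k))⁻¹) := by gcongr; exacts [hu v, hg v]
    _ = C * D * ((1 + ‖v‖) ^ k)⁻¹ := by rw [pow_add]; field_simp

lemma RapidDecay.mul_polyGrowth (hg : RapidDecay g) (hu : PolyGrowth u) :
    RapidDecay fun v => g v * u v := by
  simpa only [mul_comm] using hu.mul_rapidDecay hg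

lemma RapidDecay.mono (hg : RapidDecay g) (hh : ∀ v, |h v| ≤ |g v|) : RapidDecay h := fun k =>
  let ⟨C, hC, hg⟩ := hg k
  ⟨C, hC, fun v => (hh v).trans (hg v)⟩

lemma RapidDecay.exists_bound (hg : RapidDecay g) : ∃ C, 0 ≤ C ∧ ∀ v, |g v| ≤ C := by
  simpa using hg 0

lemma RapidDecay.polyGrowth (hg : RapidDecay g) : PolyGrowth g :=
  let ⟨_, _, hg⟩ := hg.exists_bound
  .of_bound hg

lemma RapidDecay.mul (hg : RapidDecay g) (hh : RapidDecay h) : RapidDecay fun v => g v * h v :=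
  hg.mul_polyGrowth hh.polyGrowth

lemma RapidDecay.const_mul (hg : RapidDecay g) (c : ℝ) : RapidDecay fun v => c * g v :=
  (PolyGrowth.const c).mul_rapidDecay hg

lemma RapidDecay.add (hg : RapidDecay g) (hh : RapidDecay h) : RapidDecay fun v => g v + h v := by
  intro k
  obtain ⟨C, hC, hg⟩ := hg k
  obtain ⟨D, hD, hh⟩ := hh k
  refine ⟨C + D, by positivity, fun v => ?_⟩
  rw [add_mul]
  exact (abs_add_le _ _).trans (add_le_add (hg v) (hh v))

lemma RapidDecay.sub (hg : RapidDecay g) (hh : RapidDecay h) : RapidDecay fun v => g v - h v := by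
  simpa only [neg_one_mul, ← sub_eq_add_neg] using hg.add (hh.const_mul (-1))

lemma RapidDecay.sum {ι : Type*} {s : Finset ι} {g : ι → E → ℝ} (hg : ∀ i ∈ s, RapidDecay (g i)) :
    RapidDecay fun v => ∑ i ∈ s, g i v := by
  classical
  induction s using Finset.induction_on with
  | empty => exact fun k => ⟨0, le_rfl, by simp⟩
  | insert a s ha ih =>
    simp only [Finset.sum_insert ha]
    exact (hg a (by simp)).add (ih fun i hi => hg i (by simp [hi]))

lemma RapidDecay.rpow (hg : RapidDecay g) (h0 : ∀ v, 0 ≤ g v) {q : ℝ} (hq : 0 < q) :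
    RapidDecay fun v => g v ^ q := by
  intro k
  obtain ⟨n, hn⟩ := exists_nat_ge ((k : ℝ) / q)
  obtain ⟨C, hC, hg⟩ := hg n
  refine ⟨C ^ q, by positivity, fun v => ?_⟩
  have hv : g v ≤ C * ((1 + ‖v‖) ^ n)⁻¹ := (le_abs_self _).trans (hg v)
  rw [abs_of_nonneg (Real.rpow_nonneg (h0 v) q)]
  calc g v ^ q ≤ (C * ((1 + ‖v‖) ^ n)⁻¹) ^ q := Real.rpow_le_rpow (h0 v) hv hq.le
    _ = C ^ q * ((1 + ‖v‖) ^ ((n : ℝ) * q))⁻¹ := by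
        rw [Real.mul_rpow hC (by positivity), Real.inv_rpow (by positivity),
          ← Real.rpow_natCast, ← Real.rpow_mul (by positivity)]
    _ ≤ C ^ q * ((1 + ‖v‖) ^ k)⁻¹ := by
        rw [← Real.rpow_natCast (1 + ‖v‖) k]
        gcongr
        · simp
        · rwa [div_le_iff₀ hq] at hn

lemma exists_norm_iteratedFDeriv_schwartz_le {F : Type*} [NormedSpace ℝ E] [NormedAddCommGroup F]
    [NormedSpace ℝ F] (g : 𝓢(E, F)) (k n : ℕ) :
    ∃ C, 0 ≤ C ∧ ∀ v, ‖iteratedFDeriv ℝ n g v‖ ≤ C * ((1 + ‖v‖) ^ k)⁻¹ := by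
  refine ⟨2 ^ k * (Finset.Iic (k, n)).sup (fun m => SchwartzMap.seminorm ℝ m.1 m.2) g,
    by positivity, fun v => ?_⟩
  rw [← div_eq_mul_inv, le_div_iff₀ (by positivity), mul_comm]
  exact SchwartzMap.one_add_le_sup_seminorm_apply (𝕜 := ℝ) (m := (k, n)) le_rfl le_rfl g v

lemma rapidDecay_schwartz [NormedSpace ℝ E] (g : 𝓢(E, ℝ)) : RapidDecay g := fun k => by
  simpa using exists_norm_iteratedFDeriv_schwartz_le g k 0

section integrability

variable [NormedSpace ℝ E] [FiniteDimensional ℝ E] [MeasurableSpace E] [BorelSpace E]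
  {μ : Measure E} [μ.IsAddHaarMeasure]

lemma integrable_inv_one_add_norm_pow {k : ℕ} (hk : Module.finrank ℝ E < k) :
    Integrable (fun v : E => ((1 + ‖v‖) ^ k)⁻¹) μ := by
  refine (integrable_one_add_norm (E := E) (μ := μ) (r := k) (mod_cast hk)).congr
    (ae_of_all _ fun v => ?_)
  simp only [Real.rpow_neg (by positivity : 0 ≤ 1 + ‖v‖), Real.rpow_natCast]

lemma RapidDecay.integrable (hg : RapidDecay g) (hm : AEStronglyMeasurable g μ) :
    Integrable g μ := by
  obtain ⟨C, -, hg⟩ := hg (Module.finrank ℝ E + 1)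
  exact ((integrable_inv_one_add_norm_pow (Nat.lt_succ_self _)).const_mul C).mono' hm
    (ae_of_all _ hg)

end integrability

end growth

section partialDeriv

/-- The partial derivative of a Schwartz function, as a Schwartz function. -/
def pderiv (i : Fin 3) (g : 𝓢(Vel, ℝ)) : 𝓢(Vel, ℝ) :=
  ∂_{(EuclideanSpace.single i (1 : ℝ) : Vel)} g

lemma pderiv_apply (i : Fin 3) (g : 𝓢(Vel, ℝ)) (v : Vel) : pderiv i g v = partialDeriv i g v := by
  simp [pderiv, partialDeriv, SchwartzMap.lineDerivOp_apply_eq_fderiv]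

lemma abs_partialDeriv_le (i : Fin 3) (g : Vel → ℝ) (v : Vel) :
    |partialDeriv i g v| ≤ ‖fderiv ℝ g v‖ := by
  simpa [partialDeriv] using (fderiv ℝ g v).le_opNorm (EuclideanSpace.single i 1)

lemma measurable_partialDeriv (i : Fin 3) (u : Vel → ℝ) : Measurable (partialDeriv i u) :=
  measurable_fderiv_apply_const ℝ u _

lemma partialDeriv_mul {u w : Vel → ℝ} {v : Vel} (i : Fin 3) (hu : DifferentiableAt ℝ u v)
    (hw : DifferentiableAt ℝ w v) :
    partialDeriv i (fun x => u x * w x) v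
      = u v * partialDeriv i w v + partialDeriv i u v * w v := by
  simp only [partialDeriv]
  rw [fderiv_fun_mul hu hw]
  simp [mul_comm]

lemma partialDeriv_comp_const_sub (i : Fin 3) (k : Vel → ℝ) (v w : Vel) :
    partialDeriv i (fun x => k (v - x)) w = -partialDeriv i k (v - w) := by
  have hsub := fderiv_comp_sub (𝕜 := ℝ) (f := fun y => k (-y)) (x := w) v
  have hneg := (ContinuousLinearEquiv.neg ℝ (M := Vel)).comp_right_fderiv (f := k) (x := w - v)
  simp only [neg_sub] at hsub
  simp_all [partialDeriv, Function.comp_def]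

lemma integral_mul_partialDeriv {u w : Vel → ℝ} (i : Fin 3) (hu : Differentiable ℝ u)
    (hw : Differentiable ℝ w) (huw' : Integrable fun v => partialDeriv i u v * w v)
    (hu'w : Integrable fun v => u v * partialDeriv i w v) (huw : Integrable fun v => u v * w v) :
    ∫ v, u v * partialDeriv i w v = -∫ v, partialDeriv i u v * w v :=
  integral_mul_fderiv_eq_neg_fderiv_mul_of_integrable huw' hu'w huw (fun x _ => hu x)
    (fun x _ => hw x)

end partialDeriv

/-! ### Convolution with singular kernels -/

section conv

/-- The convolution `k * g`, in the form in which it enters `diffusion` and `potential`. -/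
def conv (k g : Vel → ℝ) (v : Vel) : ℝ := ∫ w, k (v - w) * g w

/-- A measurable kernel dominated by `c / |z|`; its value at `0` is irrelevant. -/
structure CoulombDominated (c : ℝ) (k : Vel → ℝ) : Prop where
  nonneg : 0 ≤ c
  measurable : Measurable k
  bound : ∀ z, z ≠ 0 → |k z| ≤ c * ‖z‖⁻¹

lemma coulombDominated_inv_norm : CoulombDominated 1 fun z : Vel => ‖z‖⁻¹ where
  nonneg := zero_le_one
  measurable := by fun_prop
  bound z _ := by rw [abs_of_nonneg (by positivity), one_mul]

/-- The part of `|z|^{-s}` near its singularity. -/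
def nearPow (s : ℝ) : Vel → ℝ := indicator (Metric.ball 0 1) fun z => ‖z‖ ^ (-s)

lemma nearPow_nonneg (s : ℝ) (z : Vel) : 0 ≤ nearPow s z :=
  indicator_nonneg (fun _ _ => by positivity) z

lemma integrable_nearPow {s : ℝ} (hs : s < 3) : Integrable (nearPow s) := by
  rw [nearPow, integrable_indicator_iff Metric.isOpen_ball.measurableSet]
  refine integrableOn_ball_of_norm_le_rpow (C := 1) (α := s) (by simp) (by simpa using hs)
    (ae_of_all _ fun x => ?_) (measurable_norm.pow_const _).aestronglyMeasurable
  rw [Real.norm_of_nonneg (by positivity), one_mul]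

lemma inv_norm_le_nearPow_add_one (z : Vel) : ‖z‖⁻¹ ≤ nearPow 1 z + 1 := by
  by_cases h : z ∈ Metric.ball (0 : Vel) 1
  · simp [nearPow, h, Real.rpow_neg_one]
  · rw [nearPow, indicator_of_notMem h, zero_add]
    exact inv_le_one_of_one_le₀ (by simpa using h)

lemma integrable_inv_one_add_norm_pow_four : Integrable fun w : Vel => ((1 + ‖w‖) ^ 4)⁻¹ :=
  integrable_inv_one_add_norm_pow (by simp)

/-- A bound, uniform in `v`, for `∫ |v - w|⁻¹ (1 + |w|)⁻⁴ dw`. -/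
def newtonianBound : ℝ := (∫ z, nearPow 1 z) + ∫ w : Vel, ((1 + ‖w‖) ^ 4)⁻¹

lemma newtonianBound_nonneg : 0 ≤ newtonianBound :=
  add_nonneg (integral_nonneg (nearPow_nonneg 1)) (integral_nonneg fun _ => by positivity)

lemma inv_norm_mul_inv_pow_four_le (v w : Vel) : ‖v - w‖⁻¹ * ((1 + ‖w‖) ^ 4)⁻¹
    ≤ nearPow 1 (v - w) + ((1 + ‖w‖) ^ 4)⁻¹ := by
  have hle : ((1 + ‖w‖) ^ 4)⁻¹ ≤ 1 := inv_le_one_of_one_le₀ (one_le_pow₀ (by simp))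
  have hnn : 0 ≤ ((1 + ‖w‖) ^ 4)⁻¹ := by positivity
  nlinarith [inv_norm_le_nearPow_add_one (v - w), nearPow_nonneg 1 (v - w)]

lemma integrable_inv_norm_mul_inv_pow_four (v : Vel) :
    Integrable fun w : Vel => ‖v - w‖⁻¹ * ((1 + ‖w‖) ^ 4)⁻¹ := by
  refine (((integrable_nearPow (s := 1) (by norm_num)).comp_sub_left v).add
    integrable_inv_one_add_norm_pow_four).mono' (Measurable.aestronglyMeasurable (by fun_prop))
    (ae_of_all _ fun w => ?_)
  rw [Real.norm_of_nonneg (by positivity)]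
  exact inv_norm_mul_inv_pow_four_le v w

lemma integral_inv_norm_mul_inv_pow_four_le (v : Vel) :
    ∫ w : Vel, ‖v - w‖⁻¹ * ((1 + ‖w‖) ^ 4)⁻¹ ≤ newtonianBound := by
  have hnear := (integrable_nearPow (s := 1) (by norm_num)).comp_sub_left v
  refine (integral_mono (integrable_inv_norm_mul_inv_pow_four v)
    (hnear.add integrable_inv_one_add_norm_pow_four)
    (inv_norm_mul_inv_pow_four_le v)).trans_eq ?_
  simp only [Pi.add_apply]
  rw [integral_add hnear integrable_inv_one_add_norm_pow_four,
    integral_sub_left_eq_self (nearPow 1) volume v, newtonianBound]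

lemma conv_comm (k g : Vel → ℝ) : conv k g = conv g k := by
  funext v
  rw [conv, ← integral_sub_left_eq_self _ volume v]
  simp only [sub_sub_cancel, mul_comm, conv]

variable {c : ℝ} {k : Vel → ℝ}

lemma CoulombDominated.ae_norm_mul_le (hk : CoulombDominated c k) {C : ℝ} {g : Vel → ℝ}
    (hg : ∀ w, |g w| ≤ C * ((1 + ‖w‖) ^ 4)⁻¹) (v : Vel) :
    ∀ᵐ w, ‖k (v - w) * g w‖ ≤ c * C * (‖v - w‖⁻¹ * ((1 + ‖w‖) ^ 4)⁻¹) := by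
  have hc := hk.nonneg
  filter_upwards [Measure.ae_ne _ v] with w hw
  rw [norm_mul, Real.norm_eq_abs, Real.norm_eq_abs]
  calc |k (v - w)| * |g w| ≤ (c * ‖v - w‖⁻¹) * (C * ((1 + ‖w‖) ^ 4)⁻¹) := by
        gcongr
        exacts [hk.bound _ (sub_ne_zero.mpr hw.symm), hg w]
    _ = c * C * (‖v - w‖⁻¹ * ((1 + ‖w‖) ^ 4)⁻¹) := by ring

lemma integrable_conv (hk : CoulombDominated c k) {g : Vel → ℝ} (hg : RapidDecay g)
    (hm : Measurable g) (v : Vel) : Integrable fun w => k (v - w) * g w := by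
  obtain ⟨C, -, hC⟩ := hg 4
  exact ((integrable_inv_norm_mul_inv_pow_four v).const_mul (c * C)).mono'
    ((hk.measurable.comp (measurable_const.sub measurable_id)).mul hm).aestronglyMeasurable
    (hk.ae_norm_mul_le hC v)

lemma abs_conv_le (hk : CoulombDominated c k) {C : ℝ} {g : Vel → ℝ}
    (hg : ∀ v, |g v| ≤ C * ((1 + ‖v‖) ^ 4)⁻¹) (v : Vel) :
    |conv k g v| ≤ c * C * newtonianBound := by
  have hC : 0 ≤ C := by simpa using (abs_nonneg _).trans (hg 0)
  calc |conv k g v| ≤ ∫ w, c * C * (‖v - w‖⁻¹ * ((1 + ‖w‖) ^ 4)⁻¹) :=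
        norm_integral_le_of_norm_le ((integrable_inv_norm_mul_inv_pow_four v).const_mul _)
          (hk.ae_norm_mul_le hg v)
    _ = c * C * ∫ w : Vel, ‖v - w‖⁻¹ * ((1 + ‖w‖) ^ 4)⁻¹ := integral_const_mul _ _
    _ ≤ c * C * newtonianBound := mul_le_mul_of_nonneg_left
        (integral_inv_norm_mul_inv_pow_four_le v) (mul_nonneg hk.nonneg hC)

lemma polyGrowth_conv (hk : CoulombDominated c k) (g : 𝓢(Vel, ℝ)) : PolyGrowth (conv k g) :=
  let ⟨_, _, hg⟩ := rapidDecay_schwartz g 4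
  .of_bound (abs_conv_le hk hg)

lemma inv_one_add_norm_sub_pow_four_le {v x : Vel} (hx : ‖x - v‖ ≤ 1) (z : Vel) :
    ((1 + ‖x - z‖) ^ 4)⁻¹ ≤ 16 * ((1 + ‖v - z‖) ^ 4)⁻¹ := by
  have htri : 1 + ‖v - z‖ ≤ 2 * (1 + ‖x - z‖) := by
    have := norm_sub_le_norm_sub_add_norm_sub v x z
    rw [norm_sub_rev v x] at this
    linarith [norm_nonneg (x - z)]
  rw [← div_eq_mul_inv, le_div_iff₀ (by positivity), inv_mul_le_iff₀ (by positivity)]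
  calc (1 + ‖v - z‖) ^ 4 ≤ (2 * (1 + ‖x - z‖)) ^ 4 := by gcongr
    _ = (1 + ‖x - z‖) ^ 4 * 16 := by ring

lemma exists_integrable_bound_smul_fderiv (hk : CoulombDominated c k) (g : 𝓢(Vel, ℝ)) (v : Vel) :
    ∃ b : Vel → ℝ, Integrable b ∧
      ∀ z, z ≠ 0 → ∀ x ∈ Metric.ball v 1, ‖k z • fderiv ℝ g (x - z)‖ ≤ b z := by
  obtain ⟨C, hC, hg⟩ := exists_norm_iteratedFDeriv_schwartz_le g 4 1
  simp only [norm_iteratedFDeriv_one] at hg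
  have hc := hk.nonneg
  refine ⟨fun z => c * (C * 16) * (‖z‖⁻¹ * ((1 + ‖v - z‖) ^ 4)⁻¹), ?_, fun z hz x hx => ?_⟩
  · simpa using ((integrable_inv_norm_mul_inv_pow_four v).comp_sub_left v).const_mul (c * (C * 16))
  · rw [Metric.mem_ball, dist_eq_norm] at hx
    rw [norm_smul, Real.norm_eq_abs]
    calc |k z| * ‖fderiv ℝ g (x - z)‖
        ≤ (c * ‖z‖⁻¹) * (C * (16 * ((1 + ‖v - z‖) ^ 4)⁻¹)) := by
          gcongr
          · exact hk.bound z hz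
          · exact (hg _).trans (by gcongr; exact inv_one_add_norm_sub_pow_four_le hx.le z)
      _ = c * (C * 16) * (‖z‖⁻¹ * ((1 + ‖v - z‖) ^ 4)⁻¹) := by ring

lemma integrable_smul_fderiv (hk : CoulombDominated c k) (g : 𝓢(Vel, ℝ)) (v : Vel) :
    Integrable fun z => k z • fderiv ℝ g (v - z) := by
  obtain ⟨b, hb, hle⟩ := exists_integrable_bound_smul_fderiv hk g v
  have hcont : Continuous (fderiv ℝ g) := (g.smooth 1).continuous_fderiv one_ne_zero
  exact hb.mono' (hk.measurable.aestronglyMeasurable.smul (by fun_prop))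
    ((Measure.ae_ne _ 0).mono fun z hz => hle z hz v (Metric.mem_ball_self one_pos))

lemma hasFDerivAt_conv (hk : CoulombDominated c k) (g : 𝓢(Vel, ℝ)) (v : Vel) :
    HasFDerivAt (conv k g) (∫ z, k z • fderiv ℝ g (v - z)) v := by
  obtain ⟨b, hb, hle⟩ := exists_integrable_bound_smul_fderiv hk g v
  have hderiv : ∀ z x, HasFDerivAt (fun x => g (x - z) * k z) (k z • fderiv ℝ g (x - z)) x :=
    fun z x => (hasFDerivAt_comp_sub z).2 (g.hasFDerivAt (x - z)) |>.mul_const (k z)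
  rw [conv_comm]
  refine hasFDerivAt_integral_of_dominated_of_fderiv_le (F := fun x z => g (x - z) * k z)
    (Metric.ball_mem_nhds v one_pos)
    (Eventually.of_forall fun x => ((g.continuous.measurable.comp
      (measurable_const.sub measurable_id)).mul hk.measurable).aestronglyMeasurable) ?_
    (integrable_smul_fderiv hk g v).1 ((Measure.ae_ne _ 0).mono hle) hb
    (ae_of_all _ fun z x _ => hderiv z x)
  simpa [mul_comm] using (integrable_conv hk (rapidDecay_schwartz g)
    g.continuous.measurable v).comp_sub_left v

lemma differentiable_conv (hk : CoulombDominated c k) (g : 𝓢(Vel, ℝ)) :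
    Differentiable ℝ (conv k g) := fun v => (hasFDerivAt_conv hk g v).differentiableAt

lemma continuous_conv (hk : CoulombDominated c k) (g : 𝓢(Vel, ℝ)) : Continuous (conv k g) :=
  (differentiable_conv hk g).continuous

lemma partialDeriv_conv (hk : CoulombDominated c k) (g : 𝓢(Vel, ℝ)) (i : Fin 3) :
    partialDeriv i (conv k g) = conv k (pderiv i g) := by
  funext v
  rw [partialDeriv, (hasFDerivAt_conv hk g v).fderiv,
    ContinuousLinearMap.integral_apply (integrable_smul_fderiv hk g v), conv_comm]
  simp [conv, pderiv_apply, partialDeriv, mul_comm]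

lemma tendsto_conv {κ : ℕ → Vel → ℝ} (hκ : ∀ n, CoulombDominated c (κ n))
    (hlim : ∀ z, z ≠ 0 → Tendsto (fun n => κ n z) atTop (𝓝 (k z))) (g : 𝓢(Vel, ℝ)) (v : Vel) :
    Tendsto (fun n => conv (κ n) g v) atTop (𝓝 (conv k g v)) := by
  obtain ⟨C, -, hg⟩ := rapidDecay_schwartz g 4
  exact tendsto_integral_of_dominated_convergence _
    (fun n => (integrable_conv (hκ n) (rapidDecay_schwartz g) g.continuous.measurable v).1)
    ((integrable_inv_norm_mul_inv_pow_four v).const_mul _)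
    (fun n => (hκ n).ae_norm_mul_le hg v)
    ((Measure.ae_ne _ v).mono fun w hw => (hlim _ (sub_ne_zero.mpr hw.symm)).mul_const _)

lemma tendsto_integral_mul_conv {κ : ℕ → Vel → ℝ} (hκ : ∀ n, CoulombDominated c (κ n))
    (hlim : ∀ z, z ≠ 0 → Tendsto (fun n => κ n z) atTop (𝓝 (k z))) (g : 𝓢(Vel, ℝ))
    {u : Vel → ℝ} (hu : Integrable u) :
    Tendsto (fun n => ∫ v, u v * conv (κ n) g v) atTop (𝓝 (∫ v, u v * conv k g v)) := by
  obtain ⟨C, -, hg⟩ := rapidDecay_schwartz g 4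
  refine tendsto_integral_of_dominated_convergence (fun v => |u v| * (c * C * newtonianBound))
    (fun n => hu.1.mul (continuous_conv (hκ n) g).aestronglyMeasurable)
    (hu.abs.mul_const _) (fun n => ae_of_all _ fun v => ?_)
    (ae_of_all _ fun v => (tendsto_conv hκ hlim g v).const_mul _)
  rw [Real.norm_eq_abs, abs_mul]
  exact mul_le_mul_of_nonneg_left (abs_conv_le (hκ n) hg v) (abs_nonneg _)

lemma conv_pderiv (hk : Differentiable ℝ k) {b b' : ℝ} (hb : ∀ z, |k z| ≤ b) (i : Fin 3)
    (hb' : ∀ z, |partialDeriv i k z| ≤ b') (g : 𝓢(Vel, ℝ)) :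
    conv k (pderiv i g) = conv (partialDeriv i k) g := by
  funext v
  have hdiff : Differentiable ℝ fun w => k (v - w) := hk.comp (by fun_prop)
  have hbdd : ∀ h : 𝓢(Vel, ℝ), Integrable fun w => k (v - w) * h w := fun h =>
    h.integrable.bdd_mul (c := b) hdiff.continuous.aestronglyMeasurable (ae_of_all _ fun w => hb _)
  have hbdd' : Integrable fun w => -partialDeriv i k (v - w) * g w :=
    g.integrable.bdd_mul (c := b') ((measurable_partialDeriv i k).comp
      (measurable_const.sub measurable_id)).neg.aestronglyMeasurable
      (ae_of_all _ fun w => by simpa using hb' (v - w))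
  have hparts := integral_mul_partialDeriv (u := fun w => k (v - w)) (w := g) i hdiff
    g.differentiable (by simpa only [partialDeriv_comp_const_sub] using hbdd')
    (by simpa only [← pderiv_apply] using hbdd (pderiv i g)) (hbdd g)
  simp only [conv, pderiv_apply, hparts, partialDeriv_comp_const_sub, neg_mul, integral_neg,
    neg_neg]

end conv

/-! ### Powers of nonnegative functions -/

section NonnegC11

variable {E : Type*} [NormedAddCommGroup E] [NormedSpace ℝ E]

lemma hasFDerivAt_zero_of_abs_le_rpow {f : E → ℝ} {x : E} {C s : ℝ} (hs : 1 < s)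
    (h : ∀ y, |f y| ≤ C * ‖y - x‖ ^ s) : HasFDerivAt f (0 : E →L[ℝ] ℝ) x := by
  have hfx : f x = 0 := by simpa [Real.zero_rpow (by linarith : s ≠ 0)] using h x
  have hlim : Tendsto (fun y => ‖y - x‖ ^ (s - 1)) (𝓝 x) (𝓝 0) := by
    have hc : Continuous fun y => ‖y - x‖ ^ (s - 1) :=
      (by fun_prop : Continuous fun y => ‖y - x‖).rpow_const fun _ => .inr (by linarith)
    simpa [Real.zero_rpow (by linarith : s - 1 ≠ 0)] using hc.tendsto x
  have hpow : (fun y => ‖y - x‖ ^ s) =o[𝓝 x] fun y => ‖y - x‖ := by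
    refine Asymptotics.isLittleO_of_tendsto' (.of_forall fun y hy => ?_) (hlim.congr fun y => ?_)
    · rw [hy, Real.zero_rpow (by linarith)]
    · rcases eq_or_ne ‖y - x‖ 0 with h0 | h0
      · rw [h0, div_zero, Real.zero_rpow (by linarith)]
      · rw [Real.rpow_sub_one h0]
  rw [hasFDerivAt_iff_isLittleO]
  simp only [hfx, sub_zero, zero_apply]
  exact ((Asymptotics.IsBigO.of_bound' (.of_forall fun y => (h y).trans (le_abs_self _))).trans
    (Asymptotics.isBigO_const_mul_self C _ _)).trans_isLittleO hpow |>.of_norm_right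

/-- A nonnegative differentiable function whose derivative is `L`-Lipschitz. Such functions satisfy
`|∇g|² ≤ 4 L g`, so that their powers `g ^ q` with `1 / 2 < q` are still `C¹`. -/
structure NonnegC11 (L : ℝ) (g : E → ℝ) : Prop where
  nonneg : ∀ v, 0 ≤ g v
  diff : Differentiable ℝ g
  lip : ∀ x y, ‖fderiv ℝ g x - fderiv ℝ g y‖ ≤ L * ‖x - y‖

lemma exists_nonnegC11 (g : 𝓢(E, ℝ)) (h0 : ∀ v, 0 ≤ g v) : ∃ L, NonnegC11 L g := by
  obtain ⟨C, hC⟩ : ∃ C, ∀ v, ‖fderiv ℝ (fderiv ℝ g) v‖ ≤ C := by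
    have h := SchwartzMap.one_add_le_sup_seminorm_apply (𝕜 := ℝ) (m := (0, 1)) le_rfl le_rfl
      (SchwartzMap.fderivCLM ℝ E ℝ g)
    refine ⟨_, fun v => le_trans (le_of_eq ?_) (h v)⟩
    rw [norm_iteratedFDeriv_one, pow_zero, one_mul]
    rfl
  exact ⟨C, h0, g.differentiable, fun x y => convex_univ.norm_image_sub_le_of_norm_fderiv_le
    (fun z _ => (SchwartzMap.fderivCLM ℝ E ℝ g).differentiable z) (fun z _ => hC z)
    (mem_univ y) (mem_univ x)⟩

namespace NonnegC11

variable [Nontrivial E] {L q : ℝ} {g : E → ℝ}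

lemma const_nonneg (h : NonnegC11 L g) : 0 ≤ L := by
  obtain ⟨x, y, hxy⟩ := exists_pair_ne E
  exact nonneg_of_mul_nonneg_left ((norm_nonneg _).trans (h.lip x y)) (norm_sub_pos_iff.mpr hxy)

lemma taylor (h : NonnegC11 L g) (x y : E) :
    g y ≤ g x + fderiv ℝ g x (y - x) + L * ‖y - x‖ ^ 2 := by
  have hb := (convex_closedBall x ‖y - x‖).norm_image_sub_le_of_norm_hasFDerivWithin_le'
    (f := g) (f' := fderiv ℝ g) (φ := fderiv ℝ g x) (C := L * ‖y - x‖) (x := x) (y := y)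
    (fun z _ => (h.diff z).hasFDerivAt.hasFDerivWithinAt)
    (fun z hz => (h.lip z x).trans
      (mul_le_mul_of_nonneg_left (mem_closedBall_iff_norm.mp hz) h.const_nonneg))
    (by simp) (by simp [dist_eq_norm])
  linarith [(abs_le.mp hb).2]

lemma norm_fderiv_le (h : NonnegC11 L g) (v : E) : ‖fderiv ℝ g v‖ ≤ 2 * √(L * g v) := by
  refine ContinuousLinearMap.opNorm_le_bound _ (by positivity) fun e => ?_
  have hq (t : ℝ) : 0 ≤ (L * ‖e‖ ^ 2) * (t * t) + (fderiv ℝ g v e) * t + g v := by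
    have := (h.nonneg _).trans (h.taylor v (v + t • e))
    simp only [add_sub_cancel_left, map_smul, smul_eq_mul, norm_smul, Real.norm_eq_abs,
      mul_pow, sq_abs] at this
    linarith
  have hd := discrim_le_zero hq
  rw [discrim] at hd
  rw [Real.norm_eq_abs]
  refine abs_le_of_sq_le_sq ?_ (by positivity)
  rw [mul_pow, mul_pow, Real.sq_sqrt (mul_nonneg h.const_nonneg (h.nonneg v))]
  linarith

lemma fderiv_eq_zero (h : NonnegC11 L g) {v : E} (hv : g v = 0) : fderiv ℝ g v = 0 := by
  simpa [hv] using h.norm_fderiv_le v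

lemma hasFDerivAt_rpow_of_eq_zero (h : NonnegC11 L g) (hq : 1 / 2 < q) {v : E} (hv : g v = 0) :
    HasFDerivAt (fun x => g x ^ q) (0 : E →L[ℝ] ℝ) v :=
  hasFDerivAt_zero_of_abs_le_rpow (C := L ^ q) (s := 2 * q) (by linarith) fun y => by
    rw [abs_of_nonneg (Real.rpow_nonneg (h.nonneg y) q)]
    have ht : g y ≤ L * ‖y - v‖ ^ 2 := by
      simpa only [hv, h.fderiv_eq_zero hv, zero_apply, zero_add] using h.taylor v y
    calc g y ^ q ≤ (L * ‖y - v‖ ^ 2) ^ q := Real.rpow_le_rpow (h.nonneg y) ht (by linarith)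
      _ = L ^ q * ‖y - v‖ ^ (2 * q) := by
        rw [Real.mul_rpow h.const_nonneg (by positivity), ← Real.rpow_natCast,
          ← Real.rpow_mul (norm_nonneg _), Nat.cast_ofNat]

lemma hasFDerivAt_rpow (h : NonnegC11 L g) (hq : 1 / 2 < q) (v : E) :
    HasFDerivAt (fun x => g x ^ q) ((q * g v ^ (q - 1)) • fderiv ℝ g v) v := by
  rcases (h.nonneg v).eq_or_lt' with h0 | h0
  · simpa [h.fderiv_eq_zero h0] using h.hasFDerivAt_rpow_of_eq_zero hq h0
  · exact (h.diff v).hasFDerivAt.rpow_const (.inl h0.ne')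

lemma differentiable_rpow (h : NonnegC11 L g) (hq : 1 / 2 < q) :
    Differentiable ℝ fun x => g x ^ q := fun v => (h.hasFDerivAt_rpow hq v).differentiableAt

lemma fderiv_rpow (h : NonnegC11 L g) (hq : 1 / 2 < q) (v : E) :
    fderiv ℝ (fun x => g x ^ q) v = (q * g v ^ (q - 1)) • fderiv ℝ g v :=
  (h.hasFDerivAt_rpow hq v).fderiv

lemma norm_fderiv_rpow_le (h : NonnegC11 L g) (hq : 1 / 2 < q) (v : E) :
    ‖fderiv ℝ (fun x => g x ^ q) v‖ ≤ 2 * q * √L * g v ^ (q - 1 / 2) := by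
  have hq0 : 0 ≤ q := by linarith
  have hpow (s : ℝ) : 0 ≤ g v ^ s := Real.rpow_nonneg (h.nonneg v) s
  rw [h.fderiv_rpow hq v, norm_smul, Real.norm_of_nonneg (mul_nonneg hq0 (hpow _))]
  rcases (h.nonneg v).eq_or_lt' with h0 | h0
  · rw [h.fderiv_eq_zero h0, norm_zero, mul_zero]
    exact mul_nonneg (by positivity) (hpow _)
  · calc q * g v ^ (q - 1) * ‖fderiv ℝ g v‖ ≤ q * g v ^ (q - 1) * (2 * √(L * g v)) := by
          gcongr
          exact h.norm_fderiv_le v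
      _ = 2 * q * √L * (g v ^ (q - 1) * g v ^ (1 / 2 : ℝ)) := by
          rw [Real.sqrt_mul h.const_nonneg, Real.sqrt_eq_rpow (g v)]
          ring
      _ = _ := by
          rw [← Real.rpow_add h0]
          ring_nf

lemma continuous_fderiv (h : NonnegC11 L g) : Continuous (fderiv ℝ g) :=
  (LipschitzWith.of_dist_le_mul (K := ⟨L, h.const_nonneg⟩) fun x y => by
    rw [dist_eq_norm, dist_eq_norm]
    exact h.lip x y).continuous

lemma continuous_fderiv_rpow (h : NonnegC11 L g) (hq : 1 / 2 < q) :
    Continuous (fderiv ℝ fun x => g x ^ q) := by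
  refine continuous_iff_continuousAt.mpr fun v => ?_
  rcases (h.nonneg v).eq_or_lt' with h0 | h0
  · rw [ContinuousAt, h.fderiv_rpow hq v, h.fderiv_eq_zero h0, smul_zero]
    refine squeeze_zero_norm (h.norm_fderiv_rpow_le hq) ?_
    have hc : Continuous fun v => 2 * q * √L * g v ^ (q - 1 / 2) :=
      continuous_const.mul (h.diff.continuous.rpow_const fun _ => .inr (by linarith))
    simpa only [h0, Real.zero_rpow (by linarith : q - 1 / 2 ≠ 0), mul_zero] using hc.tendsto v
  · rw [funext (h.fderiv_rpow hq)]
    exact (continuousAt_const.mul (h.diff.continuous.continuousAt.rpow_const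
      (.inl h0.ne'))).smul h.continuous_fderiv.continuousAt

lemma contDiff_rpow (h : NonnegC11 L g) (hq : 1 / 2 < q) : ContDiff ℝ 1 fun x => g x ^ q :=
  contDiff_one_iff_fderiv.mpr ⟨h.differentiable_rpow hq, h.continuous_fderiv_rpow hq⟩

lemma partialDeriv_rpow {g : Vel → ℝ} (h : NonnegC11 L g) (hq : 1 / 2 < q) (i : Fin 3) (v : Vel) :
    partialDeriv i (fun x => g x ^ q) v = q * g v ^ (q - 1) * partialDeriv i g v := by
  simp [partialDeriv, h.fderiv_rpow hq v]

end NonnegC11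

end NonnegC11

section rpow

variable {g : 𝓢(Vel, ℝ)} {q : ℝ}

lemma integrable_rpow (h0 : ∀ v, 0 ≤ g v) (hq : 0 < q) : Integrable fun v => g v ^ q :=
  ((rapidDecay_schwartz g).rpow h0 hq).integrable
    (g.continuous.rpow_const fun _ => .inr hq.le).aestronglyMeasurable

lemma rapidDecay_partialDeriv_rpow (h0 : ∀ v, 0 ≤ g v) (hq : 1 / 2 < q) (i : Fin 3) :
    RapidDecay (partialDeriv i fun v => g v ^ q) := by
  obtain ⟨L, hL⟩ := exists_nonnegC11 g h0
  exact (((rapidDecay_schwartz g).rpow h0 (by linarith : 0 < q - 1 / 2)).const_mul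
    (2 * q * √L)).mono fun v => (abs_partialDeriv_le i _ v).trans
    ((hL.norm_fderiv_rpow_le hq v).trans (le_abs_self _))

end rpow

/-! ### Regularisation of the kernels -/

/-- An even differentiable kernel, bounded together with its derivatives, with `|k| ≤ c / |z|` and
`|∂ᵢ k| ≤ c / |z|²`. Only the oddness of the derivatives is recorded. The bounds `bounded` and
`deriv_bounded` are qualitative: every estimate depends on `c` alone and so survives the limit to
the singular kernels. -/
structure IsRegularKernel (c : ℝ) (k : Vel → ℝ) : Prop extends CoulombDominated c k where
  diff : Differentiable ℝ k
  odd : ∀ i z, partialDeriv i k (-z) = -partialDeriv i k z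
  deriv_bound : ∀ i z, z ≠ 0 → |partialDeriv i k z| ≤ c * (‖z‖⁻¹) ^ 2
  bounded : ∃ b, ∀ z, |k z| ≤ b
  deriv_bounded : ∃ b, ∀ i z, |partialDeriv i k z| ≤ b

/-- The regularisation `(|z|² + ε²)^{-1/2}` of `1 / |z|`. -/
def regInv (ε : ℝ) (z : Vel) : ℝ := (√(‖z‖ ^ 2 + ε ^ 2))⁻¹

lemma abs_coord_le (v : Vel) (i : Fin 3) : |v i| ≤ ‖v‖ := by
  simpa using PiLp.norm_apply_le v i

section regInv

variable {ε : ℝ}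

lemma regInv_pos (hε : 0 < ε) (z : Vel) : 0 < regInv ε z := by
  unfold regInv; positivity

lemma regInv_sq_mul (hε : 0 < ε) (z : Vel) : regInv ε z ^ 2 * (‖z‖ ^ 2 + ε ^ 2) = 1 := by
  rw [regInv, inv_pow, Real.sq_sqrt (by positivity)]
  exact inv_mul_cancel₀ (by positivity)

lemma regInv_mul_norm_le (hε : 0 < ε) (z : Vel) : regInv ε z * ‖z‖ ≤ 1 := by
  refine le_of_abs_le (abs_le_one_iff_mul_self_le_one.mpr ?_)
  linarith [regInv_sq_mul hε z, mul_nonneg (sq_nonneg (regInv ε z)) (sq_nonneg ε)]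

lemma regInv_le (hε : 0 < ε) (z : Vel) : regInv ε z ≤ ε⁻¹ := by
  rw [regInv]
  gcongr
  exact Real.le_sqrt_of_sq_le (by linarith [sq_nonneg ‖z‖])

lemma regInv_le_inv_norm (hε : 0 < ε) {z : Vel} (hz : z ≠ 0) : regInv ε z ≤ ‖z‖⁻¹ := by
  rw [← one_div, le_div_iff₀ (norm_pos_iff.mpr hz)]
  exact regInv_mul_norm_le hε z

lemma abs_regInv_mul_coord_le (hε : 0 < ε) (z : Vel) (i : Fin 3) : |regInv ε z * z i| ≤ 1 := by
  rw [abs_mul, abs_of_pos (regInv_pos hε z)]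
  exact (mul_le_mul_of_nonneg_left (abs_coord_le z i) (regInv_pos hε z).le).trans
    (regInv_mul_norm_le hε z)

lemma regInv_neg (ε : ℝ) (z : Vel) : regInv ε (-z) = regInv ε z := by simp [regInv]

lemma hasFDerivAt_regInv (hε : 0 < ε) (z : Vel) :
    HasFDerivAt (regInv ε) ((-regInv ε z ^ 3) • innerSL ℝ z) z := by
  have hq : 0 < ‖z‖ ^ 2 + ε ^ 2 := by positivity
  have hinner : HasFDerivAt (fun z : Vel => ‖z‖ ^ 2 + ε ^ 2) ((2 : ℝ) • innerSL ℝ z) z := by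
    have h := (hasStrictFDerivAt_norm_sq z).hasFDerivAt.add_const (ε ^ 2)
    rwa [two_nsmul, ← two_smul ℝ] at h
  convert! ((Real.hasDerivAt_sqrt hq.ne').inv (by positivity)).comp_hasFDerivAt z hinner using 1
  rw [smul_smul]
  congr 1
  have : √(‖z‖ ^ 2 + ε ^ 2) ≠ 0 := by positivity
  rw [regInv]
  field_simp

lemma tendsto_regInv {z : Vel} (hz : z ≠ 0) :
    Tendsto (fun n : ℕ => regInv (1 / ((n : ℝ) + 1)) z) atTop (𝓝 ‖z‖⁻¹) := by
  have h0 : Tendsto (fun n : ℕ => ‖z‖ ^ 2 + (1 / ((n : ℝ) + 1)) ^ 2) atTop (𝓝 (‖z‖ ^ 2)) := by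
    simpa using (tendsto_one_div_add_atTop_nhds_zero_nat (𝕜 := ℝ)).pow 2 |>.const_add (‖z‖ ^ 2)
  have h1 := (Real.continuous_sqrt.tendsto _).comp h0
  rw [Real.sqrt_sq (norm_nonneg z)] at h1
  exact h1.inv₀ (norm_ne_zero_iff.mpr hz)

lemma isRegularKernel_of_abs_le_regInv (hε : 0 < ε) {k : Vel → ℝ} (hd : Differentiable ℝ k)
    (hodd : ∀ i z, partialDeriv i k (-z) = -partialDeriv i k z) (hk : ∀ z, |k z| ≤ regInv ε z)
    (hk' : ∀ i z, |partialDeriv i k z| ≤ regInv ε z ^ 2) : IsRegularKernel 1 k where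
  nonneg := zero_le_one
  measurable := hd.continuous.measurable
  bound z hz := by
    rw [one_mul]
    exact (hk z).trans (regInv_le_inv_norm hε hz)
  diff := hd
  odd := hodd
  deriv_bound i z hz := by
    rw [one_mul]
    exact (hk' i z).trans (pow_le_pow_left₀ (regInv_pos hε z).le (regInv_le_inv_norm hε hz) 2)
  bounded := ⟨ε⁻¹, fun z => (hk z).trans (regInv_le hε z)⟩
  deriv_bounded := ⟨ε⁻¹ ^ 2, fun i z =>
    (hk' i z).trans (pow_le_pow_left₀ (regInv_pos hε z).le (regInv_le hε z) 2)⟩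

end regInv

/-- The kernel `1 / (4π|z|)` of the potential `a[g]`. -/
def coulombKernel (z : Vel) : ℝ := 1 / (4 * Real.pi * ‖z‖)

/-- The kernel `Π(z)ᵢⱼ / (8π|z|)` of the entry `A[g]ᵢⱼ`. -/
def landauKernel (i j : Fin 3) (z : Vel) : ℝ := proj z i j / (8 * Real.pi * ‖z‖)

/-- The regularisation of `coulombKernel` with `1 / |z|` replaced by `regInv ε z`. -/
def regCoulomb (ε : ℝ) (z : Vel) : ℝ := (4 * Real.pi)⁻¹ * regInv ε z

/-- The regularisation of `landauKernel` with each `1 / |z|` replaced by `regInv ε z`. -/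
def regLandau (ε : ℝ) (i j : Fin 3) (z : Vel) : ℝ :=
  (8 * Real.pi)⁻¹ * ((if i = j then 1 else 0) * regInv ε z - z i * z j * regInv ε z ^ 3)

lemma diffusion_eq (g : Vel → ℝ) (v : Vel) (i j : Fin 3) :
    diffusion g v i j = conv (landauKernel i j) g v := rfl

lemma potential_eq (g : Vel → ℝ) : potential g = conv coulombKernel g := rfl

lemma abs_delta_le (i j : Fin 3) : |(if i = j then 1 else 0 : ℝ)| ≤ 1 := by
  split_ifs <;> simp

lemma abs_mul_le_one {a b : ℝ} (ha : |a| ≤ 1) (hb : |b| ≤ 1) : |a * b| ≤ 1 := by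
  rw [abs_mul]
  exact mul_le_one₀ ha (abs_nonneg _) hb

lemma inv_four_pi_le : (4 * Real.pi)⁻¹ ≤ 1 :=
  inv_le_one_of_one_le₀ (by linarith [Real.pi_gt_three])

lemma inv_eight_pi_le : (8 * Real.pi)⁻¹ ≤ 1 / 6 := by
  rw [one_div]
  gcongr
  linarith [Real.pi_gt_three]

lemma coulombDominated_coulombKernel : CoulombDominated 1 coulombKernel where
  nonneg := zero_le_one
  measurable := by unfold coulombKernel; fun_prop
  bound z _ := by
    rw [coulombKernel, abs_of_nonneg (by positivity), one_div, mul_inv]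
    gcongr
    exact inv_four_pi_le

lemma abs_proj_le {z : Vel} (hz : z ≠ 0) (i j : Fin 3) : |proj z i j| ≤ 2 := by
  have hn : 0 < ‖z‖ := norm_pos_iff.mpr hz
  have hcoord : |z i * z j / ‖z‖ ^ 2| ≤ 1 := by
    rw [abs_div, abs_mul, abs_of_pos (by positivity : 0 < ‖z‖ ^ 2), div_le_one (by positivity), sq]
    exact mul_le_mul (abs_coord_le z i) (abs_coord_le z j) (abs_nonneg _) hn.le
  exact (abs_sub _ _).trans (by linarith [abs_delta_le i j])

lemma coulombDominated_landauKernel (i j : Fin 3) : CoulombDominated 1 (landauKernel i j) where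
  nonneg := zero_le_one
  measurable := by
    unfold landauKernel proj
    simp only [Matrix.of_apply]
    fun_prop
  bound z hz := by
    have : 0 < ‖z‖ := norm_pos_iff.mpr hz
    calc |landauKernel i j z| = |proj z i j| * (8 * Real.pi)⁻¹ * ‖z‖⁻¹ := by
          rw [landauKernel, abs_div, abs_of_pos (by positivity : 0 < 8 * Real.pi * ‖z‖),
            div_eq_mul_inv, mul_inv, ← mul_assoc]
      _ ≤ 2 * (1 / 6) * ‖z‖⁻¹ := by
          gcongr
          exacts [abs_proj_le hz i j, inv_eight_pi_le]
      _ ≤ 1 * ‖z‖⁻¹ := by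
          gcongr
          norm_num

lemma innerSL_single (z : Vel) (i : Fin 3) :
    innerSL ℝ z (EuclideanSpace.single i 1) = z i := by
  simp [EuclideanSpace.inner_single_right]

lemma hasFDerivAt_coord (i : Fin 3) (z : Vel) :
    HasFDerivAt (fun z : Vel => z i) (EuclideanSpace.proj i : Vel →L[ℝ] ℝ) z :=
  (EuclideanSpace.proj i : Vel →L[ℝ] ℝ).hasFDerivAt

section regularisation

variable {ε : ℝ}

lemma differentiable_regCoulomb (hε : 0 < ε) : Differentiable ℝ (regCoulomb ε) :=
  fun z => ((hasFDerivAt_regInv hε z).const_mul _).differentiableAt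

lemma partialDeriv_regCoulomb (hε : 0 < ε) (i : Fin 3) (z : Vel) :
    partialDeriv i (regCoulomb ε) z = (4 * Real.pi)⁻¹ * (-regInv ε z ^ 3 * z i) := by
  have h : HasFDerivAt (regCoulomb ε) _ z := (hasFDerivAt_regInv hε z).const_mul (4 * Real.pi)⁻¹
  rw [partialDeriv, h.fderiv]
  simp [EuclideanSpace.inner_single_right]

lemma isRegularKernel_regCoulomb (hε : 0 < ε) : IsRegularKernel 1 (regCoulomb ε) := by
  refine isRegularKernel_of_abs_le_regInv hε (differentiable_regCoulomb hε) (fun i z => ?_)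
    (fun z => ?_) fun i z => ?_ <;> have hr := regInv_pos hε z
  · simp only [partialDeriv_regCoulomb hε, regInv_neg, PiLp.neg_apply]
    ring
  · rw [regCoulomb, abs_of_pos (by positivity)]
    exact mul_le_of_le_one_left hr.le inv_four_pi_le
  · calc |partialDeriv i (regCoulomb ε) z|
        = (4 * Real.pi)⁻¹ * (regInv ε z ^ 2 * |regInv ε z * z i|) := by
          rw [partialDeriv_regCoulomb hε, abs_mul, abs_mul, abs_mul, abs_neg, abs_pow,
            abs_of_pos hr, abs_of_pos (by positivity : 0 < (4 * Real.pi)⁻¹)]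
          ring
      _ ≤ 1 * (regInv ε z ^ 2 * 1) := by
          gcongr
          exacts [inv_four_pi_le, abs_regInv_mul_coord_le hε z i]
      _ = _ := by ring

lemma differentiable_regLandau (hε : 0 < ε) (i j : Fin 3) : Differentiable ℝ (regLandau ε i j) :=
  fun z => ((((hasFDerivAt_regInv hε z).const_mul _).sub (((hasFDerivAt_coord i z).mul
    (hasFDerivAt_coord j z)).mul ((hasFDerivAt_regInv hε z).pow 3))).const_mul _).differentiableAt

lemma partialDeriv_regLandau (hε : 0 < ε) (i j l : Fin 3) (z : Vel) :
    partialDeriv l (regLandau ε i j) z = (8 * Real.pi)⁻¹ * (regInv ε z ^ 2 *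
      (-((if i = j then 1 else 0) * (regInv ε z * z l))
        + 3 * (regInv ε z * z i * (regInv ε z * z j) * (regInv ε z * z l))
        - regInv ε z * z i * (if j = l then 1 else 0)
        - regInv ε z * z j * (if i = l then 1 else 0))) := by
  have hr := hasFDerivAt_regInv hε z
  have h : HasFDerivAt (regLandau ε i j) _ z := ((hr.const_mul (if i = j then 1 else 0 : ℝ)).sub
    (((hasFDerivAt_coord i z).mul (hasFDerivAt_coord j z)).mul (hr.pow 3))).const_mul
      (8 * Real.pi)⁻¹
  rw [partialDeriv, h.fderiv]
  split_ifs <;> simp_all [EuclideanSpace.inner_single_right] <;> ring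

lemma abs_regLandau_le (hε : 0 < ε) (i j : Fin 3) (z : Vel) :
    |regLandau ε i j z| ≤ regInv ε z := by
  have hr := regInv_pos hε z
  have hδ := abs_delta_le i j
  have hij := abs_mul_le_one (abs_regInv_mul_coord_le hε z i) (abs_regInv_mul_coord_le hε z j)
  have hsum : |(if i = j then 1 else 0) - regInv ε z * z i * (regInv ε z * z j)| ≤ 6 :=
    (abs_sub _ _).trans (by linarith)
  have hfactor : regLandau ε i j z = (8 * Real.pi)⁻¹ * (regInv ε z *
      ((if i = j then 1 else 0) - regInv ε z * z i * (regInv ε z * z j))) := by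
    rw [regLandau]
    ring
  rw [hfactor, abs_mul, abs_mul, abs_of_pos (by positivity : 0 < (8 * Real.pi)⁻¹), abs_of_pos hr]
  calc _ ≤ 1 / 6 * (regInv ε z * 6) := by
        gcongr
        exact inv_eight_pi_le
    _ = _ := by ring

lemma abs_partialDeriv_regLandau_le (hε : 0 < ε) (i j l : Fin 3) (z : Vel) :
    |partialDeriv l (regLandau ε i j) z| ≤ regInv ε z ^ 2 := by
  have hc := abs_regInv_mul_coord_le hε z
  have h1 := abs_mul_le_one (abs_delta_le i j) (hc l)
  have h2 := abs_mul_le_one (abs_mul_le_one (hc i) (hc j)) (hc l)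
  have h3 := abs_mul_le_one (hc i) (abs_delta_le j l)
  have h4 := abs_mul_le_one (hc j) (abs_delta_le i l)
  rw [partialDeriv_regLandau hε, abs_mul, abs_mul, abs_of_pos (by positivity : 0 < (8 * Real.pi)⁻¹),
    abs_of_nonneg (sq_nonneg (regInv ε z))]
  calc _ ≤ 1 / 6 * (regInv ε z ^ 2 * 6) := by
        gcongr
        · exact inv_eight_pi_le
        · rw [abs_le] at h1 h2 h3 h4 ⊢
          constructor <;> linarith
    _ = _ := by ring

lemma isRegularKernel_regLandau (hε : 0 < ε) (i j : Fin 3) :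
    IsRegularKernel 1 (regLandau ε i j) := by
  refine isRegularKernel_of_abs_le_regInv hε (differentiable_regLandau hε i j) (fun l z => ?_)
    (abs_regLandau_le hε i j) (abs_partialDeriv_regLandau_le hε i j)
  simp only [partialDeriv_regLandau hε, regInv_neg, PiLp.neg_apply]
  ring

end regularisation

/-- A kernel dominated by `1 / |z|` that is, off the origin, a pointwise limit of regular kernels
satisfying the same bounds. -/
def IsApproximable (k : Vel → ℝ) : Prop :=
  CoulombDominated 1 k ∧ ∃ κ : ℕ → Vel → ℝ, (∀ n, IsRegularKernel 1 (κ n)) ∧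
    ∀ z, z ≠ 0 → Tendsto (fun n => κ n z) atTop (𝓝 (k z))

lemma tendsto_regCoulomb {z : Vel} (hz : z ≠ 0) :
    Tendsto (fun n : ℕ => regCoulomb (1 / ((n : ℝ) + 1)) z) atTop (𝓝 (coulombKernel z)) := by
  have := (tendsto_regInv hz).const_mul (4 * Real.pi)⁻¹
  simpa only [coulombKernel, ← mul_inv, one_div] using! this

lemma isApproximable_coulombKernel : IsApproximable coulombKernel :=
  ⟨coulombDominated_coulombKernel, fun n => regCoulomb (1 / ((n : ℝ) + 1)),
    fun n => isRegularKernel_regCoulomb (by positivity), fun _ hz => tendsto_regCoulomb hz⟩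

lemma tendsto_regLandau (i j : Fin 3) {z : Vel} (hz : z ≠ 0) :
    Tendsto (fun n : ℕ => regLandau (1 / ((n : ℝ) + 1)) i j z) atTop (𝓝 (landauKernel i j z)) := by
  have hr := tendsto_regInv hz
  have hn : ‖z‖ ≠ 0 := norm_ne_zero_iff.mpr hz
  have hpi := Real.pi_ne_zero
  convert! ((hr.const_mul (if i = j then 1 else 0 : ℝ)).sub
    ((hr.pow 3).const_mul (z i * z j))).const_mul (8 * Real.pi)⁻¹ using 2
  simp only [landauKernel, proj, Matrix.of_apply]
  field_simp

lemma isApproximable_landauKernel (i j : Fin 3) : IsApproximable (landauKernel i j) :=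
  ⟨coulombDominated_landauKernel i j, fun n => regLandau (1 / ((n : ℝ) + 1)) i j,
    fun n => isRegularKernel_regLandau (by positivity) i j, fun _ hz => tendsto_regLandau i j hz⟩

/-! ### Weak form of the collision operator -/

section weak

lemma coe_flux (g : 𝓢(Vel, ℝ)) (i : Fin 3) : flux g i = fun v =>
    (∑ j, conv (landauKernel i j) g v * pderiv j g v)
      - conv coulombKernel (pderiv i g) v * g v := by
  funext v
  simp only [flux, diffusion_eq, potential_eq, partialDeriv_conv coulombDominated_coulombKernel,
    pderiv_apply]

lemma differentiable_flux (g : 𝓢(Vel, ℝ)) (i : Fin 3) : Differentiable ℝ (flux g i) := by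
  rw [coe_flux]
  exact .sub (.fun_sum fun j _ => (differentiable_conv (coulombDominated_landauKernel i j) g).mul
      (pderiv j g).differentiable)
    ((differentiable_conv coulombDominated_coulombKernel (pderiv i g)).mul g.differentiable)

lemma rapidDecay_conv_mul {k : Vel → ℝ} {c : ℝ} (hk : CoulombDominated c k) (g h : 𝓢(Vel, ℝ)) :
    RapidDecay fun v => conv k g v * h v :=
  (polyGrowth_conv hk g).mul_rapidDecay (rapidDecay_schwartz h)

lemma rapidDecay_flux (g : 𝓢(Vel, ℝ)) (i : Fin 3) : RapidDecay (flux g i) := by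
  rw [coe_flux]
  exact (RapidDecay.sum fun j _ => rapidDecay_conv_mul (coulombDominated_landauKernel i j) g _).sub
    (rapidDecay_conv_mul coulombDominated_coulombKernel _ g)

lemma partialDeriv_conv_mul {k : Vel → ℝ} {c : ℝ} (hk : CoulombDominated c k) (g h : 𝓢(Vel, ℝ))
    (i : Fin 3) (v : Vel) : partialDeriv i (fun v => conv k g v * h v) v =
      conv k g v * pderiv i h v + conv k (pderiv i g) v * h v := by
  rw [partialDeriv_mul i (differentiable_conv hk g v) h.differentiable.differentiableAt,
    partialDeriv_conv hk, pderiv_apply]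

lemma partialDeriv_flux (g : 𝓢(Vel, ℝ)) (i : Fin 3) : partialDeriv i (flux g i) = fun v =>
    (∑ j, (conv (landauKernel i j) g v * pderiv i (pderiv j g) v
        + conv (landauKernel i j) (pderiv i g) v * pderiv j g v))
      - (conv coulombKernel (pderiv i g) v * pderiv i g v
        + conv coulombKernel (pderiv i (pderiv i g)) v * g v) := by
  funext v
  have hA (j : Fin 3) :
      DifferentiableAt ℝ (fun v => conv (landauKernel i j) g v * pderiv j g v) v :=
    (differentiable_conv (coulombDominated_landauKernel i j) g v).mul
      (pderiv j g).differentiable.differentiableAt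
  have ha : DifferentiableAt ℝ (fun v => conv coulombKernel (pderiv i g) v * g v) v :=
    (differentiable_conv coulombDominated_coulombKernel (pderiv i g) v).mul
      g.differentiable.differentiableAt
  rw [coe_flux, partialDeriv, fderiv_fun_sub (DifferentiableAt.fun_sum fun j _ => hA j) ha,
    fderiv_fun_sum fun j _ => hA j]
  simp only [sub_apply, sum_apply]
  exact congrArg₂ _ (Finset.sum_congr rfl fun j _ =>
      partialDeriv_conv_mul (coulombDominated_landauKernel i j) g (pderiv j g) i v)
    (partialDeriv_conv_mul coulombDominated_coulombKernel (pderiv i g) g i v)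

lemma rapidDecay_partialDeriv_flux (g : 𝓢(Vel, ℝ)) (i : Fin 3) :
    RapidDecay (partialDeriv i (flux g i)) := by
  rw [partialDeriv_flux]
  have hA (j : Fin 3) := rapidDecay_conv_mul (coulombDominated_landauKernel i j)
  have ha := rapidDecay_conv_mul coulombDominated_coulombKernel
  exact (RapidDecay.sum fun j _ => (hA j _ _).add (hA j _ _)).sub ((ha _ _).add (ha _ _))

lemma measurable_collision (g : Vel → ℝ) : Measurable (collision g) :=
  Finset.measurable_fun_sum _ fun i _ => measurable_partialDeriv i _

lemma integral_mul_collision (g : 𝓢(Vel, ℝ)) {u : Vel → ℝ} (hu : Differentiable ℝ u)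
    (hp : PolyGrowth u) (hp' : ∀ i, PolyGrowth (partialDeriv i u)) :
    ∫ v, u v * collision g v = -∑ i, ∫ v, partialDeriv i u v * flux g i v := by
  have hum := hu.continuous.measurable
  have hfm (i : Fin 3) := (differentiable_flux g i).continuous.measurable
  have hint (i : Fin 3) : Integrable fun v => u v * partialDeriv i (flux g i) v :=
    (hp.mul_rapidDecay (rapidDecay_partialDeriv_flux g i)).integrable
      (hum.mul (measurable_partialDeriv i _)).aestronglyMeasurable
  simp only [collision, Finset.mul_sum]
  rw [integral_finsetSum _ fun i _ => hint i, ← Finset.sum_neg_distrib]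
  exact Finset.sum_congr rfl fun i _ => integral_mul_partialDeriv i hu (differentiable_flux g i)
    (((hp' i).mul_rapidDecay (rapidDecay_flux g i)).integrable
      ((measurable_partialDeriv i u).mul (hfm i)).aestronglyMeasurable) (hint i)
    ((hp.mul_rapidDecay (rapidDecay_flux g i)).integrable (hum.mul (hfm i)).aestronglyMeasurable)

section bound

variable {C : ℝ} {k : ℕ}

lemma abs_conv_mul_le (hk : 4 ≤ k) {κ u w : Vel → ℝ} (hκ : CoulombDominated 1 κ)
    (hu : ∀ v, |u v| ≤ C * ((1 + ‖v‖) ^ k)⁻¹) (hw : ∀ v, |w v| ≤ C * ((1 + ‖v‖) ^ k)⁻¹) (v : Vel) :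
    |conv κ u v * w v| ≤ C ^ 2 * newtonianBound * ((1 + ‖v‖) ^ k)⁻¹ := by
  have hC : 0 ≤ C := by simpa using (abs_nonneg _).trans (hu 0)
  have hu4 (v : Vel) : |u v| ≤ C * ((1 + ‖v‖) ^ 4)⁻¹ := (hu v).trans (by gcongr; simp)
  have := newtonianBound_nonneg
  calc |conv κ u v * w v| = |conv κ u v| * |w v| := abs_mul _ _
    _ ≤ (1 * C * newtonianBound) * (C * ((1 + ‖v‖) ^ k)⁻¹) :=
      mul_le_mul (abs_conv_le hκ hu4 v) (hw v) (abs_nonneg _) (by positivity)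
    _ = _ := by ring

variable {g : 𝓢(Vel, ℝ)} (hk : 4 ≤ k) (h0 : ∀ v, |g v| ≤ C * ((1 + ‖v‖) ^ k)⁻¹)
  (h1 : ∀ i v, |pderiv i g v| ≤ C * ((1 + ‖v‖) ^ k)⁻¹)
  (h2 : ∀ i j v, |pderiv i (pderiv j g) v| ≤ C * ((1 + ‖v‖) ^ k)⁻¹)

include hk h0 h1 h2

lemma abs_partialDeriv_flux_le (i : Fin 3) (v : Vel) :
    |partialDeriv i (flux g i) v| ≤ 8 * (C ^ 2 * newtonianBound * ((1 + ‖v‖) ^ k)⁻¹) := by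
  have hA (j : Fin 3) := coulombDominated_landauKernel i j
  have ha := coulombDominated_coulombKernel
  rw [partialDeriv_flux]
  calc _ ≤ (∑ j, |conv (landauKernel i j) g v * pderiv i (pderiv j g) v
            + conv (landauKernel i j) (pderiv i g) v * pderiv j g v|)
          + |conv coulombKernel (pderiv i g) v * pderiv i g v
            + conv coulombKernel (pderiv i (pderiv i g)) v * g v| :=
        (abs_sub _ _).trans (add_le_add_left (Finset.abs_sum_le_sum_abs _ _) _)
    _ ≤ (∑ _j : Fin 3, (C ^ 2 * newtonianBound * ((1 + ‖v‖) ^ k)⁻¹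
            + C ^ 2 * newtonianBound * ((1 + ‖v‖) ^ k)⁻¹))
          + (C ^ 2 * newtonianBound * ((1 + ‖v‖) ^ k)⁻¹
            + C ^ 2 * newtonianBound * ((1 + ‖v‖) ^ k)⁻¹) := by
        gcongr with j
        · exact (abs_add_le _ _).trans (add_le_add (abs_conv_mul_le hk (hA j) h0 (h2 i j) v)
            (abs_conv_mul_le hk (hA j) (h1 i) (h1 j) v))
        · exact (abs_add_le _ _).trans (add_le_add (abs_conv_mul_le hk ha (h1 i) (h1 i) v)
            (abs_conv_mul_le hk ha (h2 i i) h0 v))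
    _ = _ := by
        simp only [Finset.sum_const, Finset.card_univ, Fintype.card_fin, nsmul_eq_mul]
        push_cast
        ring

lemma abs_collision_le (v : Vel) :
    |collision g v| ≤ 24 * C ^ 2 * newtonianBound * ((1 + ‖v‖) ^ k)⁻¹ := by
  calc |collision g v| ≤ ∑ _i : Fin 3, 8 * (C ^ 2 * newtonianBound * ((1 + ‖v‖) ^ k)⁻¹) :=
        (Finset.abs_sum_le_sum_abs _ _).trans
          (Finset.sum_le_sum fun i _ => abs_partialDeriv_flux_le hk h0 h1 h2 i v)
    _ = _ := by
        simp only [Finset.sum_const, Finset.card_univ, Fintype.card_fin, nsmul_eq_mul]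
        push_cast
        ring

end bound

end weak

/-! ### Symmetrised weak form -/

section symmetrisation

lemma abs_conv_le_conv_inv_norm {k : Vel → ℝ} (hk : CoulombDominated 1 k) (g : 𝓢(Vel, ℝ))
    (h0 : ∀ v, 0 ≤ g v) (v : Vel) : |conv k g v| ≤ conv (fun z => ‖z‖⁻¹) g v := by
  rw [← Real.norm_eq_abs, conv, conv]
  refine norm_integral_le_of_norm_le (integrable_conv coulombDominated_inv_norm
    (rapidDecay_schwartz g) g.continuous.measurable v) ?_
  filter_upwards [Measure.ae_ne _ v] with w hw
  rw [norm_mul, Real.norm_of_nonneg (h0 w)]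
  refine mul_le_mul_of_nonneg_right ?_ (h0 w)
  simpa using hk.bound _ (sub_ne_zero.mpr hw.symm)

lemma integrable_mul_conv {k : Vel → ℝ} {c : ℝ} (hk : CoulombDominated c k) {u : Vel → ℝ}
    (hm : Measurable u) (hu : PolyGrowth u) (g h : 𝓢(Vel, ℝ)) :
    Integrable fun v => u v * g v * conv k h v :=
  ((hu.mul_rapidDecay (rapidDecay_schwartz g)).mul_polyGrowth (polyGrowth_conv hk h)).integrable
    ((hm.mul g.continuous.measurable).mul (continuous_conv hk h).measurable).aestronglyMeasurable

lemma two_mul_integral_mul_conv_mul {β g ψ : Vel → ℝ} {b : ℝ} (hβ : Measurable β)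
    (hb : ∀ z, |β z| ≤ b) (hodd : ∀ z, β (-z) = -β z) (hg : Integrable g)
    (hψg : Integrable fun v => ψ v * g v) :
    2 * ∫ v, ψ v * conv β g v * g v = ∫ x : Vel × Vel,
      (ψ x.1 - ψ x.2) * β (x.1 - x.2) * (g x.1 * g x.2) ∂(volume.prod volume) := by
  set F : Vel × Vel → ℝ := fun x => β (x.1 - x.2) * (ψ x.1 * g x.1 * g x.2) with hF
  have hFi : Integrable F (volume.prod volume) :=
    (hψg.mul_prod hg).bdd_mul (c := b)
      (hβ.comp (by fun_prop : Measurable fun x : Vel × Vel => x.1 - x.2)).aestronglyMeasurable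
      (ae_of_all _ fun x => hb _)
  have hI : ∫ v, ψ v * conv β g v * g v = ∫ x, F x ∂(volume.prod volume) := by
    rw [integral_prod _ hFi]
    refine integral_congr_ae (ae_of_all _ fun v => ?_)
    simp only [hF, conv]
    rw [mul_right_comm, ← integral_const_mul]
    exact integral_congr_ae (ae_of_all _ fun w => by ring)
  calc 2 * ∫ v, ψ v * conv β g v * g v
      = (∫ x, F x ∂(volume.prod volume)) + ∫ x, F x.swap ∂(volume.prod volume) := by
        rw [integral_prod_swap F, hI, two_mul]
    _ = ∫ x, (F x + F x.swap) ∂(volume.prod volume) := (integral_add hFi hFi.swap).symm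
    _ = _ := integral_congr_ae (ae_of_all _ fun x => by
        simp only [hF, Prod.fst_swap, Prod.snd_swap]
        rw [← neg_sub x.1 x.2, hodd]
        ring)

/-- A test function `ψ` of polynomial growth whose gradient, and whose difference quotients, are
controlled by `Λ` times the weight `W`. -/
structure WeightedTest (Λ : ℝ) (W ψ : Vel → ℝ) : Prop where
  nonneg : 0 ≤ Λ
  weight_nonneg : ∀ v, 0 ≤ W v
  weight_continuous : Continuous W
  weight_polyGrowth : PolyGrowth W
  diff : Differentiable ℝ ψ
  polyGrowth : PolyGrowth ψ
  deriv_le : ∀ i v, |partialDeriv i ψ v| ≤ Λ * W v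
  sub_le : ∀ v w, |ψ v - ψ w| ≤ Λ * (W v + W w) * ‖v - w‖

variable {Λ B : ℝ} {W ψ : Vel → ℝ} {g : 𝓢(Vel, ℝ)}

namespace WeightedTest

lemma polyGrowth_partialDeriv (hψ : WeightedTest Λ W ψ) (j : Fin 3) :
    PolyGrowth (partialDeriv j ψ) := by
  obtain ⟨n, C, hC, h⟩ := hψ.weight_polyGrowth
  refine ⟨n, Λ * C, mul_nonneg hψ.nonneg hC, fun v => (hψ.deriv_le j v).trans ?_⟩
  rw [mul_assoc]
  exact mul_le_mul_of_nonneg_left ((le_abs_self _).trans (h v)) hψ.nonneg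

lemma integrable_weight_mul (hψ : WeightedTest Λ W ψ) (g : 𝓢(Vel, ℝ)) :
    Integrable fun v => W v * g v :=
  (hψ.weight_polyGrowth.mul_rapidDecay (rapidDecay_schwartz g)).integrable
    (hψ.weight_continuous.mul g.continuous).aestronglyMeasurable

lemma integrable_mul (hψ : WeightedTest Λ W ψ) (g : 𝓢(Vel, ℝ)) :
    Integrable fun v => ψ v * g v :=
  (hψ.polyGrowth.mul_rapidDecay (rapidDecay_schwartz g)).integrable
    (hψ.diff.continuous.mul g.continuous).aestronglyMeasurable

lemma integrable_weight_mul_inv_norm (hψ : WeightedTest Λ W ψ) (h0 : ∀ v, 0 ≤ g v) :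
    Integrable (fun x : Vel × Vel => W x.1 * g x.1 * (‖x.1 - x.2‖⁻¹ * g x.2))
      (volume.prod volume) := by
  have hW := hψ.weight_continuous
  rw [integrable_prod_iff (Measurable.aestronglyMeasurable (by fun_prop))]
  refine ⟨ae_of_all _ fun v => (integrable_conv coulombDominated_inv_norm (rapidDecay_schwartz g)
    g.continuous.measurable v).const_mul (W v * g v), ?_⟩
  refine (integrable_mul_conv coulombDominated_inv_norm hW.measurable hψ.weight_polyGrowth g
    g).congr (ae_of_all _ fun v => ?_)
  simp only [conv, ← integral_const_mul]
  refine integral_congr_ae (ae_of_all _ fun w => ?_)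
  exact (Real.norm_of_nonneg (mul_nonneg (mul_nonneg (hψ.weight_nonneg v) (h0 v))
    (mul_nonneg (by positivity) (h0 w)))).symm

lemma integral_weight_mul_inv_norm_le (hψ : WeightedTest Λ W ψ) (h0 : ∀ v, 0 ≤ g v)
    (hB : ∀ v, conv (fun z => ‖z‖⁻¹) g v ≤ B) :
    ∫ x : Vel × Vel, W x.1 * g x.1 * (‖x.1 - x.2‖⁻¹ * g x.2) ∂(volume.prod volume)
      ≤ B * ∫ v, W v * g v := by
  have hint := hψ.integrable_weight_mul_inv_norm h0
  rw [integral_prod _ hint, ← integral_const_mul]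
  refine integral_mono hint.integral_prod_left ((hψ.integrable_weight_mul g).const_mul B)
    fun v => ?_
  simp only
  rw [integral_const_mul, mul_comm B]
  exact mul_le_mul_of_nonneg_left (hB v) (mul_nonneg (hψ.weight_nonneg v) (h0 v))

lemma abs_sub_mul_partialDeriv_le (hψ : WeightedTest Λ W ψ) {k : Vel → ℝ}
    (hk : IsRegularKernel 1 k) (j : Fin 3) (v w : Vel) :
    |(ψ v - ψ w) * partialDeriv j k (v - w)| ≤ Λ * (W v + W w) * ‖v - w‖⁻¹ := by
  rcases eq_or_ne v w with rfl | hvw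
  · simp
  have hne := sub_ne_zero.mpr hvw
  have hn : 0 < ‖v - w‖ := norm_pos_iff.mpr hne
  calc |(ψ v - ψ w) * partialDeriv j k (v - w)|
      ≤ (Λ * (W v + W w) * ‖v - w‖) * (1 * (‖v - w‖⁻¹) ^ 2) := by
        rw [abs_mul]
        exact mul_le_mul (hψ.sub_le v w) (hk.deriv_bound j _ hne) (abs_nonneg _)
          (mul_nonneg (mul_nonneg hψ.nonneg
            (add_nonneg (hψ.weight_nonneg v) (hψ.weight_nonneg w))) hn.le)
    _ = _ := by field_simp

/- Symmetrising in `v` and `w` replaces `ψ v` by `ψ v - ψ w`, which gains the factor `|v - w|` that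
makes the singularity `|v - w|⁻²` of `∂ⱼ k` integrable. -/
lemma abs_integral_mul_conv_partialDeriv_le (hψ : WeightedTest Λ W ψ) {k : Vel → ℝ}
    (hk : IsRegularKernel 1 k) (h0 : ∀ v, 0 ≤ g v) (hB : ∀ v, conv (fun z => ‖z‖⁻¹) g v ≤ B)
    (j : Fin 3) :
    |∫ v, ψ v * conv (partialDeriv j k) g v * g v| ≤ Λ * B * ∫ v, W v * g v := by
  obtain ⟨b, hb⟩ := hk.deriv_bounded
  set H : Vel × Vel → ℝ := fun x => W x.1 * g x.1 * (‖x.1 - x.2‖⁻¹ * g x.2) with hH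
  have hHi : Integrable H (volume.prod volume) := hψ.integrable_weight_mul_inv_norm h0
  have hHs : Integrable (fun x => H x.swap) (volume.prod volume) := hHi.swap
  have hdouble : |2 * ∫ v, ψ v * conv (partialDeriv j k) g v * g v|
      ≤ Λ * (2 * ∫ x, H x ∂(volume.prod volume)) := by
    calc |2 * ∫ v, ψ v * conv (partialDeriv j k) g v * g v|
        ≤ ∫ x, Λ * (H x + H x.swap) ∂(volume.prod volume) := by
          rw [two_mul_integral_mul_conv_mul (measurable_partialDeriv j k) (hb j) (hk.odd j)
            g.integrable (hψ.integrable_mul g)]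
          rw [← Real.norm_eq_abs]
          refine norm_integral_le_of_norm_le ((hHi.add hHs).const_mul Λ)
            (ae_of_all _ fun ⟨v, w⟩ => ?_)
          rw [Real.norm_eq_abs, abs_mul, abs_of_nonneg (mul_nonneg (h0 v) (h0 w))]
          refine (mul_le_mul_of_nonneg_right (hψ.abs_sub_mul_partialDeriv_le hk j v w)
            (mul_nonneg (h0 v) (h0 w))).trans_eq ?_
          simp only [hH, Prod.swap_prod_mk, norm_sub_rev w v]
          ring
      _ = _ := by
          rw [integral_const_mul, integral_add hHi hHs, integral_prod_swap H, two_mul]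
  rw [abs_mul, abs_two] at hdouble
  linarith [mul_le_mul_of_nonneg_left (hψ.integral_weight_mul_inv_norm_le h0 hB) hψ.nonneg]

lemma abs_integral_mul_conv_pderiv_le (hψ : WeightedTest Λ W ψ) {k : Vel → ℝ}
    (hk : IsApproximable k) (h0 : ∀ v, 0 ≤ g v) (hB : ∀ v, conv (fun z => ‖z‖⁻¹) g v ≤ B)
    (j : Fin 3) : |∫ v, ψ v * g v * conv k (pderiv j g) v| ≤ Λ * B * ∫ v, W v * g v := by
  obtain ⟨-, κ, hκ, hlim⟩ := hk
  have ht := tendsto_integral_mul_conv (fun n => (hκ n).toCoulombDominated) hlim (pderiv j g)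
    (hψ.integrable_mul g)
  refine le_of_tendsto ht.abs (.of_forall fun n => ?_)
  obtain ⟨b, hb⟩ := (hκ n).bounded
  obtain ⟨b', hb'⟩ := (hκ n).deriv_bounded
  simpa only [conv_pderiv (hκ n).diff hb j (hb' j), mul_right_comm]
    using hψ.abs_integral_mul_conv_partialDeriv_le (hκ n) h0 hB j

lemma integral_mul_pderiv_mul_conv (hψ : WeightedTest Λ W ψ) {k : Vel → ℝ} {c : ℝ}
    (hk : CoulombDominated c k) (g : 𝓢(Vel, ℝ)) (j : Fin 3) :
    ∫ v, ψ v * pderiv j g v * conv k g v = -((∫ v, ψ v * g v * conv k (pderiv j g) v)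
      + ∫ v, partialDeriv j ψ v * g v * conv k g v) := by
  have hψm := hψ.diff.continuous.measurable
  have hi := integrable_mul_conv hk hψm hψ.polyGrowth g (pderiv j g)
  have hi' := integrable_mul_conv hk (measurable_partialDeriv j ψ)
    (hψ.polyGrowth_partialDeriv j) g g
  have hprod (v : Vel) : partialDeriv j (fun v => ψ v * conv k g v) v * g v
      = ψ v * g v * conv k (pderiv j g) v + partialDeriv j ψ v * g v * conv k g v := by
    rw [partialDeriv_mul j (hψ.diff v) (differentiable_conv hk g v), partialDeriv_conv hk]
    ring
  rw [← integral_add hi hi']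
  simp only [← hprod, mul_right_comm (ψ _), pderiv_apply]
  refine integral_mul_partialDeriv j (hψ.diff.mul (differentiable_conv hk g)) g.differentiable
    ((hi.add hi').congr (ae_of_all _ fun v => (hprod v).symm)) ?_ ?_
  · simpa only [← pderiv_apply, mul_right_comm]
      using integrable_mul_conv hk hψm hψ.polyGrowth (pderiv j g) g
  · simpa only [mul_right_comm] using integrable_mul_conv hk hψm hψ.polyGrowth g g

lemma abs_integral_partialDeriv_mul_conv_le (hψ : WeightedTest Λ W ψ) {k : Vel → ℝ}
    (hk : CoulombDominated 1 k) (h0 : ∀ v, 0 ≤ g v) (hB : ∀ v, conv (fun z => ‖z‖⁻¹) g v ≤ B)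
    (j : Fin 3) : |∫ v, partialDeriv j ψ v * g v * conv k g v| ≤ Λ * B * ∫ v, W v * g v := by
  rw [← integral_const_mul, ← Real.norm_eq_abs]
  refine norm_integral_le_of_norm_le ((hψ.integrable_weight_mul g).const_mul _)
    (ae_of_all _ fun v => ?_)
  rw [mul_right_comm, Real.norm_eq_abs, abs_mul, abs_mul, abs_of_nonneg (h0 v)]
  calc |partialDeriv j ψ v| * |conv k g v| * g v ≤ Λ * W v * B * g v :=
        mul_le_mul_of_nonneg_right (mul_le_mul (hψ.deriv_le j v)
          ((abs_conv_le_conv_inv_norm hk g h0 v).trans (hB v)) (abs_nonneg _)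
          (mul_nonneg hψ.nonneg (hψ.weight_nonneg v))) (h0 v)
    _ = _ := by ring

lemma abs_integral_mul_pderiv_mul_conv_le (hψ : WeightedTest Λ W ψ) {k : Vel → ℝ}
    (hk : IsApproximable k) (h0 : ∀ v, 0 ≤ g v) (hB : ∀ v, conv (fun z => ‖z‖⁻¹) g v ≤ B)
    (j : Fin 3) :
    |∫ v, ψ v * pderiv j g v * conv k g v| ≤ 2 * (Λ * B * ∫ v, W v * g v) := by
  rw [hψ.integral_mul_pderiv_mul_conv hk.1 g j, abs_neg, two_mul]
  exact (abs_add_le _ _).trans (add_le_add (hψ.abs_integral_mul_conv_pderiv_le hk h0 hB j)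
    (hψ.abs_integral_partialDeriv_mul_conv_le hk.1 h0 hB j))

lemma integral_mul_flux (hψ : WeightedTest Λ W ψ) (g : 𝓢(Vel, ℝ)) (i : Fin 3) :
    ∫ v, ψ v * flux g i v = (∑ j, ∫ v, ψ v * pderiv j g v * conv (landauKernel i j) g v)
      - ∫ v, ψ v * g v * conv coulombKernel (pderiv i g) v := by
  have hψm := hψ.diff.continuous.measurable
  have hA (j : Fin 3) := integrable_mul_conv (coulombDominated_landauKernel i j) hψm hψ.polyGrowth
    (pderiv j g) g
  rw [← integral_finsetSum _ fun j _ => hA j,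
    ← integral_sub (integrable_finsetSum _ fun j _ => hA j)
    (integrable_mul_conv coulombDominated_coulombKernel hψm hψ.polyGrowth g (pderiv i g))]
  refine integral_congr_ae (ae_of_all _ fun v => ?_)
  simp only [coe_flux, mul_sub, Finset.mul_sum]
  exact congrArg₂ _ (Finset.sum_congr rfl fun j _ => by ring) (by ring)

lemma abs_integral_mul_flux_le (hψ : WeightedTest Λ W ψ) (h0 : ∀ v, 0 ≤ g v)
    (hB : ∀ v, conv (fun z => ‖z‖⁻¹) g v ≤ B) (i : Fin 3) :
    |∫ v, ψ v * flux g i v| ≤ 7 * (Λ * B * ∫ v, W v * g v) := by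
  rw [hψ.integral_mul_flux g i]
  calc _ ≤ (∑ j, |∫ v, ψ v * pderiv j g v * conv (landauKernel i j) g v|)
          + |∫ v, ψ v * g v * conv coulombKernel (pderiv i g) v| :=
        (abs_sub _ _).trans (add_le_add_left (Finset.abs_sum_le_sum_abs _ _) _)
    _ ≤ (∑ _j : Fin 3, 2 * (Λ * B * ∫ v, W v * g v)) + Λ * B * ∫ v, W v * g v := by
        gcongr with j
        · exact hψ.abs_integral_mul_pderiv_mul_conv_le (isApproximable_landauKernel i j) h0 hB j
        · exact hψ.abs_integral_mul_conv_pderiv_le isApproximable_coulombKernel h0 hB i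
    _ = _ := by
        simp only [Finset.sum_const, Finset.card_univ, Fintype.card_fin, nsmul_eq_mul]
        push_cast
        ring

end WeightedTest

lemma abs_sum_integral_mul_flux_le {ψ : Fin 3 → Vel → ℝ} (hψ : ∀ i, WeightedTest Λ W (ψ i))
    (h0 : ∀ v, 0 ≤ g v) (hB : ∀ v, conv (fun z => ‖z‖⁻¹) g v ≤ B) :
    |∑ i, ∫ v, ψ i v * flux g i v| ≤ 21 * (Λ * B * ∫ v, W v * g v) := by
  calc |∑ i, ∫ v, ψ i v * flux g i v| ≤ ∑ _i : Fin 3, 7 * (Λ * B * ∫ v, W v * g v) :=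
        (Finset.abs_sum_le_sum_abs _ _).trans
          (Finset.sum_le_sum fun i _ => (hψ i).abs_integral_mul_flux_le h0 hB i)
    _ = _ := by
        simp only [Finset.sum_const, Finset.card_univ, Fintype.card_fin, nsmul_eq_mul]
        push_cast
        ring

end symmetrisation

/-! ### Growth of the moments -/

section bracket

lemma one_le_bracket (v : Vel) : 1 ≤ bracket v :=
  Real.one_le_sqrt.mpr (by nlinarith [sq_nonneg ‖v‖])

lemma bracket_pos (v : Vel) : 0 < bracket v := zero_lt_one.trans_le (one_le_bracket v)

lemma bracket_rpow_pos (v : Vel) (s : ℝ) : 0 < bracket v ^ s :=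
  Real.rpow_pos_of_pos (bracket_pos v) s

lemma bracket_sq (v : Vel) : bracket v ^ 2 = 1 + ‖v‖ ^ 2 := Real.sq_sqrt (by positivity)

lemma norm_le_bracket (v : Vel) : ‖v‖ ≤ bracket v :=
  Real.le_sqrt_of_sq_le (by linarith)

lemma bracket_le_one_add_norm (v : Vel) : bracket v ≤ 1 + ‖v‖ := by
  refine Real.sqrt_le_iff.mpr ⟨by positivity, ?_⟩
  nlinarith [norm_nonneg v]

lemma continuous_bracket : Continuous bracket := by
  unfold bracket
  fun_prop

lemma continuous_bracket_rpow (s : ℝ) : Continuous fun v => bracket v ^ s :=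
  continuous_bracket.rpow_const fun v => Or.inl (bracket_pos v).ne'

lemma polyGrowth_bracket_rpow (s : ℝ) : PolyGrowth fun v => bracket v ^ s := by
  obtain ⟨n, hn⟩ := exists_nat_ge s
  refine ⟨n, 1, zero_le_one, fun v => ?_⟩
  rw [abs_of_pos (bracket_rpow_pos v s), one_mul]
  calc bracket v ^ s ≤ bracket v ^ (n : ℝ) :=
        Real.rpow_le_rpow_of_exponent_le (one_le_bracket v) hn
    _ = bracket v ^ n := Real.rpow_natCast _ _
    _ ≤ _ := pow_le_pow_left₀ (bracket_pos v).le (bracket_le_one_add_norm v) n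

lemma bracket_rpow_eq (s : ℝ) (v : Vel) : bracket v ^ s = (1 + ‖v‖ ^ 2) ^ (s / 2) := by
  rw [bracket, Real.sqrt_eq_rpow, ← Real.rpow_mul (by positivity), one_div_mul_eq_div]

lemma hasFDerivAt_bracket_rpow (s : ℝ) (v : Vel) :
    HasFDerivAt (fun v => bracket v ^ s) ((s * bracket v ^ (s - 2)) • innerSL ℝ v) v := by
  have hsq : HasFDerivAt (fun z : Vel => 1 + ‖z‖ ^ 2) ((2 : ℝ) • innerSL ℝ v) v := by
    have h := (hasStrictFDerivAt_norm_sq v).hasFDerivAt.const_add 1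
    rwa [two_nsmul, ← two_smul ℝ] at h
  have hrpow := hsq.rpow_const (p := s / 2) (Or.inl (by positivity))
  simp only [bracket_rpow_eq]
  convert! hrpow using 1
  rw [smul_smul, sub_div, div_self two_ne_zero]
  congr 1
  ring

lemma partialDeriv_bracket_rpow (s : ℝ) (i : Fin 3) (v : Vel) :
    partialDeriv i (fun v => bracket v ^ s) v = s * bracket v ^ (s - 2) * v i := by
  rw [partialDeriv, (hasFDerivAt_bracket_rpow s v).fderiv, smul_apply, innerSL_single,
    smul_eq_mul]

lemma bracket_rpow_mono {s : ℝ} (hs : 0 ≤ s) {v w : Vel} (h : ‖v‖ ≤ ‖w‖) :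
    bracket v ^ s ≤ bracket w ^ s :=
  Real.rpow_le_rpow (bracket_pos v).le (Real.sqrt_le_sqrt (by gcongr)) hs

lemma hasFDerivAt_bracket_rpow_mul_coord (s : ℝ) (i : Fin 3) (v : Vel) :
    HasFDerivAt (fun v : Vel => bracket v ^ s * v i)
      (bracket v ^ s • (EuclideanSpace.proj i : Vel →L[ℝ] ℝ)
        + v i • ((s * bracket v ^ (s - 2)) • innerSL ℝ v)) v :=
  (hasFDerivAt_bracket_rpow s v).mul (hasFDerivAt_coord i v)

lemma norm_fderiv_bracket_rpow_mul_coord_le {s : ℝ} (hs : 0 ≤ s) (i : Fin 3) (v : Vel) :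
    ‖fderiv ℝ (fun v : Vel => bracket v ^ s * v i) v‖ ≤ (s + 1) * bracket v ^ s := by
  have hproj : ‖(EuclideanSpace.proj i : Vel →L[ℝ] ℝ)‖ ≤ 1 :=
    ContinuousLinearMap.opNorm_le_bound _ zero_le_one fun x => by simpa using abs_coord_le x i
  have hnorm : ‖v‖ * ‖v‖ ≤ bracket v ^ 2 := by nlinarith [bracket_sq v]
  have hpow : bracket v ^ (s - 2) * bracket v ^ 2 = bracket v ^ s := by
    rw [← Real.rpow_natCast, ← Real.rpow_add (bracket_pos v), Nat.cast_ofNat, sub_add_cancel]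
  rw [(hasFDerivAt_bracket_rpow_mul_coord s i v).fderiv]
  refine (norm_add_le _ _).trans ?_
  simp only [norm_smul, innerSL_apply_norm, Real.norm_eq_abs, abs_mul,
    abs_of_pos (bracket_rpow_pos v _), abs_of_nonneg hs]
  calc bracket v ^ s * ‖(EuclideanSpace.proj i : Vel →L[ℝ] ℝ)‖
        + |v i| * (s * bracket v ^ (s - 2) * ‖v‖)
      ≤ bracket v ^ s * 1 + ‖v‖ * (s * bracket v ^ (s - 2) * ‖v‖) := by
        have := (bracket_rpow_pos v s).le
        have := (bracket_rpow_pos v (s - 2)).le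
        gcongr
        exact abs_coord_le v i
    _ = bracket v ^ s + s * (bracket v ^ (s - 2) * (‖v‖ * ‖v‖)) := by ring
    _ ≤ bracket v ^ s + s * (bracket v ^ (s - 2) * bracket v ^ 2) := by
        have := (bracket_rpow_pos v (s - 2)).le
        gcongr
    _ = _ := by rw [hpow]; ring

lemma norm_fderiv_partialDeriv_bracket_rpow_le {m : ℝ} (hm : 2 ≤ m) (i : Fin 3) (v : Vel) :
    ‖fderiv ℝ (partialDeriv i fun v => bracket v ^ m) v‖ ≤ m ^ 2 * bracket v ^ m := by
  have hψ : (partialDeriv i fun v => bracket v ^ m)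
      = m • fun v : Vel => bracket v ^ (m - 2) * v i :=
    funext fun v => (partialDeriv_bracket_rpow m i v).trans (mul_assoc _ _ _)
  have hle : bracket v ^ (m - 2) ≤ bracket v ^ m :=
    Real.rpow_le_rpow_of_exponent_le (one_le_bracket v) (by linarith)
  rw [hψ, fderiv_const_smul (hasFDerivAt_bracket_rpow_mul_coord _ i v).differentiableAt, norm_smul,
    Real.norm_of_nonneg (by linarith)]
  calc m * ‖fderiv ℝ (fun v : Vel => bracket v ^ (m - 2) * v i) v‖
      ≤ m * ((m - 2 + 1) * bracket v ^ (m - 2)) := mul_le_mul_of_nonneg_left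
        (norm_fderiv_bracket_rpow_mul_coord_le (by linarith) i v) (by linarith)
    _ ≤ m * (m * bracket v ^ m) := by
        have := (bracket_rpow_pos v (m - 2)).le
        gcongr
        linarith
    _ = _ := by ring

lemma abs_sub_le_of_norm_fderiv_le {E : Type*} [NormedAddCommGroup E] [NormedSpace ℝ E]
    {ψ W : E → ℝ} (hψ : Differentiable ℝ ψ) (hW : ∀ v, 0 ≤ W v)
    (hmono : ∀ v w, ‖v‖ ≤ ‖w‖ → W v ≤ W w) (hd : ∀ v, ‖fderiv ℝ ψ v‖ ≤ W v) (v w : E) :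
    |ψ v - ψ w| ≤ (W v + W w) * ‖v - w‖ := by
  refine (convex_closedBall (0 : E) (max ‖v‖ ‖w‖)).norm_image_sub_le_of_norm_fderiv_le
    (fun z _ => hψ z) (fun z hz => (hd z).trans ?_) (by simp) (by simp)
  rcases le_max_iff.mp (mem_closedBall_zero_iff.mp hz) with h | h
  · exact (hmono z v h).trans (le_add_of_nonneg_right (hW w))
  · exact (hmono z w h).trans (le_add_of_nonneg_left (hW v))

lemma weightedTest_bracket {m : ℝ} (hm : 2 ≤ m) (i : Fin 3) :
    WeightedTest (m ^ 2) (fun v => bracket v ^ m) (partialDeriv i fun v => bracket v ^ m) := by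
  have hψ : (partialDeriv i fun v => bracket v ^ m)
      = fun v : Vel => m * (bracket v ^ (m - 2) * v i) :=
    funext fun v => (partialDeriv_bracket_rpow m i v).trans (mul_assoc _ _ _)
  have hcoord : PolyGrowth fun v : Vel => v i :=
    ⟨1, 1, zero_le_one, fun v => by rw [pow_one, one_mul]; linarith [abs_coord_le v i]⟩
  have hdiff : Differentiable ℝ (partialDeriv i fun v => bracket v ^ m) := by
    rw [hψ]
    exact fun v => (hasFDerivAt_bracket_rpow_mul_coord _ i v).differentiableAt.const_mul m
  have hfderiv := norm_fderiv_partialDeriv_bracket_rpow_le hm i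
  refine
  { nonneg := sq_nonneg m
    weight_nonneg := fun v => (bracket_rpow_pos v m).le
    weight_continuous := continuous_bracket_rpow m
    weight_polyGrowth := polyGrowth_bracket_rpow m
    diff := hdiff
    polyGrowth := by
      rw [hψ]
      exact (PolyGrowth.const m).mul ((polyGrowth_bracket_rpow (m - 2)).mul hcoord)
    deriv_le := fun j v => (abs_partialDeriv_le j _ v).trans (hfderiv v)
    sub_le := fun v w => ?_ }
  rw [mul_add]
  exact abs_sub_le_of_norm_fderiv_le hdiff
    (fun v => mul_nonneg (sq_nonneg m) (bracket_rpow_pos v m).le)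
    (fun v w h => mul_le_mul_of_nonneg_left (bracket_rpow_mono (by linarith) h) (sq_nonneg m))
    hfderiv v w

end bracket

lemma integral_collision_eq_zero (g : 𝓢(Vel, ℝ)) : ∫ v, collision g v = 0 := by
  have hone (i : Fin 3) : partialDeriv i (fun _ : Vel => (1 : ℝ)) = 0 := by
    funext v
    simp [partialDeriv]
  simpa [hone] using integral_mul_collision g (u := fun _ => 1) (differentiable_const _)
    (PolyGrowth.const 1) fun i => .of_bound (C := 0) (by simp [hone])

lemma abs_integral_bracket_mul_collision_le {m B : ℝ} (hm : 2 ≤ m) {g : 𝓢(Vel, ℝ)}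
    (h0 : ∀ v, 0 ≤ g v) (hB : ∀ v, conv (fun z => ‖z‖⁻¹) g v ≤ B) :
    |∫ v, bracket v ^ m * collision g v|
      ≤ 21 * (m ^ 2 * B * ∫ v, bracket v ^ m * g v) := by
  have hψ := weightedTest_bracket hm
  rw [integral_mul_collision g (fun v => (hasFDerivAt_bracket_rpow m v).differentiableAt)
    (polyGrowth_bracket_rpow m) (fun i => (hψ i).polyGrowth), abs_neg]
  exact abs_sum_integral_mul_flux_le hψ h0 hB

lemma inv_norm_mul_le_add_nearPow {p a : ℝ} (hp : 1 < p) (ha : 0 ≤ a) (z : Vel) :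
    ‖z‖⁻¹ * a ≤ a + a ^ p + nearPow (p / (p - 1)) z := by
  have hpow := Real.rpow_nonneg ha p
  by_cases hz : z ∈ Metric.ball (0 : Vel) 1
  · have hconj : p.HolderConjugate (p / (p - 1)) := Real.HolderConjugate.conjExponent hp
    have hnear : nearPow (p / (p - 1)) z = ‖z‖⁻¹ ^ (p / (p - 1)) := by
      rw [nearPow, indicator_of_mem hz, Real.rpow_neg (norm_nonneg _),
        Real.inv_rpow (norm_nonneg _)]
    have hyoung := Real.young_inequality_of_nonneg ha (inv_nonneg.mpr (norm_nonneg z)) hconj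
    rw [← hnear] at hyoung
    linarith [div_le_self hpow hp.le,
      div_le_self (nearPow_nonneg (p / (p - 1)) z) hconj.symm.lt.le, mul_comm ‖z‖⁻¹ a]
  · have hinv : ‖z‖⁻¹ ≤ 1 := inv_le_one_of_one_le₀ (by simpa using hz)
    linarith [mul_le_mul_of_nonneg_right hinv ha, nearPow_nonneg (p / (p - 1)) z]

lemma conv_inv_norm_le {p : ℝ} (hp : 3 / 2 < p) {g : 𝓢(Vel, ℝ)} (h0 : ∀ v, 0 ≤ g v) (v : Vel) :
    conv (fun z => ‖z‖⁻¹) g v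
      ≤ (∫ w, g w) + (∫ w, g w ^ p) + ∫ z, nearPow (p / (p - 1)) z := by
  have hconj : p / (p - 1) < 3 := by
    rw [div_lt_iff₀ (by linarith)]
    linarith
  have hgp : Integrable fun w => g w ^ p := integrable_rpow h0 (by linarith)
  have hnear := (integrable_nearPow hconj).comp_sub_left v
  have hmono := integral_mono
    (integrable_conv coulombDominated_inv_norm (rapidDecay_schwartz g) g.continuous.measurable v)
    ((g.integrable.add hgp).add hnear)
    fun w => inv_norm_mul_le_add_nearPow (by linarith) (h0 w) (v - w)
  rwa [integral_add' (g.integrable.add hgp) hnear, integral_add' g.integrable hgp,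
    integral_sub_left_eq_self (nearPow _) volume v] at hmono

/-! ### The drift term -/

section drift

/-- The function `-Δ (regCoulomb ε)`, an approximate identity up to a constant factor. -/
def mollifier (ε : ℝ) (z : Vel) : ℝ := (4 * Real.pi)⁻¹ * (3 * ε ^ 2 * regInv ε z ^ 5)

variable {ε : ℝ}

lemma mollifier_nonneg (hε : 0 < ε) (z : Vel) : 0 ≤ mollifier ε z := by
  have := regInv_pos hε z
  unfold mollifier
  positivity

lemma continuous_mollifier (hε : 0 < ε) : Continuous (mollifier ε) := by
  have hr : Continuous (regInv ε) :=
    continuous_iff_continuousAt.mpr fun z => (hasFDerivAt_regInv hε z).continuousAt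
  unfold mollifier
  fun_prop

lemma mollifier_le (hε : 0 < ε) (z : Vel) :
    mollifier ε z ≤ (4 * Real.pi)⁻¹ * (3 * ε ^ 2 * ε⁻¹ ^ 5) := by
  have := regInv_pos hε z
  unfold mollifier
  gcongr
  exact regInv_le hε z

lemma integrable_mollifier_one : Integrable (mollifier 1) := by
  have h := integrable_rpow_neg_one_add_norm_sq (E := Vel) (μ := volume) (r := 5)
    (by simp; norm_num)
  refine (h.const_mul ((4 * Real.pi)⁻¹ * 3)).congr (ae_of_all _ fun z => ?_)
  have hq : 0 < 1 + ‖z‖ ^ 2 := by positivity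
  have hreg : regInv 1 z = (1 + ‖z‖ ^ 2) ^ (-(1 / 2) : ℝ) := by
    rw [regInv, Real.rpow_neg hq.le, ← Real.sqrt_eq_rpow, add_comm, one_pow]
  simp only [mollifier, hreg]
  rw [← Real.rpow_natCast (_ ^ _) 5, ← Real.rpow_mul hq.le]
  norm_num
  ring

lemma mollifier_eq (hε : 0 < ε) (z : Vel) :
    mollifier ε z = (ε ^ 3)⁻¹ * mollifier 1 (ε⁻¹ • z) := by
  have hscale : ‖z‖ ^ 2 + ε ^ 2 = ε ^ 2 * (‖ε⁻¹ • z‖ ^ 2 + 1 ^ 2) := by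
    rw [norm_smul, Real.norm_of_nonneg (by positivity)]
    field_simp
  have hreg : regInv ε z = ε⁻¹ * regInv 1 (ε⁻¹ • z) := by
    rw [regInv, regInv, hscale, Real.sqrt_mul (by positivity), Real.sqrt_sq hε.le, mul_inv]
  simp only [mollifier, hreg]
  field_simp

lemma integrable_mollifier (hε : 0 < ε) : Integrable (mollifier ε) := by
  simp only [funext (mollifier_eq hε)]
  exact ((integrable_comp_smul_iff volume _ (inv_ne_zero hε.ne')).mpr
    integrable_mollifier_one).const_mul _

lemma integral_mollifier (hε : 0 < ε) : ∫ z, mollifier ε z = ∫ z, mollifier 1 z := by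
  simp only [mollifier_eq hε]
  rw [integral_const_mul, Measure.integral_comp_inv_smul_of_nonneg _ _ hε.le]
  simp only [finrank_euclideanSpace, Fintype.card_fin, smul_eq_mul]
  rw [← mul_assoc, inv_mul_cancel₀ (by positivity), one_mul]

lemma integrable_mollifier_sub_mul (hε : 0 < ε) {h : Vel → ℝ} (hi : Integrable h) (v : Vel) :
    Integrable fun w => mollifier ε (v - w) * h w :=
  hi.bdd_mul ((continuous_mollifier hε).comp (by fun_prop)).aestronglyMeasurable
    (ae_of_all _ fun w => by
      rw [Real.norm_of_nonneg (mollifier_nonneg hε _)]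
      exact mollifier_le hε _)

lemma conv_eq_convolution (k h : Vel → ℝ) :
    conv k h = convolution h k (ContinuousLinearMap.mul ℝ ℝ) volume := by
  funext v
  simp only [conv, convolution, ContinuousLinearMap.mul_apply', mul_comm]

lemma integrable_conv_mollifier (hε : 0 < ε) {h : Vel → ℝ} (hi : Integrable h) :
    Integrable (conv (mollifier ε) h) := by
  rw [conv_eq_convolution]
  exact hi.integrable_convolution _ (integrable_mollifier hε)

lemma integral_conv_mollifier (hε : 0 < ε) {h : Vel → ℝ} (hi : Integrable h) :
    ∫ v, conv (mollifier ε) h v = (∫ v, h v) * ∫ z, mollifier 1 z := by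
  rw [conv_eq_convolution, integral_convolution _ hi (integrable_mollifier hε),
    integral_mollifier hε]
  rfl

lemma hasFDerivAt_partialDeriv_regCoulomb (hε : 0 < ε) (i : Fin 3) (z : Vel) :
    HasFDerivAt (partialDeriv i (regCoulomb ε)) ((4 * Real.pi)⁻¹ •
      (-regInv ε z ^ 3 • (EuclideanSpace.proj i : Vel →L[ℝ] ℝ)
        + z i • ((3 * regInv ε z ^ 5) • innerSL ℝ z))) z := by
  have h := (((hasFDerivAt_regInv hε z).pow 3).neg.mul (hasFDerivAt_coord i z)).const_mul
    (4 * Real.pi)⁻¹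
  rw [funext (partialDeriv_regCoulomb hε i)]
  convert! h using 4
  rw [smul_smul, ← neg_smul]
  congr 1
  simp only [Nat.add_one_sub_one, nsmul_eq_mul, Nat.cast_ofNat]
  ring

lemma partialDeriv_partialDeriv_regCoulomb (hε : 0 < ε) (i : Fin 3) (z : Vel) :
    partialDeriv i (partialDeriv i (regCoulomb ε)) z
      = (4 * Real.pi)⁻¹ * (regInv ε z ^ 3 * (3 * (regInv ε z * z i) ^ 2 - 1)) := by
  rw [partialDeriv, (hasFDerivAt_partialDeriv_regCoulomb hε i z).fderiv]
  simp [EuclideanSpace.inner_single_right]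
  ring

lemma sum_partialDeriv_partialDeriv_regCoulomb (hε : 0 < ε) (z : Vel) :
    ∑ i, partialDeriv i (partialDeriv i (regCoulomb ε)) z = -mollifier ε z := by
  have hnorm : ‖z‖ ^ 2 = z 0 ^ 2 + z 1 ^ 2 + z 2 ^ 2 := by
    rw [EuclideanSpace.norm_sq_eq]
    simp [Fin.sum_univ_three]
  have hreg := regInv_sq_mul hε z
  rw [hnorm] at hreg
  simp only [partialDeriv_partialDeriv_regCoulomb hε, Fin.sum_univ_three, mollifier]
  linear_combination (4 * Real.pi)⁻¹ * 3 * regInv ε z ^ 3 * hreg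

lemma abs_partialDeriv_partialDeriv_regCoulomb_le (hε : 0 < ε) (i : Fin 3) (z : Vel) :
    |partialDeriv i (partialDeriv i (regCoulomb ε)) z| ≤ 2 * ε⁻¹ ^ 3 := by
  have hr := regInv_pos hε z
  have hcoord : (regInv ε z * z i) ^ 2 ≤ 1 :=
    (sq_le_one_iff_abs_le_one _).mpr (abs_regInv_mul_coord_le hε z i)
  have hfactor : |3 * (regInv ε z * z i) ^ 2 - 1| ≤ 2 :=
    abs_le.mpr ⟨by linarith [sq_nonneg (regInv ε z * z i)], by linarith⟩
  rw [partialDeriv_partialDeriv_regCoulomb hε, abs_mul, abs_mul, abs_of_pos (pow_pos hr 3),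
    abs_of_nonneg (by positivity)]
  calc (4 * Real.pi)⁻¹ * (regInv ε z ^ 3 * |3 * (regInv ε z * z i) ^ 2 - 1|)
      ≤ 1 * (ε⁻¹ ^ 3 * 2) := by
        gcongr
        exacts [inv_four_pi_le, regInv_le hε z]
    _ = _ := by ring

variable {g : 𝓢(Vel, ℝ)}

lemma sum_conv_regCoulomb_pderiv_pderiv (hε : 0 < ε) (g : 𝓢(Vel, ℝ)) (v : Vel) :
    ∑ i, conv (regCoulomb ε) (pderiv i (pderiv i g)) v = -conv (mollifier ε) g v := by
  have hK := isRegularKernel_regCoulomb hε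
  obtain ⟨b, hb⟩ := hK.bounded
  obtain ⟨b', hb'⟩ := hK.deriv_bounded
  have hb2 := abs_partialDeriv_partialDeriv_regCoulomb_le hε
  have hint (i : Fin 3) :
      Integrable fun w => partialDeriv i (partialDeriv i (regCoulomb ε)) (v - w) * g w :=
    g.integrable.bdd_mul ((measurable_partialDeriv i _).comp
      (measurable_const.sub measurable_id)).aestronglyMeasurable (ae_of_all _ fun w => hb2 i _)
  have hmove (i : Fin 3) : conv (regCoulomb ε) (pderiv i (pderiv i g))
      = conv (partialDeriv i (partialDeriv i (regCoulomb ε))) g := by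
    rw [conv_pderiv hK.diff hb i (hb' i), conv_pderiv
      (fun z => (hasFDerivAt_partialDeriv_regCoulomb hε i z).differentiableAt) (hb' i) i (hb2 i)]
  rw [Finset.sum_congr rfl fun i _ => congrFun (hmove i) v]
  simp only [conv]
  rw [← integral_finsetSum _ fun i _ => hint i, ← integral_neg]
  simp only [← Finset.sum_mul, sum_partialDeriv_partialDeriv_regCoulomb hε, neg_mul]

lemma integrable_rpow_mul_conv {k : Vel → ℝ} {c p : ℝ} (hk : CoulombDominated c k)
    (h0 : ∀ v, 0 ≤ g v) (hp : 0 < p) (h : 𝓢(Vel, ℝ)) :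
    Integrable fun v => g v ^ p * conv k h v :=
  (((rapidDecay_schwartz g).rpow h0 hp).mul_polyGrowth (polyGrowth_conv hk h)).integrable
    ((g.continuous.rpow_const fun _ => Or.inr hp.le).mul
      (continuous_conv hk h)).aestronglyMeasurable

lemma integrable_partialDeriv_rpow_mul_conv {k : Vel → ℝ} {c p : ℝ} (hk : CoulombDominated c k)
    (h0 : ∀ v, 0 ≤ g v) (hp : 1 / 2 < p) (i : Fin 3) (h : 𝓢(Vel, ℝ)) :
    Integrable fun v => partialDeriv i (fun w => g w ^ p) v * conv k h v :=
  ((rapidDecay_partialDeriv_rpow h0 hp i).mul_polyGrowth (polyGrowth_conv hk h)).integrable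
    ((measurable_partialDeriv i _).mul (continuous_conv hk h).measurable).aestronglyMeasurable

lemma integral_partialDeriv_rpow_mul_conv {k : Vel → ℝ} {c p : ℝ} (hk : CoulombDominated c k)
    (h0 : ∀ v, 0 ≤ g v) (hp : 1 / 2 < p) (i : Fin 3) (h : 𝓢(Vel, ℝ)) :
    ∫ v, partialDeriv i (fun w => g w ^ p) v * conv k h v
      = -∫ v, g v ^ p * conv k (pderiv i h) v := by
  obtain ⟨L, hL⟩ := exists_nonnegC11 g h0
  have hparts := integral_mul_partialDeriv (u := fun v => g v ^ p) (w := conv k h) i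
    (hL.differentiable_rpow hp) (differentiable_conv hk h)
    (integrable_partialDeriv_rpow_mul_conv hk h0 hp i h)
    (by rw [partialDeriv_conv hk]; exact integrable_rpow_mul_conv hk h0 (by linarith) _)
    (integrable_rpow_mul_conv hk h0 (by linarith) h)
  rw [← partialDeriv_conv hk, hparts, neg_neg]

lemma sum_integral_partialDeriv_rpow_mul_conv_regCoulomb (hε : 0 < ε) (h0 : ∀ v, 0 ≤ g v) {p : ℝ}
    (hp : 1 / 2 < p) :
    ∑ i, ∫ v, partialDeriv i (fun w => g w ^ p) v * conv (regCoulomb ε) (pderiv i g) v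
      = ∫ v, g v ^ p * conv (mollifier ε) g v := by
  have hK := (isRegularKernel_regCoulomb hε).toCoulombDominated
  simp only [integral_partialDeriv_rpow_mul_conv hK h0 hp, Finset.sum_neg_distrib]
  rw [← integral_finsetSum _ fun i _ => integrable_rpow_mul_conv hK h0 (by linarith) _,
    ← integral_neg]
  simp only [← Finset.mul_sum, sum_conv_regCoulomb_pderiv_pderiv hε, mul_neg, neg_neg]

lemma rpow_mul_le_add {a b p : ℝ} (ha : 0 ≤ a) (hb : 0 ≤ b) (hp : 0 < p) :
    a ^ p * b ≤ a ^ (p + 1) + b ^ (p + 1) := by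
  rw [Real.rpow_add_one' ha (by linarith), Real.rpow_add_one' hb (by linarith)]
  have hap := Real.rpow_nonneg ha p
  have hbp := Real.rpow_nonneg hb p
  rcases le_total a b with h | h
  · exact (mul_le_mul_of_nonneg_right (Real.rpow_le_rpow ha h hp.le) hb).trans
      (le_add_of_nonneg_left (mul_nonneg hap ha))
  · exact (mul_le_mul_of_nonneg_left h hap).trans (le_add_of_nonneg_right (mul_nonneg hbp hb))

/-- The constant in the estimate of the drift term by `∫ g ^ (p + 1)`. -/
def driftConst : ℝ := 2 * ∫ z, mollifier 1 z

lemma driftConst_nonneg : 0 ≤ driftConst :=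
  mul_nonneg zero_le_two (integral_nonneg (mollifier_nonneg one_pos))

lemma rpow_mul_conv_mollifier_le (hε : 0 < ε) (h0 : ∀ v, 0 ≤ g v) {p : ℝ} (hp : 0 < p) (v : Vel) :
    g v ^ p * conv (mollifier ε) g v ≤ (∫ z, mollifier 1 z) * g v ^ (p + 1)
      + conv (mollifier ε) (fun w => g w ^ (p + 1)) v := by
  have hp1 := integrable_rpow h0 (by linarith : 0 < p + 1)
  have hmi := (integrable_mollifier hε).comp_sub_left v
  rw [← integral_mollifier hε, ← integral_sub_left_eq_self (mollifier ε) volume v, conv, conv,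
    ← integral_const_mul, ← integral_mul_const,
    ← integral_add (hmi.mul_const _) (integrable_mollifier_sub_mul hε hp1 v)]
  refine integral_mono ((integrable_mollifier_sub_mul hε g.integrable v).const_mul _)
    ((hmi.mul_const _).add (integrable_mollifier_sub_mul hε hp1 v)) fun w => ?_
  have hyoung := mul_le_mul_of_nonneg_left (rpow_mul_le_add (h0 v) (h0 w) hp)
    (mollifier_nonneg hε (v - w))
  simp only
  linarith

lemma integral_rpow_mul_conv_mollifier_le (hε : 0 < ε) (h0 : ∀ v, 0 ≤ g v) {p : ℝ} (hp : 0 < p) :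
    ∫ v, g v ^ p * conv (mollifier ε) g v ≤ driftConst * ∫ v, g v ^ (p + 1) := by
  have hp1 := (integrable_rpow h0 (by linarith : 0 < p + 1))
  have hgp : Continuous fun v => g v ^ p := g.continuous.rpow_const fun _ => Or.inr hp.le
  obtain ⟨C, -, hC⟩ := ((rapidDecay_schwartz g).rpow h0 hp).exists_bound
  have hint : Integrable fun v => g v ^ p * conv (mollifier ε) g v :=
    (integrable_conv_mollifier hε g.integrable).bdd_mul hgp.aestronglyMeasurable (ae_of_all _ hC)
  refine (integral_mono hint ((hp1.const_mul _).add (integrable_conv_mollifier hε hp1))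
    (rpow_mul_conv_mollifier_le hε h0 hp)).trans_eq ?_
  rw [integral_add' (hp1.const_mul _) (integrable_conv_mollifier hε hp1), integral_const_mul,
    integral_conv_mollifier hε hp1, driftConst]
  ring

lemma sum_integral_drift_le (h0 : ∀ v, 0 ≤ g v) {p : ℝ} (hp : 1 / 2 < p) :
    ∑ i, ∫ v, partialDeriv i (fun w => g w ^ p) v * conv coulombKernel (pderiv i g) v
      ≤ driftConst * ∫ v, g v ^ (p + 1) := by
  have hε (n : ℕ) : 0 < 1 / ((n : ℝ) + 1) := by positivity
  have ht := tendsto_finsetSum (Finset.univ : Finset (Fin 3)) fun i _ =>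
    tendsto_integral_mul_conv (fun n => (isRegularKernel_regCoulomb (hε n)).toCoulombDominated)
      (fun z hz => tendsto_regCoulomb hz) (pderiv i g)
      ((rapidDecay_partialDeriv_rpow h0 hp i).integrable
        (measurable_partialDeriv i _).aestronglyMeasurable)
  refine le_of_tendsto ht (.of_forall fun n => ?_)
  rw [sum_integral_partialDeriv_rpow_mul_conv_regCoulomb (hε n) h0 hp]
  exact integral_rpow_mul_conv_mollifier_le (hε n) h0 (by linarith)

end drift

/-! ### Dissipation of the `Lᵖ` norm -/

section dissipation

lemma norm_gradient_sq (h : Vel → ℝ) (v : Vel) :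
    ‖gradient h v‖ ^ 2 = ∑ i, partialDeriv i h v ^ 2 := by
  have hcoord (i : Fin 3) : gradient h v i = partialDeriv i h v := by
    rw [partialDeriv, ← InnerProductSpace.toDual_symm_apply, EuclideanSpace.inner_single_right,
      one_mul, conj_trivial, gradient]
  rw [EuclideanSpace.norm_sq_eq]
  simp only [hcoord, Real.norm_eq_abs, sq_abs]

lemma norm_gradient (h : Vel → ℝ) (v : Vel) : ‖gradient h v‖ = ‖fderiv ℝ h v‖ := by
  simp [gradient]

/-- The dissipation density `⟨v⟩⁻³ |∇ g^{p/2}|²` of the `Lᵖ` norm. -/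
def dissipation (p : ℝ) (g : Vel → ℝ) (v : Vel) : ℝ :=
  bracket v ^ (-3 : ℝ) * ‖gradient (fun w => g w ^ (p / 2)) v‖ ^ 2

lemma dissipation_nonneg (p : ℝ) (g : Vel → ℝ) (v : Vel) : 0 ≤ dissipation p g v :=
  mul_nonneg (bracket_rpow_pos v _).le (sq_nonneg _)

variable {g : 𝓢(Vel, ℝ)} {p : ℝ}

lemma integrable_dissipation (h0 : ∀ v, 0 ≤ g v) (hp : 1 < p) : Integrable (dissipation p g) := by
  have hsum : dissipation p g = fun v => bracket v ^ (-3 : ℝ)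
      * ∑ i, partialDeriv i (fun w => g w ^ (p / 2)) v
        * partialDeriv i (fun w => g w ^ (p / 2)) v := by
    funext v
    simp only [dissipation, norm_gradient_sq]
    simp only [sq]
  have hdecay (i : Fin 3) := rapidDecay_partialDeriv_rpow h0 (by linarith : 1 / 2 < p / 2) i
  rw [hsum]
  exact ((polyGrowth_bracket_rpow _).mul_rapidDecay (RapidDecay.sum (s := .univ) fun i _ =>
    (hdecay i).mul (hdecay i))).integrable ((continuous_bracket_rpow _).measurable.mul
    (Finset.measurable_fun_sum _ fun i _ =>
      (measurable_partialDeriv i _).mul (measurable_partialDeriv i _))).aestronglyMeasurable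

lemma dissipation_eq (h0 : ∀ v, 0 ≤ g v) (hp : 1 < p) (v : Vel) :
    dissipation p g v
      = bracket v ^ (-3 : ℝ) * (p ^ 2 / 4 * g v ^ (p - 2) * ∑ i, pderiv i g v ^ 2) := by
  obtain ⟨L, hL⟩ := exists_nonnegC11 g h0
  have hpow : (g v ^ (p / 2 - 1)) ^ 2 = g v ^ (p - 2) := by
    rw [← Real.rpow_mul_natCast (h0 v)]
    congr 1
    push_cast
    ring
  rw [dissipation, norm_gradient_sq]
  congr 1
  rw [Finset.mul_sum]
  refine Finset.sum_congr rfl fun i _ => ?_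
  rw [hL.partialDeriv_rpow (by linarith), pderiv_apply, mul_pow, mul_pow, hpow]
  ring

lemma mul_sum_partialDeriv_rpow_mul_flux (h0 : ∀ v, 0 ≤ g v) (hp : 3 / 2 < p) (v : Vel) :
    p * ∑ i, partialDeriv i (fun x => g x ^ (p - 1)) v * flux g i v
      = p * (p - 1) * g v ^ (p - 2)
          * (∑ i, ∑ j, conv (landauKernel i j) g v * (pderiv i g v * pderiv j g v))
        - (p - 1) * ∑ i, partialDeriv i (fun w => g w ^ p) v
          * conv coulombKernel (pderiv i g) v := by
  obtain ⟨L, hL⟩ := exists_nonnegC11 g h0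
  have hsub (i : Fin 3) : partialDeriv i (fun x => g x ^ (p - 1)) v
      = (p - 1) * g v ^ (p - 2) * pderiv i g v := by
    rw [hL.partialDeriv_rpow (by linarith), pderiv_apply, show p - 1 - 1 = p - 2 by ring]
  have hpow (i : Fin 3) : partialDeriv i (fun x => g x ^ p) v
      = p * (g v ^ (p - 2) * g v) * pderiv i g v := by
    rw [hL.partialDeriv_rpow (by linarith), pderiv_apply]
    rcases (h0 v).eq_or_lt' with h | h
    · have hzero : partialDeriv i g v = 0 := by
        rw [partialDeriv, hL.fderiv_eq_zero h, zero_apply]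
      rw [hzero, mul_zero, mul_zero]
    · rw [← Real.rpow_add_one h.ne', show p - 2 + 1 = p - 1 by ring]
  simp only [hsub, hpow, coe_flux, Fin.sum_univ_three]
  ring

lemma dissipation_sub_drift_le (h0 : ∀ v, 0 ≤ g v) {c : ℝ} (hp : 3 / 2 < p) {v : Vel}
    (hA : ∀ ξ : Fin 3 → ℝ, c * bracket v ^ (-3 : ℝ) * ∑ i, ξ i ^ 2
      ≤ ∑ i, ∑ j, conv (landauKernel i j) g v * (ξ i * ξ j)) :
    4 * (p - 1) / p * c * dissipation p g v
      - (p - 1) * ∑ i, partialDeriv i (fun w => g w ^ p) v * conv coulombKernel (pderiv i g) v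
      ≤ p * ∑ i, partialDeriv i (fun x => g x ^ (p - 1)) v * flux g i v := by
  have hp0 : 0 < p := by linarith
  have hcoercive := mul_le_mul_of_nonneg_left (hA fun i => pderiv i g v)
    (mul_nonneg (mul_nonneg hp0.le (by linarith : 0 ≤ p - 1)) (Real.rpow_nonneg (h0 v) (p - 2)))
  rw [mul_sum_partialDeriv_rpow_mul_flux h0 hp, dissipation_eq h0 (by linarith)]
  refine sub_le_sub_right (le_trans (le_of_eq ?_) hcoercive) _
  field_simp

lemma integrable_partialDeriv_rpow_mul_flux {q : ℝ} (h0 : ∀ v, 0 ≤ g v) (hq : 1 / 2 < q)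
    (i : Fin 3) : Integrable fun v => partialDeriv i (fun x => g x ^ q) v * flux g i v :=
  ((rapidDecay_partialDeriv_rpow h0 hq i).mul (rapidDecay_flux g i)).integrable
    ((measurable_partialDeriv i _).mul
      (differentiable_flux g i).continuous.measurable).aestronglyMeasurable

lemma integral_mul_rpow_mul_collision (h0 : ∀ v, 0 ≤ g v) (hp : 3 / 2 < p) :
    ∫ v, p * g v ^ (p - 1) * collision g v
      = -∫ v, p * ∑ i, partialDeriv i (fun x => g x ^ (p - 1)) v * flux g i v := by
  obtain ⟨L, hL⟩ := exists_nonnegC11 g h0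
  have hdecay := (rapidDecay_schwartz g).rpow h0 (by linarith : 0 < p - 1)
  have hderiv := rapidDecay_partialDeriv_rpow h0 (by linarith : 1 / 2 < p - 1)
  simp only [mul_assoc p]
  rw [integral_const_mul, integral_const_mul, integral_mul_collision g
    (hL.differentiable_rpow (by linarith)) hdecay.polyGrowth fun i => (hderiv i).polyGrowth,
    integral_finsetSum _ fun i _ => integrable_partialDeriv_rpow_mul_flux h0 (by linarith) i,
    mul_neg]

lemma integral_rpow_mul_collision_le (h0 : ∀ v, 0 ≤ g v) {c : ℝ} (hp : 3 / 2 < p)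
    (hA : ∀ v (ξ : Fin 3 → ℝ), c * bracket v ^ (-3 : ℝ) * ∑ i, ξ i ^ 2
      ≤ ∑ i, ∑ j, conv (landauKernel i j) g v * (ξ i * ξ j)) :
    ∫ v, p * g v ^ (p - 1) * collision g v
      ≤ -(4 * (p - 1) / p * c * ∫ v, dissipation p g v)
        + (p - 1) * (driftConst * ∫ v, g v ^ (p + 1)) := by
  have hdrift (i : Fin 3) := integrable_partialDeriv_rpow_mul_conv coulombDominated_coulombKernel h0
    (by linarith : 1 / 2 < p) i (pderiv i g)
  have hD := (integrable_dissipation h0 (by linarith)).const_mul (4 * (p - 1) / p * c)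
  have hK := (integrable_finsetSum Finset.univ fun i _ => hdrift i).const_mul (p - 1)
  have hflux := (integrable_finsetSum Finset.univ fun i _ =>
    integrable_partialDeriv_rpow_mul_flux h0 (by linarith : 1 / 2 < p - 1) i).const_mul p
  have hmono := integral_mono (hD.sub hK) hflux fun v => dissipation_sub_drift_le h0 hp (hA v)
  rw [integral_sub' hD hK, integral_const_mul, integral_const_mul,
    integral_finsetSum _ fun i _ => hdrift i] at hmono
  rw [integral_mul_rpow_mul_collision h0 hp]
  linarith [mul_le_mul_of_nonneg_left (sum_integral_drift_le h0 (by linarith : 1 / 2 < p))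
    (by linarith : 0 ≤ p - 1)]

end dissipation

/-! ### Coercivity of the diffusion matrix -/

section coercivity

/-- The part of a ball of radius `R` that lies in a slab of width `2δ` around `v`, orthogonal
to `e`. -/
def slab (e v : Vel) (R δ : ℝ) : Set Vel := {w | ‖w‖ ≤ R ∧ |inner ℝ e (v - w)| < δ}

lemma measurableSet_slab (e v : Vel) (R δ : ℝ) : MeasurableSet (slab e v R δ) := by
  have h : Continuous fun w : Vel => |inner ℝ e (v - w)| := by fun_prop
  exact (measurableSet_le measurable_norm measurable_const).inter
    (measurableSet_lt h.measurable measurable_const)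

lemma volume_slab_le (b : OrthonormalBasis (Fin 3) ℝ Vel) (v : Vel) {R δ : ℝ} (hR : 0 ≤ R)
    (hδ : 0 ≤ δ) : volume (slab (b 1) v R δ) ≤ ENNReal.ofReal (8 * δ * R ^ 2) := by
  set c := inner ℝ (b 1) v with hc
  set I : Fin 3 → Set ℝ := ![Icc (-R) R, Icc (c - δ) (c + δ), Icc (-R) R] with hI
  have hmeas : MeasurableSet (univ.pi I) := by
    refine MeasurableSet.univ_pi fun i => ?_
    fin_cases i <;> exact measurableSet_Icc
  have hcoords := (EuclideanSpace.volume_preserving_symm_measurableEquiv_toLp (Fin 3)).comp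
    b.measurePreserving_repr
  have hsub : slab (b 1) v R δ ⊆
      (⇑(MeasurableEquiv.toLp 2 (Fin 3 → ℝ)).symm ∘ ⇑b.repr) ⁻¹' univ.pi I := by
    rintro w ⟨hw, hs⟩ i -
    have hball (j : Fin 3) : |inner ℝ (b j) w| ≤ R :=
      (abs_real_inner_le_norm _ _).trans (by rwa [b.orthonormal.1 j, one_mul])
    have hval : (⇑(MeasurableEquiv.toLp 2 (Fin 3 → ℝ)).symm ∘ ⇑b.repr) w i
        = inner ℝ (b i) w := by
      simp [b.repr_apply_apply]
    rw [hval]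
    rw [inner_sub_right, ← hc, abs_lt] at hs
    fin_cases i
    · exact abs_le.mp (hball 0)
    · exact ⟨by simp; linarith [hs.2], by simp; linarith [hs.1]⟩
    · exact abs_le.mp (hball 2)
  refine (measure_mono hsub).trans ?_
  rw [hcoords.measure_preimage hmeas.nullMeasurableSet, volume_pi_pi, Fin.prod_univ_three]
  simp only [hI, Matrix.cons_val_zero, Matrix.cons_val_one, Matrix.cons_val, Real.volume_Icc]
  rw [← ENNReal.ofReal_mul (by linarith), ← ENNReal.ofReal_mul (by nlinarith)]
  exact ENNReal.ofReal_le_ofReal (by nlinarith)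

lemma sum_landauKernel_mul (z : Vel) (ξ : Fin 3 → ℝ) :
    ∑ i, ∑ j, landauKernel i j z * (ξ i * ξ j)
      = ((∑ i, ξ i ^ 2) - (inner ℝ z (WithLp.toLp 2 ξ : Vel)) ^ 2 / ‖z‖ ^ 2)
        / (8 * Real.pi * ‖z‖) := by
  simp only [landauKernel, proj, Matrix.of_apply, PiLp.inner_apply, Fin.sum_univ_three,
    RCLike.inner_apply, conj_trivial]
  simp only [↓reduceIte, Fin.isValue, zero_ne_one, zero_sub, Fin.reduceEq, one_ne_zero]
  ring

lemma exists_orthonormalBasis_zero {e : Vel} (he : ‖e‖ = 1) :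
    ∃ b : OrthonormalBasis (Fin 3) ℝ Vel, b 0 = e := by
  have ho : Orthonormal ℝ (({0} : Set (Fin 3)).domRestrict fun _ => e) := by
    rw [orthonormal_iff_ite]
    rintro ⟨i, hi⟩ ⟨j, hj⟩
    simp only [mem_singleton_iff] at hi hj
    subst hi hj
    simp [domRestrict, he]
  obtain ⟨b, hb⟩ := ho.exists_orthonormalBasis_extension_of_card_eq (by simp)
  exact ⟨b, hb 0 rfl⟩

lemma exists_orthonormalBasis_norm_smul_zero (x : Vel) :
    ∃ b : OrthonormalBasis (Fin 3) ℝ Vel, ‖x‖ • b 0 = x := by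
  rcases eq_or_ne x 0 with rfl | hx
  · exact ⟨EuclideanSpace.basisFun (Fin 3) ℝ, by simp⟩
  · obtain ⟨b, hb⟩ := exists_orthonormalBasis_zero (e := ‖x‖⁻¹ • x)
      (by rw [norm_smul, norm_inv, norm_norm, inv_mul_cancel₀ (norm_ne_zero_iff.mpr hx)])
    exact ⟨b, by rw [hb, smul_smul, mul_inv_cancel₀ (norm_ne_zero_iff.mpr hx), one_smul]⟩

/- `Π(z)` annihilates only the direction of `z`, so any direction `b 1` orthogonal to `ξ` detects
how far `ξ` is from the kernel of `Π(z)`. -/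
lemma exists_le_sum_landauKernel_mul (ξ : Fin 3 → ℝ) :
    ∃ b : OrthonormalBasis (Fin 3) ℝ Vel, ∀ z : Vel,
      (∑ i, ξ i ^ 2) * inner ℝ (b 1) z ^ 2 / (8 * Real.pi * ‖z‖ ^ 3)
        ≤ ∑ i, ∑ j, landauKernel i j z * (ξ i * ξ j) := by
  obtain ⟨b, hb⟩ := exists_orthonormalBasis_norm_smul_zero (WithLp.toLp 2 ξ)
  set x : Vel := WithLp.toLp 2 ξ with hx
  have hxs : ∑ i, ξ i ^ 2 = ‖x‖ ^ 2 := by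
    rw [EuclideanSpace.norm_sq_eq]
    simp [hx]
  refine ⟨b, fun z => ?_⟩
  rw [sum_landauKernel_mul, hxs]
  rcases eq_or_ne z 0 with rfl | hz
  · simp
  have : 0 < ‖z‖ := norm_pos_iff.mpr hz
  have hparseval : ‖z‖ ^ 2
      = inner ℝ (b 0) z ^ 2 + inner ℝ (b 1) z ^ 2 + inner ℝ (b 2) z ^ 2 := by
    rw [← b.sum_sq_norm_inner_right z, Fin.sum_univ_three]
    simp
  have hinner : inner ℝ z x = ‖x‖ * inner ℝ (b 0) z := by
    rw [← hb, inner_smul_right, norm_smul, b.orthonormal.1 0, norm_norm, mul_one,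
      real_inner_comm]
  calc ‖x‖ ^ 2 * inner ℝ (b 1) z ^ 2 / (8 * Real.pi * ‖z‖ ^ 3)
      ≤ ‖x‖ ^ 2 * (‖z‖ ^ 2 - inner ℝ (b 0) z ^ 2) / (8 * Real.pi * ‖z‖ ^ 3) := by
        gcongr
        linarith [sq_nonneg (inner ℝ (b 2) z)]
    _ = _ := by
        rw [← hx, hinner]
        field_simp

lemma le_add_rpow {x lam p : ℝ} (hx : 0 ≤ x) (hlam : 0 < lam) (hp : 1 < p) :
    x ≤ lam + lam ^ (1 - p) * x ^ p := by
  have hnn : 0 ≤ lam ^ (1 - p) * x ^ p := by positivity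
  rcases le_total x lam with h | h
  · linarith
  · have hone : 1 ≤ (x / lam) ^ (p - 1) :=
      Real.one_le_rpow ((one_le_div hlam).mpr h) (by linarith)
    calc x ≤ (x / lam) ^ (p - 1) * x := le_mul_of_one_le_left hx hone
      _ = lam ^ (1 - p) * x ^ p := by
          rw [Real.div_rpow hx hlam.le, ← neg_sub p 1, Real.rpow_neg hlam.le, div_mul_eq_mul_div,
            ← Real.rpow_add_one (hlam.trans_le h).ne', sub_add_cancel, div_eq_inv_mul]
      _ ≤ _ := le_add_of_nonneg_left hlam.le

lemma setIntegral_le_add_integral_rpow {α : Type*} [MeasurableSpace α] {μ : Measure α} {g : α → ℝ}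
    {s : Set α} {lam p : ℝ} (h0 : ∀ w, 0 ≤ g w) (hg : Integrable g μ)
    (hgp : Integrable (fun w => g w ^ p) μ) (hs : μ s ≠ ⊤) (hlam : 0 < lam) (hp : 1 < p) :
    ∫ w in s, g w ∂μ ≤ μ.real s * lam + lam ^ (1 - p) * ∫ w, g w ^ p ∂μ := by
  have hconst : IntegrableOn (fun _ => lam) s μ := integrableOn_const hs
  calc ∫ w in s, g w ∂μ ≤ ∫ w in s, (lam + lam ^ (1 - p) * g w ^ p) ∂μ :=
        integral_mono hg.integrableOn (hconst.add (hgp.const_mul _).integrableOn)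
          fun w => le_add_rpow (h0 w) hlam hp
    _ = μ.real s * lam + lam ^ (1 - p) * ∫ w in s, g w ^ p ∂μ := by
        rw [integral_add hconst (hgp.const_mul _).integrableOn, setIntegral_const,
          integral_const_mul, smul_eq_mul]
    _ ≤ _ := add_le_add le_rfl (mul_le_mul_of_nonneg_left
        (setIntegral_le_integral hgp (ae_of_all _ fun w => Real.rpow_nonneg (h0 w) p))
        (Real.rpow_nonneg hlam.le _))

lemma setIntegral_compl_closedBall_le {E : Type*} [NormedAddCommGroup E] [MeasurableSpace E]
    [OpensMeasurableSpace E] {μ : Measure E} {g : E → ℝ} {R : ℝ} (h0 : ∀ w, 0 ≤ g w)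
    (hg : Integrable g μ) (hg2 : Integrable (fun w => ‖w‖ ^ 2 * g w) μ) (hR : 0 < R) :
    ∫ w in (Metric.closedBall 0 R)ᶜ, g w ∂μ ≤ (R ^ 2)⁻¹ * ∫ w, ‖w‖ ^ 2 * g w ∂μ := by
  rw [← integral_const_mul]
  refine (setIntegral_mono_on hg.integrableOn (hg2.const_mul _).integrableOn
    Metric.isClosed_closedBall.measurableSet.compl fun w hw => ?_).trans
    (setIntegral_le_integral (hg2.const_mul _) (ae_of_all _ fun w =>
      mul_nonneg (by positivity) (mul_nonneg (sq_nonneg _) (h0 w))))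
  rw [mem_compl_iff, mem_closedBall_zero_iff, not_le] at hw
  rw [← mul_assoc, ← div_eq_inv_mul]
  exact le_mul_of_one_le_left (h0 w) ((one_le_div (by positivity)).mpr (by gcongr))

variable {g : 𝓢(Vel, ℝ)} {p R δ : ℝ}

lemma integrable_norm_sq_mul (g : 𝓢(Vel, ℝ)) : Integrable fun w => ‖w‖ ^ 2 * g w := by
  refine (PolyGrowth.mul_rapidDecay ⟨2, 1, zero_le_one, fun v => ?_⟩
    (rapidDecay_schwartz g)).integrable
    ((by fun_prop : Continuous fun w : Vel => ‖w‖ ^ 2).mul g.continuous).aestronglyMeasurable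
  rw [abs_of_nonneg (by positivity), one_mul]
  gcongr
  simp

lemma integral_le_setIntegral_diff_slab_add (h0 : ∀ v, 0 ≤ g v) {lam : ℝ} (hp : 1 < p)
    (hlam : 0 < lam) (hR : 0 < R) (hδ : 0 ≤ δ) (b : OrthonormalBasis (Fin 3) ℝ Vel) (v : Vel) :
    ∫ w, g w ≤ (∫ w in Metric.closedBall 0 R \ slab (b 1) v R δ, g w)
      + (R ^ 2)⁻¹ * (∫ w, ‖w‖ ^ 2 * g w) + 8 * δ * R ^ 2 * lam
      + lam ^ (1 - p) * ∫ w, g w ^ p := by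
  have hvol := volume_slab_le b v hR.le hδ
  have hslab := setIntegral_le_add_integral_rpow h0 g.integrable
    (integrable_rpow h0 (by linarith)) (hvol.trans_lt ENNReal.ofReal_lt_top).ne hlam hp
  have hreal : volume.real (slab (b 1) v R δ) ≤ 8 * δ * R ^ 2 :=
    ENNReal.toReal_le_of_le_ofReal (by positivity) hvol
  have hsub : slab (b 1) v R δ ⊆ Metric.closedBall 0 R :=
    fun w hw => mem_closedBall_zero_iff.mpr hw.1
  rw [← integral_add_compl (Metric.isClosed_closedBall (x := (0 : Vel)) (ε := R)).measurableSet
    g.integrable, setIntegral_sdiff (measurableSet_slab _ _ _ _) g.integrable.integrableOn hsub]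
  linarith [setIntegral_compl_closedBall_le h0 g.integrable (integrable_norm_sq_mul g) hR,
    mul_le_mul_of_nonneg_right hreal hlam.le]

lemma exists_le_setIntegral_diff_slab (hp : 1 < p) {ρ : ℝ} (hρ : 0 < ρ) (M K : ℝ) :
    ∃ R δ : ℝ, 1 ≤ R ∧ 0 < δ ∧ ∀ g : 𝓢(Vel, ℝ), (∀ v, 0 ≤ g v) → ρ ≤ ∫ v, g v →
      ∫ v, ‖v‖ ^ 2 * g v ≤ M → ∫ v, g v ^ p ≤ K → ∀ (b : OrthonormalBasis (Fin 3) ℝ Vel) (v : Vel),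
        ρ / 4 ≤ ∫ w in Metric.closedBall 0 R \ slab (b 1) v R δ, g w := by
  set R : ℝ := 1 + 4 * |M| / ρ with hR
  set lam : ℝ := (4 * |K| / ρ + 1) ^ (p - 1)⁻¹
  have hR1 : 1 ≤ R := le_add_of_nonneg_right (by positivity)
  have hlam0 : 0 < lam := by positivity
  have hlamp : lam ^ (1 - p) = (4 * |K| / ρ + 1)⁻¹ := by
    rw [← neg_sub p 1, Real.rpow_neg hlam0.le, Real.rpow_inv_rpow (by positivity)
      (by linarith)]
  refine ⟨R, ρ / (32 * lam * R ^ 2), hR1, by positivity, fun g h0 hmass hen hLp b v => ?_⟩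
  have hsplit := integral_le_setIntegral_diff_slab_add h0 hp hlam0 (by linarith : 0 < R)
    (by positivity : 0 ≤ ρ / (32 * lam * R ^ 2)) b v
  have htail : (R ^ 2)⁻¹ * (∫ w, ‖w‖ ^ 2 * g w) ≤ ρ / 4 := by
    have hMR : |M| ≤ R * (ρ / 4) := by
      rw [hR]
      field_simp
      linarith
    rw [inv_mul_le_iff₀ (by positivity)]
    calc _ ≤ R * (ρ / 4) := (hen.trans (le_abs_self M)).trans hMR
      _ ≤ _ := by
        gcongr
        exact le_self_pow₀ hR1 two_ne_zero
  have hslab : 8 * (ρ / (32 * lam * R ^ 2)) * R ^ 2 * lam = ρ / 4 := by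
    have : R ≠ 0 := by linarith
    field_simp
    norm_num
  have hlarge : lam ^ (1 - p) * ∫ w, g w ^ p ≤ ρ / 4 := by
    rw [hlamp, inv_mul_le_iff₀ (by positivity)]
    calc _ ≤ |K| := hLp.trans (le_abs_self K)
      _ ≤ |K| + ρ / 4 := by linarith
      _ = _ := by field_simp
  linarith

lemma le_sum_landauKernel_mul_of_mem_diff_slab {b : OrthonormalBasis (Fin 3) ℝ Vel}
    {ξ : Fin 3 → ℝ} (hb : ∀ z : Vel, (∑ i, ξ i ^ 2) * inner ℝ (b 1) z ^ 2
      / (8 * Real.pi * ‖z‖ ^ 3) ≤ ∑ i, ∑ j, landauKernel i j z * (ξ i * ξ j))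
    (hR : 1 ≤ R) (hδ : 0 < δ) {v w : Vel} (hw : w ∈ Metric.closedBall 0 R \ slab (b 1) v R δ) :
    (∑ i, ξ i ^ 2) * δ ^ 2 / (8 * Real.pi * (2 * R * bracket v) ^ 3)
      ≤ ∑ i, ∑ j, landauKernel i j (v - w) * (ξ i * ξ j) := by
  have hwR : ‖w‖ ≤ R := mem_closedBall_zero_iff.mp hw.1
  have hwS : δ ≤ |inner ℝ (b 1) (v - w)| := not_lt.mp fun h => hw.2 ⟨hwR, h⟩
  have hpos : 0 < ‖v - w‖ := norm_pos_iff.mpr fun h => by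
    rw [h, inner_zero_right, abs_zero] at hwS
    linarith
  have hle : ‖v - w‖ ≤ 2 * R * bracket v := by
    nlinarith [norm_sub_le v w, norm_le_bracket v, one_le_bracket v]
  have hsq : δ ^ 2 ≤ inner ℝ (b 1) (v - w) ^ 2 := by
    rw [← sq_abs (inner ℝ (b 1) (v - w))]
    gcongr
  refine le_trans ?_ (hb (v - w))
  have := Finset.sum_nonneg fun (i : Fin 3) (_ : i ∈ Finset.univ) => sq_nonneg (ξ i)
  gcongr

lemma integrable_sum_landauKernel_mul (g : 𝓢(Vel, ℝ)) (v : Vel) (ξ : Fin 3 → ℝ) (i j : Fin 3) :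
    Integrable fun w => landauKernel i j (v - w) * (ξ i * ξ j) * g w := by
  simpa only [mul_right_comm] using (integrable_conv (coulombDominated_landauKernel i j)
    (rapidDecay_schwartz g) g.continuous.measurable v).mul_const (ξ i * ξ j)

lemma sum_conv_landauKernel_mul (g : 𝓢(Vel, ℝ)) (v : Vel) (ξ : Fin 3 → ℝ) :
    ∑ i, ∑ j, conv (landauKernel i j) g v * (ξ i * ξ j)
      = ∫ w, (∑ i, ∑ j, landauKernel i j (v - w) * (ξ i * ξ j)) * g w := by
  have hint := integrable_sum_landauKernel_mul g v ξ
  simp only [Finset.sum_mul]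
  rw [integral_finsetSum _ fun i _ => integrable_finsetSum _ fun j _ => hint i j]
  refine Finset.sum_congr rfl fun i _ => ?_
  rw [integral_finsetSum _ fun j _ => hint i j]
  refine Finset.sum_congr rfl fun j _ => ?_
  rw [conv, ← integral_mul_const]
  simp only [mul_right_comm]

lemma exists_coercivity (hp : 1 < p) {ρ : ℝ} (hρ : 0 < ρ) (M K : ℝ) : ∃ c : ℝ, 0 < c ∧
    ∀ g : 𝓢(Vel, ℝ), (∀ v, 0 ≤ g v) → ρ ≤ ∫ v, g v → ∫ v, ‖v‖ ^ 2 * g v ≤ M →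
      ∫ v, g v ^ p ≤ K → ∀ v (ξ : Fin 3 → ℝ), c * bracket v ^ (-3 : ℝ) * ∑ i, ξ i ^ 2
        ≤ ∑ i, ∑ j, conv (landauKernel i j) g v * (ξ i * ξ j) := by
  obtain ⟨R, δ, hR, hδ, hmass⟩ := exists_le_setIntegral_diff_slab hp hρ M K
  refine ⟨δ ^ 2 / (8 * Real.pi * (2 * R) ^ 3) * (ρ / 4), by positivity,
    fun g h0 hρg hen hLp v ξ => ?_⟩
  obtain ⟨b, hb⟩ := exists_le_sum_landauKernel_mul ξ
  set G := Metric.closedBall 0 R \ slab (b 1) v R δ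
  set a := (∑ i, ξ i ^ 2) * δ ^ 2 / (8 * Real.pi * (2 * R * bracket v) ^ 3) with ha
  have hbv := bracket_pos v
  have hint : Integrable fun w => (∑ i, ∑ j, landauKernel i j (v - w) * (ξ i * ξ j)) * g w := by
    simp only [Finset.sum_mul]
    exact integrable_finsetSum _ fun i _ => integrable_finsetSum _ fun j _ =>
      integrable_sum_landauKernel_mul g v ξ i j
  have hnonneg (w : Vel) : 0 ≤ (∑ i, ∑ j, landauKernel i j (v - w) * (ξ i * ξ j)) * g w :=
    mul_nonneg ((div_nonneg (mul_nonneg (Finset.sum_nonneg fun i _ => sq_nonneg _)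
      (sq_nonneg _)) (by positivity)).trans (hb (v - w))) (h0 w)
  calc _ = a * (ρ / 4) := by
        rw [ha, Real.rpow_neg hbv.le, Real.rpow_ofNat]
        field_simp
    _ ≤ a * ∫ w in G, g w := by
        gcongr
        exact hmass g h0 hρg hen hLp b v
    _ ≤ ∫ w in G, (∑ i, ∑ j, landauKernel i j (v - w) * (ξ i * ξ j)) * g w := by
        rw [← integral_const_mul]
        exact setIntegral_mono_on (g.integrable.const_mul a).integrableOn hint.integrableOn
          (Metric.isClosed_closedBall.measurableSet.diff (measurableSet_slab _ _ _ _))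
          fun w hw => mul_le_mul_of_nonneg_right
            (le_sum_landauKernel_mul_of_mem_diff_slab hb hR hδ hw) (h0 w)
    _ ≤ ∫ w, (∑ i, ∑ j, landauKernel i j (v - w) * (ξ i * ξ j)) * g w :=
        setIntegral_le_integral hint (ae_of_all _ hnonneg)
    _ = _ := (sum_conv_landauKernel_mul g v ξ).symm

end coercivity

/-! ### The Sobolev inequality -/

section sobolev

/-- The constant of the Sobolev inequality `H¹ ⊂ L⁶` for compactly supported functions. -/
def sobolevConst : ℝ := SNormLESNormFDerivOfEqConst ℝ (volume : Measure Vel) 2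

lemma sobolevConst_nonneg : 0 ≤ sobolevConst := NNReal.coe_nonneg _

lemma integral_pow_six_le_of_hasCompactSupport {u : Vel → ℝ} (hc : HasCompactSupport u)
    (hu : ContDiff ℝ 1 u) :
    ∫ v, u v ^ 6 ≤ sobolevConst ^ 6 * (∫ v, ‖fderiv ℝ u v‖ ^ 2) ^ 3 := by
  have hsob := eLpNorm_le_eLpNorm_fderiv_of_eq (volume : Measure Vel) (p := 2) (p' := 6) hu hc
    (by norm_num) (by simp) (by simp; norm_num)
  have hu6 : MemLp u (6 : NNReal) volume := hu.continuous.memLp_of_hasCompactSupport hc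
  have hd2 : MemLp (fderiv ℝ u) (2 : NNReal) volume :=
    (hu.continuous_fderiv (by norm_num)).memLp_of_hasCompactSupport (hc.fderiv ℝ)
  rw [hu6.eLpNorm_eq_integral_rpow_norm (by norm_num) (by norm_num),
    hd2.eLpNorm_eq_integral_rpow_norm (by norm_num) (by norm_num),
    ← ENNReal.ofReal_coe_nnreal (p := SNormLESNormFDerivOfEqConst ℝ volume _),
    ← ENNReal.ofReal_mul (by positivity), ENNReal.ofReal_le_ofReal_iff (by positivity)] at hsob
  simp only [ENNReal.coe_toReal, NNReal.coe_ofNat, Real.rpow_ofNat, Real.norm_eq_abs,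
    Even.pow_abs (show Even 6 by decide)] at hsob
  have hX : 0 ≤ ∫ v, u v ^ 6 := integral_nonneg fun v => by positivity
  have hY : 0 ≤ ∫ v, ‖fderiv ℝ u v‖ ^ 2 := integral_nonneg fun v => by positivity
  calc ∫ v, u v ^ 6 = ((∫ v, u v ^ 6) ^ (6 : ℝ)⁻¹) ^ 6 := by
        rw [← Real.rpow_mul_natCast hX]
        norm_num
    _ ≤ (sobolevConst * (∫ v, ‖fderiv ℝ u v‖ ^ 2) ^ (2 : ℝ)⁻¹) ^ 6 :=
        pow_le_pow_left₀ (by positivity) hsob 6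
    _ = sobolevConst ^ 6 * (∫ v, ‖fderiv ℝ u v‖ ^ 2) ^ 3 := by
        rw [mul_pow, ← Real.rpow_mul_natCast hY, ← Real.rpow_natCast _ 3]
        norm_num

lemma norm_fderiv_mul_sq_le {E : Type*} [NormedAddCommGroup E] [NormedSpace ℝ E] {χ u : E → ℝ}
    {v : E} {B : ℝ} (hχ : DifferentiableAt ℝ χ v) (hu : DifferentiableAt ℝ u v)
    (hB : ‖fderiv ℝ χ v‖ ≤ B) :
    ‖fderiv ℝ (fun w => χ w * u w) v‖ ^ 2
      ≤ 2 * (χ v ^ 2 * ‖fderiv ℝ u v‖ ^ 2) + 2 * B ^ 2 * u v ^ 2 := by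
  have hle : ‖fderiv ℝ (fun w => χ w * u w) v‖ ≤ |χ v| * ‖fderiv ℝ u v‖ + |u v| * B := by
    rw [fderiv_fun_mul hχ hu]
    refine (norm_add_le _ _).trans ?_
    rw [norm_smul, norm_smul, Real.norm_eq_abs, Real.norm_eq_abs]
    gcongr
  calc ‖fderiv ℝ (fun w => χ w * u w) v‖ ^ 2
      ≤ (|χ v| * ‖fderiv ℝ u v‖ + |u v| * B) ^ 2 := by gcongr
    _ ≤ 2 * ((|χ v| * ‖fderiv ℝ u v‖) ^ 2 + (|u v| * B) ^ 2) := add_sq_le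
    _ = _ := by
        rw [mul_pow, mul_pow, sq_abs, sq_abs]
        ring

variable {u : Vel → ℝ}

lemma integral_cutoff_mul_pow_six_le {χ : Vel → ℝ} {B : ℝ} (hc : HasCompactSupport χ)
    (hχ : ContDiff ℝ 1 χ) (hχ1 : ∀ v, |χ v| ≤ 1) (hB : ∀ v, ‖fderiv ℝ χ v‖ ≤ B)
    (hu : ContDiff ℝ 1 u) (hu2 : Integrable fun v => u v ^ 2)
    (hd2 : Integrable fun v => ‖fderiv ℝ u v‖ ^ 2) :
    ∫ v, (χ v * u v) ^ 6
      ≤ sobolevConst ^ 6 * (2 * (∫ v, ‖fderiv ℝ u v‖ ^ 2) + 2 * B ^ 2 * ∫ v, u v ^ 2) ^ 3 := by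
  refine (integral_pow_six_le_of_hasCompactSupport hc.mul_right (hχ.mul hu)).trans ?_
  refine mul_le_mul_of_nonneg_left (pow_le_pow_left₀ (integral_nonneg fun v => sq_nonneg _) ?_ 3)
    (pow_nonneg sobolevConst_nonneg 6)
  rw [← integral_const_mul, ← integral_const_mul, ← integral_add (hd2.const_mul _)
    (hu2.const_mul _)]
  refine integral_mono_of_nonneg (ae_of_all _ fun v => by positivity)
    ((hd2.const_mul _).add (hu2.const_mul _)) (ae_of_all _ fun v => ?_)
  refine (norm_fderiv_mul_sq_le (hχ.differentiable one_ne_zero v)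
    (hu.differentiable one_ne_zero v) (hB v)).trans ?_
  beta_reduce
  gcongr
  exact mul_le_of_le_one_left (by positivity) ((sq_le_one_iff_abs_le_one _).mpr (hχ1 v))

lemma exists_bump_fderiv_le : ∃ (χ : ContDiffBump (0 : Vel)) (B : ℝ), ∀ a v,
    ‖fderiv ℝ (fun w : Vel => χ (a • w)) v‖ ≤ |a| * B := by
  let χ : ContDiffBump (0 : Vel) := ⟨1, 2, one_pos, one_lt_two⟩
  obtain ⟨B, hB⟩ := ((χ.contDiff (n := 1)).continuous_fderiv
    one_ne_zero).bounded_above_of_compact_support (χ.hasCompactSupport.fderiv ℝ)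
  refine ⟨χ, B, fun a v => ?_⟩
  rw [fderiv_comp_smul, norm_smul, Real.norm_eq_abs]
  gcongr
  exact hB _

/- Apply the compactly supported inequality to `χ (v / n) u v`; as `n → ∞` the contribution of
`∇ (χ (v / n))` vanishes. -/
lemma integral_pow_six_le (hu : ContDiff ℝ 1 u) (hu2 : Integrable fun v => u v ^ 2)
    (hd2 : Integrable fun v => ‖fderiv ℝ u v‖ ^ 2) (hu6 : Integrable fun v => u v ^ 6) :
    ∫ v, u v ^ 6 ≤ sobolevConst ^ 6 * (2 * ∫ v, ‖fderiv ℝ u v‖ ^ 2) ^ 3 := by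
  obtain ⟨χ, B, hB⟩ := exists_bump_fderiv_le
  set a : ℕ → ℝ := fun n => 1 / ((n : ℝ) + 1)
  have ha0 : Tendsto a atTop (𝓝 0) := tendsto_one_div_add_atTop_nhds_zero_nat
  have hχa (n : ℕ) : ContDiff ℝ 1 fun v : Vel => χ (a n • v) :=
    χ.contDiff.comp (contDiff_const_smul (a n))
  have hlhs : Tendsto (fun n => ∫ v, (χ (a n • v) * u v) ^ 6) atTop (𝓝 (∫ v, u v ^ 6)) := by
    refine tendsto_integral_of_dominated_convergence (fun v => u v ^ 6)
      (fun n => (((hχa n).continuous.mul hu.continuous).pow 6).aestronglyMeasurable) hu6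
      (fun n => ae_of_all _ fun v => ?_) (ae_of_all _ fun v => ?_)
    · rw [Real.norm_of_nonneg (by positivity), mul_pow]
      exact mul_le_of_le_one_left (by positivity) (pow_le_one₀ χ.nonneg χ.le_one)
    · have hχ0 : Tendsto (fun n => χ (a n • v)) atTop (𝓝 1) := by
        rw [← χ.one_of_mem_closedBall (Metric.mem_closedBall_self χ.rIn_pos.le)]
        refine (χ.continuous.tendsto 0).comp ?_
        simpa only [zero_smul] using ha0.smul_const v
      simpa only [one_mul] using (hχ0.mul_const (u v)).pow 6
  have hrhs : Tendsto (fun n => sobolevConst ^ 6 * (2 * (∫ v, ‖fderiv ℝ u v‖ ^ 2)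
      + 2 * (|a n| * B) ^ 2 * ∫ v, u v ^ 2) ^ 3) atTop
      (𝓝 (sobolevConst ^ 6 * (2 * ∫ v, ‖fderiv ℝ u v‖ ^ 2) ^ 3)) := by
    have hzero : Tendsto (fun n => 2 * (|a n| * B) ^ 2 * ∫ v, u v ^ 2) atTop (𝓝 0) := by
      simpa using (((ha0.abs.mul_const B).pow 2).const_mul 2).mul_const (∫ v, u v ^ 2)
    simpa only [add_zero] using ((hzero.const_add _).pow 3).const_mul (sobolevConst ^ 6)
  refine le_of_tendsto_of_tendsto' hlhs hrhs fun n => ?_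
  exact integral_cutoff_mul_pow_six_le (χ.hasCompactSupport.comp_smul (by positivity)) (hχa n)
    (fun v => abs_le.mpr ⟨by linarith [χ.nonneg' (a n • v)], χ.le_one⟩) (hB _) hu hu2 hd2

end sobolev

/-! ### Interpolation -/

section interpolation

lemma integral_prod_rpow_le {α ι : Type*} [MeasurableSpace α] {μ : Measure α} {s : Finset ι}
    {F : ι → α → ℝ} {θ : ι → ℝ} (h0 : ∀ i ∈ s, ∀ x, 0 ≤ F i x)
    (hF : ∀ i ∈ s, Integrable (F i) μ) (hθ : ∀ i ∈ s, 0 ≤ θ i) (hsum : ∑ i ∈ s, θ i = 1) :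
    ∫ x, ∏ i ∈ s, F i x ^ θ i ∂μ ≤ ∏ i ∈ s, (∫ x, F i x ∂μ) ^ θ i := by
  have hholder := ENNReal.lintegral_prod_norm_pow_le (μ := μ) s (p := θ)
    (f := fun i x => ENNReal.ofReal (F i x)) (fun i hi => (hF i hi).1.aemeasurable.ennreal_ofReal)
    hsum hθ
  have hpow (i) (hi : i ∈ s) (x) : 0 ≤ F i x ^ θ i := Real.rpow_nonneg (h0 i hi x) _
  have hint (i) (hi : i ∈ s) : 0 ≤ (∫ x, F i x ∂μ) ^ θ i :=
    Real.rpow_nonneg (integral_nonneg (h0 i hi)) _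
  have hlhs (x) : ∏ i ∈ s, ENNReal.ofReal (F i x) ^ θ i
      = ENNReal.ofReal (∏ i ∈ s, F i x ^ θ i) := by
    rw [ENNReal.ofReal_prod_of_nonneg fun i hi => hpow i hi x]
    exact Finset.prod_congr rfl fun i hi =>
      ENNReal.ofReal_rpow_of_nonneg (h0 i hi x) (hθ i hi)
  have hrhs : ∏ i ∈ s, (∫⁻ x, ENNReal.ofReal (F i x) ∂μ) ^ θ i
      = ENNReal.ofReal (∏ i ∈ s, (∫ x, F i x ∂μ) ^ θ i) := by
    rw [ENNReal.ofReal_prod_of_nonneg hint]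
    refine Finset.prod_congr rfl fun i hi => ?_
    rw [← ofReal_integral_eq_lintegral_ofReal (hF i hi) (ae_of_all _ (h0 i hi)),
      ENNReal.ofReal_rpow_of_nonneg (integral_nonneg (h0 i hi)) (hθ i hi)]
  simp only [hlhs, hrhs] at hholder
  rw [integral_eq_lintegral_of_nonneg_ae
    (ae_of_all _ fun x => Finset.prod_nonneg fun i hi => hpow i hi x)
    (Finset.aemeasurable_fun_prod s fun i hi =>
      (hF i hi).1.aemeasurable.pow_const _).aestronglyMeasurable]
  exact ENNReal.toReal_le_of_le_ofReal (Finset.prod_nonneg hint) hholder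

lemma exists_mul_rpow_le_mul_add {A a η : ℝ} (hA : 0 ≤ A) (ha0 : 0 ≤ a) (ha : a < 1)
    (hη : 0 < η) : ∃ C : ℝ, 0 ≤ C ∧ ∀ Z : ℝ, 0 ≤ Z → A * Z ^ a ≤ η * Z + C := by
  set τ := (η / (A + 1)) ^ (a - 1)⁻¹
  have hτ : 0 < τ := by positivity
  have hτa : τ ^ (a - 1) = η / (A + 1) := Real.rpow_inv_rpow (by positivity) (by linarith)
  refine ⟨A * τ ^ a, by positivity, fun Z hZ => ?_⟩
  rcases le_total Z τ with h | h
  · exact le_add_of_nonneg_of_le (by positivity) (by gcongr)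
  refine le_add_of_le_of_nonneg ?_ (by positivity)
  have hZ0 : 0 < Z := hτ.trans_le h
  calc A * Z ^ a = A * (Z ^ (a - 1) * Z) := by rw [← Real.rpow_add_one hZ0.ne', sub_add_cancel]
    _ ≤ A * (η / (A + 1) * Z) := by
        rw [← hτa]
        gcongr ?_ * (?_ * Z)
        exact Real.rpow_le_rpow_of_nonpos hτ h (by linarith)
    _ = A / (A + 1) * (η * Z) := by ring
    _ ≤ η * Z := mul_le_of_le_one_left (by positivity) (div_le_one_of_le₀ (by linarith)
        (by positivity))

/-- The function `⟨v⟩^{-3/2} g^{p/2}`, to which the Sobolev inequality is applied. -/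
def weightedRoot (p : ℝ) (g : Vel → ℝ) (v : Vel) : ℝ :=
  bracket v ^ (-(3 / 2) : ℝ) * g v ^ (p / 2)

variable {g : 𝓢(Vel, ℝ)} {p m : ℝ}

lemma bracket_rpow_neg_three_halves_sq (v : Vel) :
    (bracket v ^ (-(3 / 2) : ℝ)) ^ 2 = bracket v ^ (-3 : ℝ) := by
  rw [← Real.rpow_mul_natCast (bracket_pos v).le]
  norm_num

lemma weightedRoot_sq (h0 : ∀ v, 0 ≤ g v) (v : Vel) :
    weightedRoot p g v ^ 2 = bracket v ^ (-3 : ℝ) * g v ^ p := by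
  rw [weightedRoot, mul_pow, bracket_rpow_neg_three_halves_sq, ← Real.rpow_mul_natCast (h0 v),
    Nat.cast_ofNat, div_mul_cancel₀ p two_ne_zero]

lemma weightedRoot_pow_six (h0 : ∀ v, 0 ≤ g v) (v : Vel) :
    weightedRoot p g v ^ 6 = bracket v ^ (-9 : ℝ) * g v ^ (3 * p) := by
  rw [pow_mul _ 2 3, weightedRoot_sq h0, mul_pow, ← Real.rpow_mul_natCast (bracket_pos v).le,
    ← Real.rpow_mul_natCast (h0 v), mul_comm p]
  norm_num

lemma weightedRoot_sq_le (h0 : ∀ v, 0 ≤ g v) (v : Vel) : weightedRoot p g v ^ 2 ≤ g v ^ p := by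
  rw [weightedRoot_sq h0]
  exact mul_le_of_le_one_left (Real.rpow_nonneg (h0 v) p)
    (Real.rpow_le_one_of_one_le_of_nonpos (one_le_bracket v) (by norm_num))

lemma contDiff_bracket_rpow (s : ℝ) : ContDiff ℝ 1 fun v => bracket v ^ s := by
  refine contDiff_one_iff_fderiv.mpr
    ⟨fun v => (hasFDerivAt_bracket_rpow s v).differentiableAt, ?_⟩
  rw [funext fun v => (hasFDerivAt_bracket_rpow s v).fderiv]
  exact ((continuous_bracket_rpow _).const_mul _).smul (innerSL ℝ).continuous

lemma norm_fderiv_bracket_rpow_le {s : ℝ} (hs : s ≤ 1) (v : Vel) :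
    ‖fderiv ℝ (fun w => bracket w ^ s) v‖ ≤ |s| := by
  rw [(hasFDerivAt_bracket_rpow s v).fderiv, norm_smul, innerSL_apply_norm, Real.norm_eq_abs,
    abs_mul, abs_of_pos (bracket_rpow_pos v _), mul_assoc]
  refine mul_le_of_le_one_right (abs_nonneg s) ?_
  calc bracket v ^ (s - 2) * ‖v‖ ≤ bracket v ^ (s - 2) * bracket v :=
        mul_le_mul_of_nonneg_left (norm_le_bracket v) (bracket_rpow_pos v _).le
    _ = bracket v ^ (s - 2 + 1) := (Real.rpow_add_one (bracket_pos v).ne' _).symm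
    _ ≤ 1 := Real.rpow_le_one_of_one_le_of_nonpos (one_le_bracket v) (by linarith)

lemma contDiff_weightedRoot (h0 : ∀ v, 0 ≤ g v) (hp : 1 < p) :
    ContDiff ℝ 1 (weightedRoot p g) := by
  obtain ⟨L, hL⟩ := exists_nonnegC11 g h0
  exact (contDiff_bracket_rpow _).mul (hL.contDiff_rpow (by linarith))

lemma norm_fderiv_weightedRoot_sq_le (h0 : ∀ v, 0 ≤ g v) (hp : 1 < p) (v : Vel) :
    ‖fderiv ℝ (weightedRoot p g) v‖ ^ 2 ≤ 2 * dissipation p g v + 9 / 2 * g v ^ p := by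
  obtain ⟨L, hL⟩ := exists_nonnegC11 g h0
  have hroot : (g v ^ (p / 2)) ^ 2 = g v ^ p := by
    rw [← Real.rpow_mul_natCast (h0 v), Nat.cast_ofNat, div_mul_cancel₀ p two_ne_zero]
  have hle := norm_fderiv_mul_sq_le
    ((contDiff_bracket_rpow (-(3 / 2))).differentiable one_ne_zero v)
    ((hL.contDiff_rpow (by linarith : 1 / 2 < p / 2)).differentiable one_ne_zero v)
    (norm_fderiv_bracket_rpow_le (by norm_num) v)
  rw [sq_abs, bracket_rpow_neg_three_halves_sq, hroot] at hle
  calc _ ≤ _ := hle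
    _ = _ := by
        rw [dissipation, norm_gradient]
        norm_num

lemma integrable_bracket_rpow_mul_rpow (h0 : ∀ v, 0 ≤ g v) (s : ℝ) {q : ℝ} (hq : 0 < q) :
    Integrable fun v => bracket v ^ s * g v ^ q :=
  ((polyGrowth_bracket_rpow s).mul_rapidDecay ((rapidDecay_schwartz g).rpow h0 hq)).integrable
    ((continuous_bracket_rpow s).mul
      (g.continuous.rpow_const fun _ => Or.inr hq.le)).aestronglyMeasurable

lemma integral_bracket_rpow_mul_rpow_le (h0 : ∀ v, 0 ≤ g v) (hp : 1 < p) :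
    ∫ v, bracket v ^ (-9 : ℝ) * g v ^ (3 * p)
      ≤ sobolevConst ^ 6 * (4 * (∫ v, dissipation p g v) + 9 * ∫ v, g v ^ p) ^ 3 := by
  have hu := contDiff_weightedRoot h0 hp
  have hgp := integrable_rpow h0 (by linarith : 0 < p)
  have hdom := ((integrable_dissipation h0 hp).const_mul 2).add (hgp.const_mul (9 / 2))
  have hu2 : Integrable fun v => weightedRoot p g v ^ 2 :=
    hgp.mono' (hu.continuous.pow 2).aestronglyMeasurable (ae_of_all _ fun v =>
      (Real.norm_of_nonneg (sq_nonneg _)).trans_le (weightedRoot_sq_le h0 v))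
  have hd2 : Integrable fun v => ‖fderiv ℝ (weightedRoot p g) v‖ ^ 2 :=
    hdom.mono' ((hu.continuous_fderiv one_ne_zero).norm.pow 2).aestronglyMeasurable
      (ae_of_all _ fun v => (Real.norm_of_nonneg (sq_nonneg _)).trans_le
        (norm_fderiv_weightedRoot_sq_le h0 hp v))
  have hu6 : Integrable fun v => weightedRoot p g v ^ 6 := by
    simp only [weightedRoot_pow_six h0]
    exact integrable_bracket_rpow_mul_rpow h0 _ (by linarith)
  have hgrad : ∫ v, ‖fderiv ℝ (weightedRoot p g) v‖ ^ 2
      ≤ 2 * (∫ v, dissipation p g v) + 9 / 2 * ∫ v, g v ^ p := by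
    rw [← integral_const_mul, ← integral_const_mul,
      ← integral_add' ((integrable_dissipation h0 hp).const_mul 2) (hgp.const_mul (9 / 2))]
    exact integral_mono hd2 hdom (norm_fderiv_weightedRoot_sq_le h0 hp)
  calc ∫ v, bracket v ^ (-9 : ℝ) * g v ^ (3 * p) = ∫ v, weightedRoot p g v ^ 6 := by
        simp only [weightedRoot_pow_six h0]
    _ ≤ sobolevConst ^ 6 * (2 * ∫ v, ‖fderiv ℝ (weightedRoot p g) v‖ ^ 2) ^ 3 :=
        integral_pow_six_le hu hu2 hd2 hu6
    _ ≤ _ := by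
        refine mul_le_mul_of_nonneg_left (pow_le_pow_left₀ (mul_nonneg zero_le_two
          (integral_nonneg fun v => sq_nonneg _)) ?_ 3) (pow_nonneg sobolevConst_nonneg 6)
        linarith

/- The exponents interpolating `g^{p+1}` between `⟨v⟩^{-9} g^{3p}`, `⟨v⟩^m g` and `g^p`. The
condition on `m` is exactly `3 s < 1`, which makes the dissipation enter sublinearly. -/
lemma exists_interpolation_exponents (hp : 3 / 2 < p)
    (hm : 9 / 2 * ((p - 1) / (p - 3 / 2)) < m) : ∃ s t r : ℝ, 0 < s ∧ 3 * s < 1 ∧ 0 < t ∧ 0 ≤ r ∧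
      s + t + r = 1 ∧ -9 * s + m * t = 0 ∧ 3 * p * s + t + p * r = p + 1 := by
  rw [← mul_div_assoc, div_lt_iff₀ (by linarith)] at hm
  have hm0 : 0 < m := pos_of_mul_pos_left (by linarith : 0 < m * (p - 3 / 2)) (by linarith)
  set d := 2 * p * m - 9 * (p - 1) with hd
  have hd3 : 3 * m < d := by linarith
  have hd0 : 0 < d := by linarith
  refine ⟨m / d, 9 / d, 1 - m / d - 9 / d, by positivity, ?_, by positivity, ?_, by ring, by ring,
    ?_⟩
  · rwa [← mul_div_assoc, div_lt_one hd0]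
  · rw [sub_sub, ← add_div, sub_nonneg, div_le_one hd0]
    nlinarith
  · field_simp
    rw [hd]
    ring

lemma integral_rpow_add_one_le (h0 : ∀ v, 0 ≤ g v) (hp : 0 < p) {s t r : ℝ} (hs : 0 < s)
    (ht : 0 ≤ t) (hr : 0 ≤ r) (hsum : s + t + r = 1) (hweight : -9 * s + m * t = 0)
    (hpow : 3 * p * s + t + p * r = p + 1) :
    ∫ v, g v ^ (p + 1) ≤ (∫ v, bracket v ^ (-9 : ℝ) * g v ^ (3 * p)) ^ s
      * (∫ v, bracket v ^ m * g v) ^ t * (∫ v, g v ^ p) ^ r := by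
  have hfactor (v : Vel) : g v ^ (p + 1) = (bracket v ^ (-9 : ℝ) * g v ^ (3 * p)) ^ s
      * (bracket v ^ m * g v) ^ t * (g v ^ p) ^ r := by
    have hb := bracket_pos v
    rcases (h0 v).eq_or_lt' with h | h
    · rw [h, Real.zero_rpow (by linarith : 3 * p ≠ 0), Real.zero_rpow (by linarith : p + 1 ≠ 0),
        mul_zero, Real.zero_rpow hs.ne', zero_mul, zero_mul]
    · rw [Real.mul_rpow (bracket_rpow_pos v _).le (Real.rpow_nonneg h.le _),
        Real.mul_rpow (bracket_rpow_pos v _).le h.le, ← Real.rpow_mul hb.le, ← Real.rpow_mul hb.le,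
        ← Real.rpow_mul h.le, ← Real.rpow_mul h.le, mul_mul_mul_comm, ← Real.rpow_add hb,
        ← Real.rpow_add h, mul_assoc, ← Real.rpow_add h, hpow, hweight, Real.rpow_zero, one_mul]
  have hmom : Integrable fun v => bracket v ^ m * g v := by
    simpa only [Real.rpow_one] using integrable_bracket_rpow_mul_rpow h0 m one_pos
  have hholder := integral_prod_rpow_le (μ := volume) (s := Finset.univ) (θ := ![s, t, r])
    (F := ![fun v => bracket v ^ (-9 : ℝ) * g v ^ (3 * p), fun v => bracket v ^ m * g v,
      fun v => g v ^ p])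
    (by
      intro i _
      fin_cases i
      exacts [fun v => mul_nonneg (bracket_rpow_pos v _).le (Real.rpow_nonneg (h0 v) _),
        fun v => mul_nonneg (bracket_rpow_pos v _).le (h0 v), fun v => Real.rpow_nonneg (h0 v) p])
    (by
      intro i _
      fin_cases i
      exacts [integrable_bracket_rpow_mul_rpow h0 _ (by linarith : 0 < 3 * p), hmom,
        integrable_rpow h0 hp])
    (by simp [Fin.forall_fin_succ, hs.le, ht, hr])
    (by simpa [Fin.sum_univ_three] using hsum)
  simpa [Fin.prod_univ_three, hfactor] using hholder

lemma exists_interpolation (hp : 3 / 2 < p) (hm : 9 / 2 * ((p - 1) / (p - 3 / 2)) < m)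
    {M K η : ℝ} (hM : 0 ≤ M) (hK : 0 ≤ K) (hη : 0 < η) : ∃ C : ℝ, 0 ≤ C ∧
    ∀ g : 𝓢(Vel, ℝ), (∀ v, 0 ≤ g v) → ∫ v, bracket v ^ m * g v ≤ M → ∫ v, g v ^ p ≤ K →
      ∫ v, g v ^ (p + 1) ≤ η * (∫ v, dissipation p g v) + C := by
  obtain ⟨s, t, r, hs, hs3, ht, hr, hsum, hweight, hpow⟩ := exists_interpolation_exponents hp hm
  have := sobolevConst_nonneg
  obtain ⟨D, hD, hyoung⟩ := exists_mul_rpow_le_mul_add (A := (sobolevConst ^ 6) ^ s * M ^ t * K ^ r)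
    (a := 3 * s) (η := η / 4) (by positivity) (by positivity) hs3 (by positivity)
  refine ⟨η / 4 * (9 * K) + D, by positivity, fun g h0 hgM hgK => ?_⟩
  set X := ∫ v, bracket v ^ (-9 : ℝ) * g v ^ (3 * p)
  set Z := 4 * (∫ v, dissipation p g v) + 9 * K with hZ
  have hΔ : 0 ≤ ∫ v, dissipation p g v := integral_nonneg (dissipation_nonneg p g)
  have hX0 : 0 ≤ X := integral_nonneg fun v =>
    mul_nonneg (bracket_rpow_pos v _).le (Real.rpow_nonneg (h0 v) _)
  have hE0 : 0 ≤ ∫ v, bracket v ^ m * g v :=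
    integral_nonneg fun v => mul_nonneg (bracket_rpow_pos v _).le (h0 v)
  have hY0 : 0 ≤ ∫ v, g v ^ p := integral_nonneg fun v => Real.rpow_nonneg (h0 v) p
  have hZ0 : 0 ≤ Z := by positivity
  have hX : X ≤ sobolevConst ^ 6 * Z ^ 3 :=
    (integral_bracket_rpow_mul_rpow_le h0 (by linarith)).trans (by rw [hZ]; gcongr)
  calc ∫ v, g v ^ (p + 1) ≤ X ^ s * (∫ v, bracket v ^ m * g v) ^ t * (∫ v, g v ^ p) ^ r :=
        integral_rpow_add_one_le h0 (by linarith) hs ht.le hr hsum hweight hpow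
    _ ≤ (sobolevConst ^ 6 * Z ^ 3) ^ s * M ^ t * K ^ r := by gcongr
    _ = (sobolevConst ^ 6) ^ s * M ^ t * K ^ r * Z ^ (3 * s) := by
        rw [Real.mul_rpow (by positivity) (by positivity), ← Real.rpow_natCast Z,
          ← Real.rpow_mul hZ0, Nat.cast_ofNat]
        ring
    _ ≤ η / 4 * Z + D := hyoung Z hZ0
    _ = η * (∫ v, dissipation p g v) + (η / 4 * (9 * K) + D) := by
        rw [hZ]
        ring

end interpolation

/-! ### Evolution in time -/

section evolution

variable {T : ℝ} {f : ℝ → Vel → ℝ}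

lemma abs_pderiv_le (g : 𝓢(Vel, ℝ)) (i : Fin 3) (v : Vel) :
    |pderiv i g v| ≤ ‖iteratedFDeriv ℝ 1 g v‖ := by
  rw [pderiv_apply, norm_iteratedFDeriv_one]
  exact abs_partialDeriv_le i g v

lemma abs_pderiv_pderiv_le (g : 𝓢(Vel, ℝ)) (i j : Fin 3) (v : Vel) :
    |pderiv i (pderiv j g) v| ≤ ‖iteratedFDeriv ℝ 2 g v‖ := by
  have hcoord : pderiv i (pderiv j g) v
      = iteratedFDeriv ℝ 2 g v ![EuclideanSpace.single i 1, EuclideanSpace.single j 1] := by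
    rw [← SchwartzMap.iteratedLineDerivOp_eq_iteratedFDeriv]
    simp [pderiv, LineDeriv.iteratedLineDerivOp_succ_left]
  rw [hcoord, ← Real.norm_eq_abs]
  refine (ContinuousMultilinearMap.le_opNorm _ _).trans_eq ?_
  simp [Fin.prod_univ_two]

lemma abs_mul_le_of_decay {a b C D r : ℝ} {n : ℕ} (hr : 0 ≤ r) (ha : |a| ≤ C * (1 + r) ^ n)
    (hb : |b| ≤ D * ((1 + r) ^ (n + 4))⁻¹) : |a * b| ≤ C * D * ((1 + r) ^ 4)⁻¹ := by
  calc |a * b| ≤ (C * (1 + r) ^ n) * (D * ((1 + r) ^ (n + 4))⁻¹) := by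
        rw [abs_mul]
        exact mul_le_mul ha hb (abs_nonneg _) ((abs_nonneg _).trans ha)
    _ = C * D * ((1 + r) ^ 4)⁻¹ := by
        rw [pow_add]
        field_simp

namespace IsSchwartzSolution

lemma contDiff (hf : IsSchwartzSolution T f) {t : ℝ} (ht : t ∈ Ioo 0 T) : ContDiff ℝ ∞ (f t) := by
  have hslice : ContDiffOn ℝ ∞ (fun v : Vel => (t, v)) univ := by fun_prop
  exact contDiffOn_univ.mp (hf.smooth.comp hslice fun v _ => ⟨ht, mem_univ v⟩)

/-- The solution at an interior time, as a Schwartz function. -/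
def slice (hf : IsSchwartzSolution T f) {t : ℝ} (ht : t ∈ Ioo 0 T) : 𝓢(Vel, ℝ) where
  toFun := f t
  smooth' := hf.contDiff ht
  decay' k n := let ⟨C, hC⟩ := hf.decay k n; ⟨C, fun v => hC t ht v⟩

lemma coe_slice (hf : IsSchwartzSolution T f) {t : ℝ} (ht : t ∈ Ioo 0 T) :
    (hf.slice ht : Vel → ℝ) = f t := rfl

lemma slice_nonneg (hf : IsSchwartzSolution T f) {t : ℝ} (ht : t ∈ Ioo 0 T) (v : Vel) :
    0 ≤ hf.slice ht v := hf.nonneg t (Ioo_subset_Icc_self ht) v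

lemma exists_iteratedFDeriv_bound (hf : IsSchwartzSolution T f) (k n : ℕ) :
    ∃ C, 0 ≤ C ∧ ∀ t ∈ Ioo 0 T, ∀ v,
      ‖iteratedFDeriv ℝ n (f t) v‖ ≤ C * ((1 + ‖v‖) ^ k)⁻¹ := by
  obtain ⟨C, hC⟩ := hf.decay k n
  obtain ⟨D, hD⟩ := hf.decay 0 n
  refine ⟨2 ^ (k - 1) * (|D| + |C|), by positivity, fun t ht v => ?_⟩
  have hk := (hC t ht v).trans (le_abs_self C)
  have h0 := (hD t ht v).trans (le_abs_self D)
  rw [pow_zero, one_mul] at h0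
  rw [← div_eq_mul_inv, le_div_iff₀ (by positivity), mul_comm]
  calc (1 + ‖v‖) ^ k * ‖iteratedFDeriv ℝ n (f t) v‖
      ≤ 2 ^ (k - 1) * (1 ^ k + ‖v‖ ^ k) * ‖iteratedFDeriv ℝ n (f t) v‖ := by
        gcongr
        exact add_pow_le zero_le_one (norm_nonneg v) k
    _ = 2 ^ (k - 1) * (‖iteratedFDeriv ℝ n (f t) v‖
          + ‖v‖ ^ k * ‖iteratedFDeriv ℝ n (f t) v‖) := by ring
    _ ≤ _ := by gcongr

lemma continuousOn_time (hf : IsSchwartzSolution T f) (v : Vel) :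
    ContinuousOn (fun t => f t v) (Icc 0 T) :=
  hf.continuousOn.comp (f := fun t : ℝ => (t, v)) (by fun_prop) fun _ ht => ⟨ht, mem_univ v⟩

lemma continuous_velocity (hf : IsSchwartzSolution T f) {t : ℝ} (ht : t ∈ Icc 0 T) :
    Continuous (f t) :=
  continuousOn_univ.mp (hf.continuousOn.comp (f := fun v : Vel => (t, v)) (by fun_prop)
    fun v _ => ⟨ht, mem_univ v⟩)

lemma exists_bound (hf : IsSchwartzSolution T f) (hT : 0 < T) (k : ℕ) :
    ∃ C, 0 ≤ C ∧ ∀ t ∈ Icc 0 T, ∀ v, |f t v| ≤ C * ((1 + ‖v‖) ^ k)⁻¹ := by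
  obtain ⟨C, hC, hbound⟩ := hf.exists_iteratedFDeriv_bound k 0
  refine ⟨C, hC, fun t ht v => ?_⟩
  have hclosure : closure (Ioo 0 T) = Icc 0 T := closure_Ioo hT.ne
  refine le_on_closure (s := Ioo 0 T) (f := fun t => |f t v|)
    (g := fun _ => C * ((1 + ‖v‖) ^ k)⁻¹) (fun s hs => ?_) ?_ continuousOn_const
    (hclosure ▸ ht)
  · simpa using hbound s hs v
  · rw [hclosure]
    exact (hf.continuousOn_time v).abs

lemma rapidDecay (hf : IsSchwartzSolution T f) (hT : 0 < T) {t : ℝ} (ht : t ∈ Icc 0 T) :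
    RapidDecay (f t) := fun k =>
  let ⟨C, hC, hbound⟩ := hf.exists_bound hT k
  ⟨C, hC, hbound t ht⟩

lemma exists_collision_bound (hf : IsSchwartzSolution T f) {k : ℕ} (hk : 4 ≤ k) :
    ∃ C, ∀ t ∈ Ioo 0 T, ∀ v, |collision (f t) v| ≤ C * ((1 + ‖v‖) ^ k)⁻¹ := by
  choose C hC hbound using hf.exists_iteratedFDeriv_bound k
  set B := C 0 + C 1 + C 2
  have hle {t : ℝ} (ht : t ∈ Ioo 0 T) (v : Vel) {n : ℕ} (hn : C n ≤ B) :
      ‖iteratedFDeriv ℝ n (f t) v‖ ≤ B * ((1 + ‖v‖) ^ k)⁻¹ :=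
    (hbound n t ht v).trans (by gcongr)
  refine ⟨24 * B ^ 2 * newtonianBound, fun t ht v => ?_⟩
  refine abs_collision_le (g := hf.slice ht) hk (fun v => ?_)
    (fun i v => (abs_pderiv_le _ i v).trans (hle ht v (by linarith [hC 0, hC 2])))
    (fun i j v => (abs_pderiv_pderiv_le _ i j v).trans (hle ht v (by linarith [hC 0, hC 1]))) v
  rw [← Real.norm_eq_abs, ← norm_iteratedFDeriv_zero (𝕜 := ℝ)]
  exact hle ht v (by linarith [hC 1, hC 2])

variable {W : Vel → ℝ} {p t : ℝ}

lemma hasDerivAt_integral_mul (hf : IsSchwartzSolution T f) (hT : 0 < T) (hW : Continuous W)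
    (hWp : PolyGrowth W) (ht : t ∈ Ioo 0 T) :
    HasDerivAt (fun s => ∫ v, W v * f s v) (∫ v, W v * collision (f t) v) t := by
  obtain ⟨n, C, hC, hWb⟩ := hWp
  obtain ⟨D, hcb⟩ := hf.exists_collision_bound (k := n + 4) (by omega)
  have ht' := Ioo_subset_Icc_self ht
  refine (hasDerivAt_integral_of_dominated_loc_of_deriv_le (μ := volume) (s := Ioo 0 T)
    (F := fun s v => W v * f s v) (F' := fun s v => W v * collision (f s) v)
    (bound := fun v => C * D * ((1 + ‖v‖) ^ 4)⁻¹) (Ioo_mem_nhds ht.1 ht.2) ?_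
    ((PolyGrowth.mul_rapidDecay ⟨n, C, hC, hWb⟩ (hf.rapidDecay hT ht')).integrable
      (hW.mul (hf.continuous_velocity ht')).aestronglyMeasurable)
    (hW.measurable.mul (measurable_collision _)).aestronglyMeasurable
    (ae_of_all _ fun v s hs => abs_mul_le_of_decay (norm_nonneg v) (hWb v) (hcb s hs v))
    (integrable_inv_one_add_norm_pow_four.const_mul _)
    (ae_of_all _ fun v s hs => (hf.equation s hs v).const_mul (W v))).2
  filter_upwards [Ioo_mem_nhds ht.1 ht.2] with s hs
  exact (hW.mul (hf.continuous_velocity (Ioo_subset_Icc_self hs))).aestronglyMeasurable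

lemma continuousOn_integral_mul (hf : IsSchwartzSolution T f) (hT : 0 < T) (hW : Continuous W)
    (hWp : PolyGrowth W) : ContinuousOn (fun s => ∫ v, W v * f s v) (Icc 0 T) := by
  obtain ⟨n, C, -, hWb⟩ := hWp
  obtain ⟨D, -, hcb⟩ := hf.exists_bound hT (n + 4)
  exact continuousOn_of_dominated (bound := fun v => C * D * ((1 + ‖v‖) ^ 4)⁻¹)
    (fun s hs => (hW.mul (hf.continuous_velocity hs)).aestronglyMeasurable)
    (fun s hs => ae_of_all _ fun v =>
      abs_mul_le_of_decay (norm_nonneg v) (hWb v) (hcb s hs v))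
    (integrable_inv_one_add_norm_pow_four.const_mul _)
    (ae_of_all _ fun v => continuousOn_const.mul (hf.continuousOn_time v))

lemma integral_eq (hf : IsSchwartzSolution T f) (hT : 0 < T) (ht : t ∈ Icc 0 T) :
    ∫ v, f t v = ∫ v, f 0 v := by
  rcases ht.1.eq_or_lt with rfl | ht0
  · rfl
  have hone : PolyGrowth fun _ : Vel => (1 : ℝ) := .const 1
  have hcont := (hf.continuousOn_integral_mul hT continuous_const hone).mono
    (Icc_subset_Icc_right ht.2)
  have hderiv (s : ℝ) (hs : s ∈ Ioo 0 t) : HasDerivAt (fun s => ∫ v, 1 * f s v) 0 s := by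
    have hs' : s ∈ Ioo 0 T := Ioo_subset_Ioo_right ht.2 hs
    have hmass := hf.hasDerivAt_integral_mul hT continuous_const hone hs'
    rwa [← integral_collision_eq_zero (hf.slice hs'), hf.coe_slice,
      ← funext fun v => one_mul (collision (f s) v)]
  obtain ⟨s, -, hs⟩ := exists_hasDerivAt_eq_slope _ _ ht0 hcont hderiv
  simp only [one_mul] at hs
  exact sub_eq_zero.mp ((div_eq_zero_iff.mp hs.symm).resolve_right (by linarith))

lemma integrable_rpow (hf : IsSchwartzSolution T f) (hT : 0 < T) (hp : 0 < p)
    (ht : t ∈ Icc 0 T) : Integrable fun v => f t v ^ p :=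
  ((hf.rapidDecay hT ht).rpow (hf.nonneg t ht) hp).integrable
    ((hf.continuous_velocity ht).rpow_const fun _ => Or.inr hp.le).aestronglyMeasurable

lemma hasDerivAt_integral_rpow (hf : IsSchwartzSolution T f) (hT : 0 < T) (hp : 1 < p)
    (ht : t ∈ Ioo 0 T) :
    HasDerivAt (fun s => ∫ v, f s v ^ p) (∫ v, p * f t v ^ (p - 1) * collision (f t) v) t := by
  obtain ⟨C, hC, hfb⟩ := hf.exists_bound hT 0
  obtain ⟨D, hcb⟩ := hf.exists_collision_bound (k := 4) le_rfl
  have hp0 : 0 < p := by linarith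
  have ht' := Ioo_subset_Icc_self ht
  have hpow (v : Vel) (s : ℝ) (hs : s ∈ Ioo 0 T) : f s v ^ (p - 1) ≤ C ^ (p - 1) := by
    have h0 := hf.nonneg s (Ioo_subset_Icc_self hs) v
    have hle := hfb s (Ioo_subset_Icc_self hs) v
    rw [pow_zero, inv_one, mul_one, abs_of_nonneg h0] at hle
    exact Real.rpow_le_rpow h0 hle (by linarith)
  refine (hasDerivAt_integral_of_dominated_loc_of_deriv_le (μ := volume) (s := Ioo 0 T)
    (F := fun s v => f s v ^ p) (F' := fun s v => p * f s v ^ (p - 1) * collision (f s) v)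
    (bound := fun v => p * C ^ (p - 1) * (D * ((1 + ‖v‖) ^ 4)⁻¹)) (Ioo_mem_nhds ht.1 ht.2) ?_
    (hf.integrable_rpow hT hp0 ht') ((((hf.continuous_velocity ht').rpow_const
      fun _ => Or.inr (by linarith)).measurable.const_mul p).mul
      (measurable_collision _)).aestronglyMeasurable
    (ae_of_all _ fun v s hs => ?_)
    ((integrable_inv_one_add_norm_pow_four.const_mul _).const_mul _)
    (ae_of_all _ fun v s hs => ?_)).2
  · filter_upwards [Ioo_mem_nhds ht.1 ht.2] with s hs
    exact ((hf.continuous_velocity (Ioo_subset_Icc_self hs)).rpow_const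
      fun _ => Or.inr hp0.le).aestronglyMeasurable
  · have h0 := Real.rpow_nonneg (hf.nonneg s (Ioo_subset_Icc_self hs) v) (p - 1)
    rw [norm_mul, Real.norm_of_nonneg (by positivity)]
    exact mul_le_mul (mul_le_mul_of_nonneg_left (hpow v s hs) hp0.le) (hcb s hs v)
      (abs_nonneg _) (by positivity)
  · refine ((hf.equation s hs v).rpow_const (Or.inr hp.le)).congr_deriv ?_
    ring

lemma continuousOn_integral_rpow (hf : IsSchwartzSolution T f) (hT : 0 < T) (hp : 1 < p) :
    ContinuousOn (fun s => ∫ v, f s v ^ p) (Icc 0 T) := by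
  obtain ⟨C, hC, hfb⟩ := hf.exists_bound hT 4
  have hp0 : 0 < p := by linarith
  refine continuousOn_of_dominated (bound := fun v => C ^ p * ((1 + ‖v‖) ^ 4)⁻¹)
    (fun s hs => (hf.integrable_rpow hT hp0 hs).aestronglyMeasurable)
    (fun s hs => ae_of_all _ fun v => ?_) (integrable_inv_one_add_norm_pow_four.const_mul _)
    (ae_of_all _ fun v => (hf.continuousOn_time v).rpow_const fun _ _ => Or.inr hp0.le)
  have h0 := hf.nonneg s hs v
  have hle : ((1 + ‖v‖) ^ 4)⁻¹ ≤ 1 := inv_le_one_of_one_le₀ (one_le_pow₀ (by simp))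
  rw [Real.norm_of_nonneg (Real.rpow_nonneg h0 p)]
  calc f s v ^ p ≤ (C * ((1 + ‖v‖) ^ 4)⁻¹) ^ p :=
        Real.rpow_le_rpow h0 ((le_abs_self _).trans (hfb s hs v)) hp0.le
    _ = C ^ p * (((1 + ‖v‖) ^ 4)⁻¹) ^ p := Real.mul_rpow hC (by positivity)
    _ ≤ C ^ p * ((1 + ‖v‖) ^ 4)⁻¹ := by
        gcongr
        exact Real.rpow_le_self_of_le_one (by positivity) hle hp.le

lemma lintegral_dissipation (hf : IsSchwartzSolution T f) (hp : 1 < p) (ht : t ∈ Ioo 0 T) :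
    ∫⁻ v, ENNReal.ofReal (dissipation p (f t) v)
      = ENNReal.ofReal (∫ v, dissipation p (f t) v) :=
  (ofReal_integral_eq_lintegral_ofReal
    (integrable_dissipation (g := hf.slice ht) (hf.slice_nonneg ht) hp)
    (ae_of_all _ (dissipation_nonneg p (f t)))).symm

end IsSchwartzSolution

end evolution

/-! ### Propagation -/

section continuation

lemma sub_le_of_hasDerivAt_le {Y Y' : ℝ → ℝ} {a t C : ℝ} (ht : a ≤ t)
    (hc : ContinuousOn Y (Icc a t)) (hd : ∀ s ∈ Ioo a t, HasDerivAt Y (Y' s) s)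
    (hb : ∀ s ∈ Ioo a t, Y' s ≤ C) : Y t - Y a ≤ C * (t - a) :=
  have hint {s : ℝ} (hs : s ∈ interior (Icc a t)) : s ∈ Ioo a t := interior_Icc.subset hs
  (convex_Icc a t).image_sub_le_mul_sub_of_deriv_le hc
    (fun s hs => (hd s (hint hs)).differentiableAt.differentiableWithinAt)
    (fun s hs => (hd s (hint hs)).deriv.trans_le (hb s (hint hs)))
    a (left_mem_Icc.mpr ht) t (right_mem_Icc.mpr ht) ht

lemma forall_lt_of_forall_lt_imp_lt {φ : ℝ → ℝ} {a τ b : ℝ} (hφ : ContinuousOn φ (Icc a τ))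
    (hstep : ∀ t ∈ Icc a τ, (∀ s ∈ Ioo a t, φ s < b) → φ t < b) : ∀ t ∈ Icc a τ, φ t < b := by
  by_contra! hbad
  obtain ⟨t₁, ht₁, hφ₁⟩ := hbad
  have hcompact : IsCompact (Icc a τ ∩ φ ⁻¹' Ici b) :=
    isCompact_Icc.of_isClosed_subset (hφ.preimage_isClosed_of_isClosed isClosed_Icc isClosed_Ici)
      inter_subset_left
  obtain ⟨t₀, ⟨ht₀, hφ₀⟩, hfirst⟩ := hcompact.exists_isLeast ⟨t₁, ht₁, hφ₁⟩
  refine (hstep t₀ ht₀ fun s hs => ?_).not_ge hφ₀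
  by_contra! hs'
  exact (hfirst ⟨⟨hs.1.le, hs.2.le.trans ht₀.2⟩, hs'⟩).not_gt hs.2

lemma le_of_bootstrap {Y Y' E E' : ℝ → ℝ} {τ K M C : ℝ} (hYc : ContinuousOn Y (Icc 0 τ))
    (hEc : ContinuousOn E (Icc 0 τ)) (hYd : ∀ s ∈ Ioo 0 τ, HasDerivAt Y (Y' s) s)
    (hEd : ∀ s ∈ Ioo 0 τ, HasDerivAt E (E' s) s) (hY0 : Y 0 ≤ K) (hE0 : E 0 ≤ M)
    (hb : ∀ s ∈ Ioo 0 τ, Y s ≤ K + 1 → E s ≤ M + 1 → Y' s ≤ C ∧ E' s ≤ C)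
    (hC : 0 ≤ C) (hCτ : C * τ < 1) : ∀ t ∈ Icc 0 τ, Y t ≤ K + 1 ∧ E t ≤ M + 1 := by
  suffices h : ∀ t ∈ Icc 0 τ, max (Y t - K) (E t - M) < 1 from fun t ht =>
    ⟨by linarith [(max_lt_iff.mp (h t ht)).1], by linarith [(max_lt_iff.mp (h t ht)).2]⟩
  refine forall_lt_of_forall_lt_imp_lt
    ((hYc.sub continuousOn_const).sup (hEc.sub continuousOn_const)) fun t ht hbelow => ?_
  have hsub : Ioo 0 t ⊆ Ioo 0 τ := Ioo_subset_Ioo_right ht.2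
  have hslope (s : ℝ) (hs : s ∈ Ioo 0 t) : Y' s ≤ C ∧ E' s ≤ C :=
    have hlt := max_lt_iff.mp (hbelow s hs)
    hb s (hsub hs) (by linarith [hlt.1]) (by linarith [hlt.2])
  have hY := sub_le_of_hasDerivAt_le ht.1 (hYc.mono (Icc_subset_Icc_right ht.2))
    (fun s hs => hYd s (hsub hs)) fun s hs => (hslope s hs).1
  have hE := sub_le_of_hasDerivAt_le ht.1 (hEc.mono (Icc_subset_Icc_right ht.2))
    (fun s hs => hEd s (hsub hs)) fun s hs => (hslope s hs).2
  have hCt : C * t < 1 := (mul_le_mul_of_nonneg_left ht.2 hC).trans_lt hCτ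
  exact max_lt (by linarith) (by linarith)

lemma lintegral_le_of_hasDerivAt {Y Y' D : ℝ → ℝ} {τ C κ : ℝ} (hτ : 0 ≤ τ) (hκ : 0 < κ)
    (hYc : ContinuousOn Y (Icc 0 τ)) (hYd : ∀ s ∈ Ioo 0 τ, HasDerivAt Y (Y' s) s)
    (hD : ∀ s ∈ Ioo 0 τ, 0 ≤ D s) (hb : ∀ s ∈ Ioo 0 τ, Y' s ≤ C - κ * D s) (hYτ : 0 ≤ Y τ) :
    ∫⁻ t in Ioo 0 τ, ENNReal.ofReal (D t) ≤ ENNReal.ofReal ((Y 0 + C * τ) / κ) := by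
  set G : ℝ → ℝ := fun t => (C * t - Y t) / κ with hG
  have hGc : ContinuousOn G (Icc 0 τ) :=
    ((continuousOn_const.mul continuousOn_id).sub hYc).div_const κ
  have hGd (s : ℝ) (hs : s ∈ Ioo 0 τ) : HasDerivAt G ((C - Y' s) / κ) s := by
    simpa using! (((hasDerivAt_id s).const_mul C).sub (hYd s hs)).div_const κ
  have hDG (s : ℝ) (hs : s ∈ Ioo 0 τ) : D s ≤ (C - Y' s) / κ := by
    rw [le_div_iff₀ hκ]
    linarith [hb s hs]
  have hG0 (s : ℝ) (hs : s ∈ Ioo 0 τ) : 0 ≤ (C - Y' s) / κ := (hD s hs).trans (hDG s hs)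
  have hint : IntegrableOn (fun s => (C - Y' s) / κ) (Ioc 0 τ) :=
    intervalIntegral.integrableOn_deriv_of_nonneg hGc hGd hG0
  have hFTC : ∫ s in (0 : ℝ)..τ, (C - Y' s) / κ = G τ - G 0 :=
    intervalIntegral.integral_eq_sub_of_hasDerivAt_of_le hτ hGc hGd
      ((intervalIntegrable_iff_integrableOn_Ioc_of_le hτ).mpr hint)
  calc ∫⁻ t in Ioo 0 τ, ENNReal.ofReal (D t)
      ≤ ∫⁻ t in Ioo 0 τ, ENNReal.ofReal ((C - Y' t) / κ) :=
        setLIntegral_mono' measurableSet_Ioo fun t ht => ENNReal.ofReal_le_ofReal (hDG t ht)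
    _ = ENNReal.ofReal (∫ t in Ioo 0 τ, (C - Y' t) / κ) :=
        (ofReal_integral_eq_lintegral_ofReal (hint.mono_set Ioo_subset_Ioc_self)
          ((ae_restrict_iff' measurableSet_Ioo).mpr (ae_of_all _ hG0))).symm
    _ = ENNReal.ofReal ((Y 0 - Y τ + C * τ) / κ) := by
        rw [← integral_Ioc_eq_integral_Ioo, ← intervalIntegral.integral_of_le hτ, hFTC, hG]
        ring_nf
    _ ≤ ENNReal.ofReal ((Y 0 + C * τ) / κ) := by
        gcongr
        linarith

end continuation

section apriori

variable {g : 𝓢(Vel, ℝ)} {p m M K ρ : ℝ}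

lemma two_le_of_moment_exponent_lt (hp : 3 / 2 < p)
    (hm : 9 / 2 * ((p - 1) / (p - 3 / 2)) < m) : 2 ≤ m := by
  have : 1 ≤ (p - 1) / (p - 3 / 2) := (one_le_div (by linarith)).mpr (by linarith)
  linarith

lemma integral_mul_le_integral_bracket_rpow_mul (h0 : ∀ v, 0 ≤ g v) {W : Vel → ℝ}
    (hW0 : ∀ v, 0 ≤ W v) (hW : ∀ v, W v ≤ bracket v ^ m) :
    ∫ v, W v * g v ≤ ∫ v, bracket v ^ m * g v :=
  integral_mono_of_nonneg (ae_of_all _ fun v => mul_nonneg (hW0 v) (h0 v))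
    (by simpa only [Real.rpow_one] using integrable_bracket_rpow_mul_rpow h0 m one_pos)
    (ae_of_all _ fun v => mul_le_mul_of_nonneg_right (hW v) (h0 v))

lemma integral_le_integral_bracket_rpow_mul (h0 : ∀ v, 0 ≤ g v) (hm : 0 ≤ m) :
    ∫ v, g v ≤ ∫ v, bracket v ^ m * g v := by
  simpa only [one_mul] using integral_mul_le_integral_bracket_rpow_mul h0
    (fun _ => zero_le_one) fun v => Real.one_le_rpow (one_le_bracket v) hm

lemma integral_norm_sq_mul_le_integral_bracket_rpow_mul (h0 : ∀ v, 0 ≤ g v) (hm : 2 ≤ m) :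
    ∫ v, ‖v‖ ^ 2 * g v ≤ ∫ v, bracket v ^ m * g v :=
  integral_mul_le_integral_bracket_rpow_mul h0 (fun _ => sq_nonneg _) fun v =>
    calc ‖v‖ ^ 2 ≤ bracket v ^ 2 := pow_le_pow_left₀ (norm_nonneg v) (norm_le_bracket v) 2
      _ = bracket v ^ (2 : ℝ) := (Real.rpow_two _).symm
      _ ≤ bracket v ^ m := Real.rpow_le_rpow_of_exponent_le (one_le_bracket v) hm

/- The quadratic term `∫ g ^ (p + 1)` is interpolated with a weight `η` so small that it costs
only half of the dissipation produced by the coercivity of `A[g]`. -/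
lemma exists_integral_rpow_mul_collision_le (hp : 3 / 2 < p)
    (hm : 9 / 2 * ((p - 1) / (p - 3 / 2)) < m) (hρ : 0 < ρ) (hM : 0 ≤ M) (hK : 0 ≤ K) :
    ∃ κ C : ℝ, 0 < κ ∧ 0 ≤ C ∧ ∀ g : 𝓢(Vel, ℝ), (∀ v, 0 ≤ g v) → ρ ≤ ∫ v, g v →
      ∫ v, bracket v ^ m * g v ≤ M → ∫ v, g v ^ p ≤ K →
      ∫ v, p * g v ^ (p - 1) * collision g v ≤ C - κ * ∫ v, dissipation p g v := by
  have : 0 < p := by linarith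
  have hp1 : 0 < p - 1 := by linarith
  have hdrift := driftConst_nonneg
  obtain ⟨c, hc, hcoercive⟩ := exists_coercivity (by linarith : 1 < p) hρ M K
  set η := 2 * c / (p * (driftConst + 1))
  obtain ⟨C, hC, hinterp⟩ := exists_interpolation hp hm hM hK (by positivity : 0 < η)
  refine ⟨2 * (p - 1) / p * c, (p - 1) * (driftConst * C), by positivity, by positivity,
    fun g h0 hmass hmom hLp => ?_⟩
  have henergy := (integral_norm_sq_mul_le_integral_bracket_rpow_mul h0
    (two_le_of_moment_exponent_lt hp hm)).trans hmom
  have hD : 0 ≤ ∫ v, dissipation p g v := integral_nonneg (dissipation_nonneg p g)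
  have hη : (p - 1) * (driftConst * η) ≤ 2 * (p - 1) / p * c := by
    have hratio : driftConst / (driftConst + 1) ≤ 1 := (div_le_one (by positivity)).mpr (by simp)
    calc (p - 1) * (driftConst * η)
        = 2 * (p - 1) / p * c * (driftConst / (driftConst + 1)) := by
          simp only [η]
          field_simp
      _ ≤ 2 * (p - 1) / p * c := mul_le_of_le_one_right (by positivity) hratio
  calc ∫ v, p * g v ^ (p - 1) * collision g v
      ≤ -(4 * (p - 1) / p * c * ∫ v, dissipation p g v)
          + (p - 1) * (driftConst * ∫ v, g v ^ (p + 1)) :=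
        integral_rpow_mul_collision_le h0 hp (hcoercive g h0 hmass henergy hLp)
    _ ≤ -(4 * (p - 1) / p * c * ∫ v, dissipation p g v)
          + (p - 1) * (driftConst * (η * (∫ v, dissipation p g v) + C)) := by
        gcongr
        exact hinterp g h0 hmom hLp
    _ = (p - 1) * (driftConst * C) + (p - 1) * (driftConst * η) * (∫ v, dissipation p g v)
          - 2 * (2 * (p - 1) / p * c) * ∫ v, dissipation p g v := by ring
    _ ≤ (p - 1) * (driftConst * C) - 2 * (p - 1) / p * c * ∫ v, dissipation p g v := by
        linarith [mul_le_mul_of_nonneg_right hη hD]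

lemma exists_integral_bracket_mul_collision_le (hp : 3 / 2 < p) (hm : 2 ≤ m) (hM : 0 ≤ M)
    (hK : 0 ≤ K) : ∃ C : ℝ, 0 ≤ C ∧ ∀ g : 𝓢(Vel, ℝ), (∀ v, 0 ≤ g v) →
      ∫ v, bracket v ^ m * g v ≤ M → ∫ v, g v ^ p ≤ K → ∫ v, bracket v ^ m * collision g v ≤ C := by
  set B := M + K + ∫ z, nearPow (p / (p - 1)) z
  have hB : 0 ≤ B :=
    add_nonneg (add_nonneg hM hK) (integral_nonneg (nearPow_nonneg (p / (p - 1))))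
  refine ⟨21 * (m ^ 2 * B * M), by positivity, fun g h0 hmom hLp => ?_⟩
  have hmass := (integral_le_integral_bracket_rpow_mul h0 (by linarith)).trans hmom
  have hconv (v : Vel) : conv (fun z => ‖z‖⁻¹) g v ≤ B :=
    (conv_inv_norm_le hp h0 v).trans (by simp only [B]; gcongr)
  calc ∫ v, bracket v ^ m * collision g v
      ≤ 21 * (m ^ 2 * B * ∫ v, bracket v ^ m * g v) :=
        (le_abs_self _).trans (abs_integral_bracket_mul_collision_le hm h0 hconv)
    _ ≤ 21 * (m ^ 2 * B * M) := by gcongr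

lemma exists_apriori (hp : 3 / 2 < p) (hm : 9 / 2 * ((p - 1) / (p - 3 / 2)) < m) (hρ : 0 < ρ)
    (hM : 0 ≤ M) (hK : 0 ≤ K) : ∃ κ C : ℝ, 0 < κ ∧ 0 ≤ C ∧
    ∀ g : 𝓢(Vel, ℝ), (∀ v, 0 ≤ g v) → ρ ≤ ∫ v, g v → ∫ v, bracket v ^ m * g v ≤ M →
      ∫ v, g v ^ p ≤ K →
      ∫ v, p * g v ^ (p - 1) * collision g v ≤ C - κ * ∫ v, dissipation p g v ∧
      ∫ v, bracket v ^ m * collision g v ≤ C := by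
  obtain ⟨κ, C₁, hκ, hC₁, hLp⟩ := exists_integral_rpow_mul_collision_le hp hm hρ hM hK
  obtain ⟨C₂, hC₂, hmom⟩ :=
    exists_integral_bracket_mul_collision_le hp (two_le_of_moment_exponent_lt hp hm) hM hK
  exact ⟨κ, C₁ + C₂, hκ, add_nonneg hC₁ hC₂, fun g h0 hmass hE hY =>
    ⟨by linarith [hLp g h0 hmass hE hY], by linarith [hmom g h0 hE hY]⟩⟩

end apriori

section lebesgue

variable {α : Type*} [MeasurableSpace α] {μ : Measure α} {p : ℝ} {g : α → ℝ}

lemma eLpNorm_rpow_eq (h0 : ∀ x, 0 ≤ g x) (hp : 0 < p) (hi : Integrable (fun x => g x ^ p) μ) :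
    eLpNorm g (ENNReal.ofReal p) μ ^ p = ENNReal.ofReal (∫ x, g x ^ p ∂μ) := by
  rw [eLpNorm_eq_lintegral_rpow_enorm_toReal (by simpa using hp) ENNReal.ofReal_ne_top,
    ENNReal.toReal_ofReal hp.le, ← ENNReal.rpow_mul, one_div_mul_cancel hp.ne', ENNReal.rpow_one,
    ofReal_integral_eq_lintegral_ofReal hi (ae_of_all _ fun x => Real.rpow_nonneg (h0 x) p)]
  refine lintegral_congr fun x => ?_
  rw [Real.enorm_of_nonneg (h0 x), ENNReal.ofReal_rpow_of_nonneg (h0 x) hp.le]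

lemma integral_rpow_le_of_eLpNorm_le (h0 : ∀ x, 0 ≤ g x) (hp : 0 < p)
    (hi : Integrable (fun x => g x ^ p) μ) {N : NNReal}
    (hN : eLpNorm g (ENNReal.ofReal p) μ ≤ N) : ∫ x, g x ^ p ∂μ ≤ (N : ℝ) ^ p := by
  have hpow := ENNReal.rpow_le_rpow hN hp.le
  rwa [eLpNorm_rpow_eq h0 hp hi, ← ENNReal.ofReal_coe_nnreal,
    ENNReal.ofReal_rpow_of_nonneg N.coe_nonneg hp.le,
    ENNReal.ofReal_le_ofReal_iff (by positivity)] at hpow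

lemma integral_le_of_lintegral_le (h0 : ∀ x, 0 ≤ g x) {M : NNReal}
    (hM : ∫⁻ x, ENNReal.ofReal (g x) ∂μ ≤ M) : ∫ x, g x ∂μ ≤ M := by
  by_cases hg : Integrable g μ
  · rw [← ENNReal.ofReal_le_ofReal_iff M.coe_nonneg,
      ofReal_integral_eq_lintegral_ofReal hg (ae_of_all _ h0)]
    exact hM.trans_eq ENNReal.ofReal_coe_nnreal.symm
  · exact (integral_undef hg).trans_le M.coe_nonneg

end lebesgue

/- On `[0, T₀]` neither `∫ f ^ p` nor the moment can grow by more than `1 / 2`, so the a priori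
estimate, which presupposes a growth of at most `1`, never ceases to apply. -/
lemma IsSchwartzSolution.exists_propagation {p m ρ M K : ℝ} (hp : 3 / 2 < p)
    (hm : 9 / 2 * ((p - 1) / (p - 3 / 2)) < m) (hρ : 0 < ρ) (hM : 0 ≤ M) (hK : 0 ≤ K) :
    ∃ T₀ C : ℝ, 0 < T₀ ∧ 0 ≤ C ∧ ∀ (T : ℝ) (f : ℝ → Vel → ℝ), 0 < T → IsSchwartzSolution T f →
      ρ ≤ ∫ v, f 0 v → ∫ v, bracket v ^ m * f 0 v ≤ M → ∫ v, f 0 v ^ p ≤ K →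
      (∀ t ∈ Icc 0 (min T T₀), ∫ v, f t v ^ p ≤ K + 1) ∧
      ∫⁻ t in Ioo 0 (min T T₀), ENNReal.ofReal (∫ v, dissipation p (f t) v)
        ≤ ENNReal.ofReal C := by
  obtain ⟨κ, C, hκ, hC, hapriori⟩ := exists_apriori hp hm hρ (M := M + 1) (K := K + 1)
    (by positivity) (by positivity)
  refine ⟨1 / (2 * (C + 1)), (K + 1 / 2) / κ, by positivity, by positivity,
    fun T f hT hf hmass hmom hLp => ?_⟩
  set τ := min T (1 / (2 * (C + 1)))
  have hτ : 0 < τ := lt_min hT (by positivity)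
  have hCτ : C * τ ≤ 1 / 2 := by
    have hle : τ * (2 * (C + 1)) ≤ 1 := (le_div_iff₀ (by positivity)).mp (min_le_right _ _)
    linarith
  have hsub : Ioo 0 τ ⊆ Ioo 0 T := Ioo_subset_Ioo_right (min_le_left _ _)
  have hsub' : Icc 0 τ ⊆ Icc 0 T := Icc_subset_Icc_right (min_le_left _ _)
  have hYc := (hf.continuousOn_integral_rpow hT (by linarith : 1 < p)).mono hsub'
  have hYd (s : ℝ) (hs : s ∈ Ioo 0 τ) :=
    hf.hasDerivAt_integral_rpow hT (by linarith : 1 < p) (hsub hs)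
  have hD (s : ℝ) : 0 ≤ ∫ v, dissipation p (f s) v := integral_nonneg (dissipation_nonneg p (f s))
  have hstep (s : ℝ) (hs : s ∈ Ioo 0 τ) := hapriori (hf.slice (hsub hs)) (hf.slice_nonneg (hsub hs))
    (hmass.trans_eq (hf.integral_eq hT (Ioo_subset_Icc_self (hsub hs))).symm)
  have hbound := le_of_bootstrap hYc ((hf.continuousOn_integral_mul hT (continuous_bracket_rpow m)
      (polyGrowth_bracket_rpow m)).mono hsub') hYd (fun s hs => hf.hasDerivAt_integral_mul hT
      (continuous_bracket_rpow m) (polyGrowth_bracket_rpow m) (hsub hs)) hLp hmom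
    (fun s hs hY hE => (hstep s hs hE hY).imp_left fun h =>
      h.trans (sub_le_self _ (mul_nonneg hκ.le (hD s)))) hC (by linarith)
  refine ⟨fun t ht => (hbound t ht).1, (lintegral_le_of_hasDerivAt hτ.le hκ hYc hYd
    (fun s _ => hD s) (fun s hs => ?_) ?_).trans (ENNReal.ofReal_le_ofReal (by gcongr))⟩
  · have hs' := hbound s (Ioo_subset_Icc_self hs)
    exact (hstep s hs hs'.2 hs'.1).1
  · exact integral_nonneg fun v =>
      Real.rpow_nonneg (hf.nonneg τ (hsub' (right_mem_Icc.mpr hτ.le)) v) p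

end

end Landau

open Landau

theorem proposition3p1_general (p m ρ : ℝ) (M N : NNReal) (hp : 3 / 2 < p)
    (hm : 9 / 2 * ((p - 1) / (p - 3 / 2)) < m) (hρ : 0 < ρ) :
    ∃ T₀ : ℝ, 0 < T₀ ∧ ∃ C : ℝ, ∀ (T : ℝ) (f : ℝ → Vel → ℝ), 0 < T →
      IsSchwartzSolution T f →
      ρ ≤ ∫ v, f 0 v →
      ∫⁻ v, ENNReal.ofReal (bracket v ^ m * f 0 v) ≤ M →
      eLpNorm (f 0) (ENNReal.ofReal p) volume ≤ N →
      (⨆ t ∈ Ioo 0 (min T T₀), eLpNorm (f t) (ENNReal.ofReal p) volume ^ p) +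
          (∫⁻ t in Ioo 0 (min T T₀), ∫⁻ v, ENNReal.ofReal
            (bracket v ^ (-3 : ℝ) * ‖gradient (fun w => f t w ^ (p / 2)) v‖ ^ 2))
        ≤ ENNReal.ofReal C := by
  have hp0 : 0 < p := by linarith
  obtain ⟨T₀, D, hT₀, hD, hprop⟩ := IsSchwartzSolution.exists_propagation hp hm hρ M.coe_nonneg
    (by positivity : 0 ≤ (N : ℝ) ^ p)
  refine ⟨T₀, hT₀, (N : ℝ) ^ p + 1 + D, fun T f hT hf hmass hmom hLp => ?_⟩
  have h0 : (0 : ℝ) ∈ Icc 0 T := left_mem_Icc.mpr hT.le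
  have hmom' : ∫ v, bracket v ^ m * f 0 v ≤ M := integral_le_of_lintegral_le
    (fun v => mul_nonneg (bracket_rpow_pos v m).le (hf.nonneg 0 h0 v)) hmom
  have hLp' : ∫ v, f 0 v ^ p ≤ (N : ℝ) ^ p :=
    integral_rpow_le_of_eLpNorm_le (hf.nonneg 0 h0) hp0 (hf.integrable_rpow hT hp0 h0) hLp
  obtain ⟨hbound, hdiss⟩ := hprop T f hT hf hmass hmom' hLp'
  have hsub : Icc 0 (min T T₀) ⊆ Icc 0 T := Icc_subset_Icc_right (min_le_left _ _)
  rw [ENNReal.ofReal_add (by positivity) hD]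
  refine add_le_add (iSup₂_le fun t ht => ?_) ((setLIntegral_congr_fun measurableSet_Ioo
    fun t ht => hf.lintegral_dissipation (by linarith)
      (Ioo_subset_Ioo_right (min_le_left _ _) ht)).trans_le hdiss)
  have ht' := Ioo_subset_Icc_self ht
  rw [eLpNorm_rpow_eq (hf.nonneg t (hsub ht')) hp0 (hf.integrable_rpow hT hp0 (hsub ht'))]
  exact ENNReal.ofReal_le_ofReal (hbound t ht')

theorem proposition3p1 (p m M N : ℝ) (hp : 3 / 2 < p)
    (hm : 9 / 2 * ((p - 1) / (p - 3 / 2)) < m) (hM : 0 < M) :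
    ∃ T₀ : ℝ, 0 < T₀ ∧ ∃ C : ℝ, ∀ (T : ℝ) (f : ℝ → Landau.Vel → ℝ), 0 < T →
      Landau.IsSchwartzSolution T f →
      Landau.IsNormalized (f 0) →
      (∫⁻ v, ENNReal.ofReal (Landau.bracket v ^ m * f 0 v)) +
          (∫⁻ v, ENNReal.ofReal (f 0 v * |Real.log (f 0 v)|)) ≤ ENNReal.ofReal M →
      eLpNorm (f 0) (ENNReal.ofReal p) volume ≤ ENNReal.ofReal N →
      (⨆ t ∈ Ioo 0 (min T T₀), eLpNorm (f t) (ENNReal.ofReal p) volume ^ p) +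
          (∫⁻ t in Ioo 0 (min T T₀), ∫⁻ v, ENNReal.ofReal
            (Landau.bracket v ^ (-3 : ℝ) * ‖gradient (fun w => f t w ^ (p / 2)) v‖ ^ 2))
        ≤ ENNReal.ofReal C := by
  obtain ⟨T₀, hT₀, C, hC⟩ := proposition3p1_general p m 1 M.toNNReal N.toNNReal hp hm one_pos
  exact ⟨T₀, hT₀, C, fun T f hT hf hnorm hmom hLp =>
    hC T f hT hf hnorm.1.ge (le_self_add.trans hmom) hLp⟩
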